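/- Let $X$ be a smooth complex variety and let $Z\subset X$ be a closed subscheme with ideal sheaf $\mathcal I\subset\mathcal O_X$. All $\mathcal D$-modules are left and quasi-coherent over $\mathcal O$. **Definitions.** (1) Let $Y$ be a smooth complex variety with functions $t_1,\dots,t_r$ that are part of a local coordinate system, and let $T=\{t=0\}$ have ideal $\mathcal J=(t_1,\dots,t_r)$. Put $V^j\mathcal D_Y=\{P\in\mathcal D_Y : P\mathcal J^i\subset\mathcal J^{i+j}\ \text{for all } i\in\mathbf Z\}$, where $\mathcal J^i=\mathcal O_Y$ for $i\le 0$. The *$V$-filtration along $T$* on a coherent $\mathcal D_Y$-module $M$ is an exhaustive decreasing filtration $(V^\alpha M)_{\alpha\in\mathbf R}$ by coherent $V^0\mathcal D_Y$-submodules such that, with $V^{>\alpha}=\bigcup_{\beta>\alpha}V^\beta M$ and $\mathrm{Gr}_V^\alpha=V^\alpha M/V^{>\alpha}$: (i) $V^\alpha M=\bigcap_{\beta<\alpha}V^\beta M$; every bounded interval contains only finitely many $\alpha$ with $\mathrm{Gr}_V^\alpha\ne0$, and these $\alpha$ are rational; (ii) $(V^j\mathcal D_Y)(V^\alpha M)\subset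 V^{\alpha+j}M$ for all $j\in\mathbf Z$; (iii) $\sum_j t_jV^\alpha M=V^{\alpha+1}M$ for $\alpha\gg0$; (iv) $\sum_j\partial_{t_j}t_j-\alpha$ is nilpotent on $\mathrm{Gr}_V^\alpha$ for every $\alpha$. (The "eventually" in (iii) and the nilpotency in (iv) are understood locally on $Y$.) (2) Let $f=(f_1,\dots,f_r)$ be functions on $X$ and let $N$ be a $\mathcal D_X$-module. The direct image of $N$ under $i_f:X\to X\times\mathbf A^r$, $x\mapsto(x,f(x))$, is $M_f=N\otimes\mathbf C[\partial_{t_1},\dots,\partial_{t_r}]$, on which functions $g$ and vector fields $\xi$ on $X$ and the $t_j,\partial_{t_j}$ act by $$g(m\otimes\partial_t^\nu)=gm\otimes\partial_t^\nu,\qquad \xi(m\otimes\partial_t^\nu)=\xi m\otimes\partial_t^\nu-\sum_j\xi(f_j)m\otimes\partial_{t_j}\partial_t^\nu,$$ $$\partial_{t_j}(m\otimes\partial_t^\nu)=m\otimes\partial_{t_j}\partial_t^\nu,\qquad t_j(m\otimes\partial_t^\nu)=f_jm\otimes\partial_t^\nu-\nu_jm\otimes\partial_t^{\nu-e_j}.$$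 If $M_f$ has a $V$-filtration along $X\times\{0\}$, then the $V$-filtration on $N$ defined by $f$ is $V^\alpha N=(N\otimes1)\cap V^\alpha M_f$. **Proposition.** Let $f_1,\dots,f_r$ and $g_1,\dots,g_{r'}$ be two systems of functions on $X$ that generate $\mathcal I$, and let $N$ be a $\mathcal D_X$-module. (a) If the direct images $M_f$ and $M_g$ of $N$ have $V$-filtrations along $X\times\{0\}$, then the $V$-filtrations on $N$ defined by $f$ and by $g$ coincide. Thus the $V$-filtration on $N$ along $Z$ depends only on $\mathcal I$ and not on the generators. (b) Over an affine open subset of $X$, let $g_j=\sum_i a_{ij}f_i$ with functions $a_{ij}$, let $M=M_f$, and let $M'=M\otimes\mathbf C[\partial_{u_1},\dots,\partial_{u_{r'}}]$ be the direct image of $M$ under the embedding $X\times\mathbf A^r\to X\times\mathbf A^r\times\mathbf A^{r'}$, $(x,t)\mapsto(x,t,t')$, $t'_j=\sum_i a_{ij}(x)t_i$. If $(V^\alpha M)_\alpha$ is the $V$-filtration on $M$ along $X\times\{0\}$, then $$V^\alpha M'=\sum_{\nu\in\mathbf N^{r'}}V^{\alpha+|\nu|}M\otimes\partial_u^\nu$$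 is the $V$-filtration on $M'$ along $X\times\{0\}\times\{0\}$. -/

import Mathlib

open MvPolynomial

namespace DMod

section DiffOp
variable (A : Type*) [CommRing A] [Algebra ℂ A]

/-- The ring of differential operators of a smooth affine variety with coordinate ring `A`:
the algebra of operators on `A` generated by multiplications and derivations. -/
def DiffOp : Subalgebra ℂ (Module.End ℂ A) :=
  Algebra.adjoin ℂ (Set.range (Algebra.lmul ℂ A) ∪
    Set.range (fun θ : Derivation ℂ A A => (θ : A →ₗ[ℂ] A)))

variable {A}

/-- Functions as differential operators of order zero. -/
def ofFun : A →+* DiffOp A :=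
  RingHom.codRestrict (Algebra.lmul ℂ A : A →ₐ[ℂ] Module.End ℂ A).toRingHom (DiffOp A)
    fun a => Algebra.subset_adjoin (Or.inl ⟨a, rfl⟩)

/-- Vector fields as differential operators. -/
def ofDer (θ : Derivation ℂ A A) : DiffOp A :=
  ⟨(θ : A →ₗ[ℂ] A), Algebra.subset_adjoin (Or.inr ⟨θ, rfl⟩)⟩

theorem ofFun_coe (a b : A) : (ofFun a : Module.End ℂ A) b = a * b := rfl

theorem ofDer_coe (θ : Derivation ℂ A A) (b : A) : (ofDer θ : Module.End ℂ A) b = θ b := rfl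

theorem ofDer_add (θ η : Derivation ℂ A A) : ofDer (θ + η) = ofDer θ + ofDer η := rfl

theorem ofDer_smul (a : A) (θ : Derivation ℂ A A) : ofDer (a • θ) = ofFun a * ofDer θ := by
  ext b; rfl

theorem ofDer_mul_ofFun (θ : Derivation ℂ A A) (a : A) :
    ofDer θ * ofFun a = ofFun a * ofDer θ + ofFun (θ a) := by
  ext b
  change θ (a * b) = a * θ b + θ a * b
  rw [Derivation.leibniz, smul_eq_mul, smul_eq_mul, mul_comm b]

theorem ofDer_lie (θ η : Derivation ℂ A A) :
    ofDer ⁅θ, η⁆ = ofDer θ * ofDer η - ofDer η * ofDer θ := by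
  ext b; rfl

variable (A) in
/-- `θ = ∑ θ(gₚ) eₚ` for all vector fields `θ`: a finite system of functions `gₚ` whose
differentials generate, together with a dual system `eₚ` of vector fields. -/
theorem exists_dual [Algebra.Smooth ℂ A] :
    ∃ (n : ℕ) (g : Fin n → A) (e : Fin n → Derivation ℂ A A),
      ∀ θ : Derivation ℂ A A, θ = ∑ p, θ (g p) • e p := by
  classical
  have hfin : (Submodule.span A (Set.range (KaehlerDifferential.D ℂ A))).FG := by
    rw [KaehlerDifferential.span_range_derivation]; exact Module.Finite.fg_top
  obtain ⟨s, hs, hspan⟩ := (Submodule.fg_span_iff_fg_span_finset_subset _).mp hfin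
  choose pre hpre using fun x : s => hs x.2
  let v : Fin s.card → A := fun p => pre (s.equivFin.symm p)
  have hv : Submodule.span A (Set.range fun p => KaehlerDifferential.D ℂ A (v p)) = ⊤ := by
    rw [← KaehlerDifferential.span_range_derivation, hspan]
    congr 1
    ext x
    constructor
    · rintro ⟨p, rfl⟩
      simp only [v, hpre]
      exact (s.equivFin.symm p).2
    · intro hx
      exact ⟨s.equivFin ⟨x, hx⟩, by simp [v, hpre]⟩
  have hsurj : LinearMap.range (Fintype.linearCombination A
      fun p => KaehlerDifferential.D ℂ A (v p)) = ⊤ := by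
    rw [Fintype.range_linearCombination, hv]
  obtain ⟨σ, hσ⟩ := Module.projective_lifting_property _ LinearMap.id
    (LinearMap.range_eq_top.mp hsurj)
  refine ⟨s.card, v, fun p => ((LinearMap.proj p).comp σ).compDer (KaehlerDifferential.D ℂ A),
    fun θ => ?_⟩
  ext a
  have h1 := LinearMap.congr_fun hσ (KaehlerDifferential.D ℂ A a)
  have h2 := congrArg θ.liftKaehlerDifferential h1
  rw [LinearMap.comp_apply, Fintype.linearCombination_apply, map_sum] at h2
  simp only [map_smul, Derivation.liftKaehlerDifferential_comp_D, LinearMap.id_apply] at h2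
  rw [← h2]
  have h3 : ∀ F : Fin s.card → Derivation ℂ A A, (∑ p, F p) a = ∑ p, F p a := fun F =>
    map_sum (AddMonoidHom.mk' (fun θ : Derivation ℂ A A => θ a) fun _ _ => rfl) _ _
  rw [h3]
  exact Finset.sum_congr rfl fun p _ => by simp [mul_comm]

/-- An integrable connection: functions and vector fields act additively on `M`, compatibly with
the relations between functions and vector fields. -/
structure Connection (A : Type*) [CommRing A] [Algebra ℂ A] (M : Type*) [AddCommGroup M] where
  rho : A →+* AddMonoid.End M
  nab : Derivation ℂ A A →+ AddMonoid.End M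
  nab_smul : ∀ a θ, nab (a • θ) = rho a * nab θ
  nab_rho : ∀ θ a, nab θ * rho a = rho a * nab θ + rho (θ a)
  nab_lie : ∀ θ η, nab ⁅θ, η⁆ = nab θ * nab η - nab η * nab θ

/-- Pairs of an operator on functions and an operator on `M`. -/
def Pairs (A : Type*) [CommRing A] [Algebra ℂ A] (M : Type*) [AddCommGroup M] : Type _ :=
  Module.End ℂ A × AddMonoid.End M

instance (A : Type*) [CommRing A] [Algebra ℂ A] (M : Type*) [AddCommGroup M] :
    Ring (Pairs A M) :=
  inferInstanceAs (Ring (Module.End ℂ A × AddMonoid.End M))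

def Pairs.mk {A : Type*} [CommRing A] [Algebra ℂ A] {M : Type*} [AddCommGroup M]
    (P : Module.End ℂ A) (φ : AddMonoid.End M) : Pairs A M := (P, φ)

namespace Connection
variable {M : Type*} [AddCommGroup M] (c : Connection A M)

def gf (a : A) : Pairs A M := (Algebra.lmul ℂ A a, c.rho a)
def gd (θ : Derivation ℂ A A) : Pairs A M := ((θ : A →ₗ[ℂ] A), c.nab θ)

theorem gf_add (a b : A) : c.gf (a + b) = c.gf a + c.gf b :=
  Prod.ext (map_add (Algebra.lmul ℂ A) a b) (map_add c.rho a b)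
theorem gf_neg (a : A) : c.gf (-a) = - c.gf a :=
  Prod.ext (map_neg (Algebra.lmul ℂ A) a) (map_neg c.rho a)
theorem gf_mul (a b : A) : c.gf (a * b) = c.gf a * c.gf b :=
  Prod.ext (map_mul (Algebra.lmul ℂ A) a b) (map_mul c.rho a b)
theorem gf_one : c.gf 1 = 1 :=
  Prod.ext (map_one (Algebra.lmul ℂ A)) (map_one c.rho)
theorem gf_zero : c.gf 0 = 0 :=
  Prod.ext (map_zero (Algebra.lmul ℂ A)) (map_zero c.rho)
theorem gd_add (a b : Derivation ℂ A A) : c.gd (a + b) = c.gd a + c.gd b :=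
  Prod.ext rfl (map_add c.nab a b)
theorem gd_sum {n : ℕ} (e : Fin n → Derivation ℂ A A) : c.gd (∑ p, e p) = ∑ p, c.gd (e p) :=
  map_sum (AddMonoidHom.mk' c.gd c.gd_add) _ _
theorem gd_smul (a : A) (θ : Derivation ℂ A A) : c.gd (a • θ) = c.gf a * c.gd θ :=
  Prod.ext rfl (c.nab_smul a θ)
theorem gd_gf (θ : Derivation ℂ A A) (a : A) :
    c.gd θ * c.gf a = c.gf a * c.gd θ + c.gf (θ a) :=
  Prod.ext (congrArg Subtype.val (ofDer_mul_ofFun θ a)) (c.nab_rho θ a)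
theorem gd_lie (θ η : Derivation ℂ A A) :
    c.gd ⁅θ, η⁆ = c.gd θ * c.gd η - c.gd η * c.gd θ :=
  Prod.ext rfl (c.nab_lie θ η)

/-- Pairs of operators generated from functions and vector fields, of order at most `k`. -/
inductive Ord : ℕ → Pairs A M → Prop
  | fn (k : ℕ) (a : A) : Ord k (c.gf a)
  | der (k : ℕ) (θ : Derivation ℂ A A) (x) (hx : Ord k x) : Ord (k + 1) (c.gd θ * x)
  | add (k : ℕ) (x y) (hx : Ord k x) (hy : Ord k y) : Ord k (x + y)

variable {c}

theorem Ord.zero_iff {k : ℕ} {x} (h : c.Ord k x) (hk : k = 0) : ∃ a, x = c.gf a := by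
  induction h with
  | fn k a => exact ⟨a, rfl⟩
  | der => omega
  | add k x y _ _ ihx ihy =>
    obtain ⟨a, rfl⟩ := ihx hk
    obtain ⟨b, rfl⟩ := ihy hk
    exact ⟨a + b, (c.gf_add a b).symm⟩

theorem Ord.succ {k : ℕ} {x} (h : c.Ord k x) : c.Ord (k + 1) x := by
  induction h with
  | fn k a => exact .fn _ a
  | der k θ x _ ih => exact .der _ θ x ih
  | add k x y _ _ ihx ihy => exact .add _ _ _ ihx ihy

theorem Ord.mono {k l : ℕ} (hkl : k ≤ l) {x} (h : c.Ord k x) : c.Ord l x := by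
  induction hkl with
  | refl => exact h
  | step _ ih => exact ih.succ

theorem Ord.gf_mul {k : ℕ} {x} (a : A) (h : c.Ord k x) : c.Ord k (c.gf a * x) := by
  induction h with
  | fn k b => rw [← c.gf_mul]; exact .fn _ _
  | der k θ x hx ih => rw [← mul_assoc, ← c.gd_smul]; exact .der _ _ _ hx
  | add k x y _ _ ihx ihy => rw [mul_add]; exact .add _ _ _ ihx ihy

theorem Ord.neg {k : ℕ} {x} (h : c.Ord k x) : c.Ord k (-x) := by
  have := h.gf_mul (-1)
  rwa [c.gf_neg, c.gf_one, neg_mul, one_mul] at this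

theorem Ord.zero (k : ℕ) : c.Ord k 0 := by
  rw [← c.gf_zero]; exact .fn k 0

theorem Ord.sub {k : ℕ} {x y} (h : c.Ord k x) (h' : c.Ord k y) : c.Ord k (x - y) := by
  rw [sub_eq_add_neg]; exact .add _ _ _ h h'.neg

theorem Ord.sum {k n : ℕ} {x : Fin n → Pairs A M}
    (h : ∀ p, c.Ord k (x p)) : c.Ord k (∑ p, x p) :=
  Finset.sum_induction _ (c.Ord k) (fun _ _ => .add _ _ _) (.zero k) (fun p _ => h p)

theorem Ord.comm {k : ℕ} {x} (h : c.Ord k x) (a : A) :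
    (k = 0 → x * c.gf a - c.gf a * x = 0) ∧
      (∀ l, k = l + 1 → c.Ord l (x * c.gf a - c.gf a * x)) := by
  induction h with
  | fn k b =>
    have : c.gf b * c.gf a - c.gf a * c.gf b = 0 := by
      rw [← c.gf_mul, ← c.gf_mul, mul_comm, sub_self]
    rw [this]
    exact ⟨fun _ => rfl, fun l _ => .zero l⟩
  | der k θ x hx ih =>
    refine ⟨fun h => by omega, fun l hl => ?_⟩
    obtain rfl : k = l := by omega
    have e : c.gd θ * x * c.gf a - c.gf a * (c.gd θ * x)
        = c.gd θ * (x * c.gf a - c.gf a * x) + c.gf (θ a) * x := by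
      have : c.gf (θ a) = c.gd θ * c.gf a - c.gf a * c.gd θ := by rw [c.gd_gf]; abel
      rw [this]; noncomm_ring
    rw [e]
    refine .add _ _ _ ?_ (hx.gf_mul _)
    cases k with
    | zero => rw [ih.1 rfl, mul_zero]; exact .zero _
    | succ k => exact .der _ _ _ (ih.2 k rfl)
  | add k x y _ _ ihx ihy =>
    have e : (x + y) * c.gf a - c.gf a * (x + y)
      = (x * c.gf a - c.gf a * x) + (y * c.gf a - c.gf a * y) := by noncomm_ring
    rw [e]
    exact ⟨fun h => by rw [ihx.1 h, ihy.1 h, add_zero],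
      fun l h => .add _ _ _ (ihx.2 l h) (ihy.2 l h)⟩

/-- Euler's identity for the order of operators. -/
theorem Ord.euler {n : ℕ} {g : Fin n → A} {e : Fin n → Derivation ℂ A A}
    (hge : ∀ θ : Derivation ℂ A A, θ = ∑ p, θ (g p) • e p) {k : ℕ} {x} (h : c.Ord k x) :
    ∀ l, k = l + 1 → c.Ord l
      (∑ p, c.gd (e p) * (x * c.gf (g p) - c.gf (g p) * x) - (k : ℕ) • x) := by
  induction h with
  | fn k b =>
    intro l _
    refine .sub (.sum fun p => ?_) ?_
    · rw [← c.gf_mul, ← c.gf_mul, mul_comm, sub_self, mul_zero]; exact .zero _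
    · rw [nsmul_eq_mul]
      have : ((k : ℕ) : Pairs A M) = c.gf k :=
        Prod.ext (map_natCast (Algebra.lmul ℂ A) k).symm (map_natCast c.rho k).symm
      rw [this]; exact (Ord.fn l b).gf_mul _
  | der k θ x hx ih =>
    intro l hl
    obtain rfl : k = l := by omega
    have key : ∑ p, c.gd (e p) * (c.gd θ * x * c.gf (g p) - c.gf (g p) * (c.gd θ * x))
        - (k + 1) • (c.gd θ * x)
        = c.gd θ * (∑ p, c.gd (e p) * (x * c.gf (g p) - c.gf (g p) * x) - k • x)
          + ∑ p, c.gd ⁅e p, θ⁆ * (x * c.gf (g p) - c.gf (g p) * x)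
          + ∑ p, c.gf (e p (θ (g p))) * x := by
      have h1 : ∀ p, c.gd (e p) * (c.gd θ * x * c.gf (g p) - c.gf (g p) * (c.gd θ * x))
          = c.gd θ * (c.gd (e p) * (x * c.gf (g p) - c.gf (g p) * x))
            + c.gd ⁅e p, θ⁆ * (x * c.gf (g p) - c.gf (g p) * x)
            + c.gf (e p (θ (g p))) * x + c.gd (θ (g p) • e p) * x := by
        intro p
        have a1 : c.gf (θ (g p)) = c.gd θ * c.gf (g p) - c.gf (g p) * c.gd θ := by
          rw [c.gd_gf]; abel
        have a2 : c.gf (e p (θ (g p))) = c.gd (e p) * c.gf (θ (g p))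
            - c.gf (θ (g p)) * c.gd (e p) := by
          rw [c.gd_gf]; abel
        rw [c.gd_smul, a2, a1, c.gd_lie]
        noncomm_ring
      have h2 : ∑ p, c.gd (θ (g p) • e p) * x = c.gd θ * x := by
        rw [← Finset.sum_mul, ← c.gd_sum, ← hge θ]
      rw [Finset.sum_congr rfl fun p _ => h1 p]
      simp only [Finset.sum_add_distrib]
      rw [h2, mul_sub, Finset.mul_sum]
      rw [mul_smul_comm, add_smul, one_smul]
      abel
    rw [key]
    have hc : ∀ p η, c.Ord k (c.gd η * (x * c.gf (g p) - c.gf (g p) * x)) := by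
      intro p η
      cases k with
      | zero => rw [(hx.comm (g p)).1 rfl, mul_zero]; exact .zero _
      | succ k => exact .der _ _ _ ((hx.comm (g p)).2 k rfl)
    refine .add _ _ _ (.add _ _ _ ?_ (.sum fun p => hc p _)) (.sum fun p => hx.gf_mul _)
    cases k with
    | zero =>
      have : ∑ p, c.gd (e p) * (x * c.gf (g p) - c.gf (g p) * x) - 0 • x = 0 := by
        simp [(hx.comm _).1 rfl]
      rw [this, mul_zero]; exact .zero _
    | succ k => exact .der _ _ _ (ih k rfl)
  | add k x y _ _ ihx ihy =>
    intro l hl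
    have e : ∑ p, c.gd (e p) * ((x + y) * c.gf (g p) - c.gf (g p) * (x + y)) - k • (x + y)
      = (∑ p, c.gd (e p) * (x * c.gf (g p) - c.gf (g p) * x) - k • x)
        + (∑ p, c.gd (e p) * (y * c.gf (g p) - c.gf (g p) * y) - k • y) := by
      have h1 : ∀ p, c.gd (e p) * ((x + y) * c.gf (g p) - c.gf (g p) * (x + y))
        = c.gd (e p) * (x * c.gf (g p) - c.gf (g p) * x)
          + c.gd (e p) * (y * c.gf (g p) - c.gf (g p) * y) := fun p => by noncomm_ring
      rw [nsmul_add, Finset.sum_congr rfl fun p _ => h1 p, Finset.sum_add_distrib]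
      abel
    rw [e]
    exact .add _ _ _ (ihx l hl) (ihy l hl)

theorem Ord.eq_zero [Algebra.Smooth ℂ A] : ∀ (k : ℕ) (φ : AddMonoid.End M),
    c.Ord k (.mk 0 φ) → φ = 0 := by
  obtain ⟨n, g, e, hge⟩ := exists_dual A
  intro k
  induction k with
  | zero =>
    intro φ h
    obtain ⟨a, ha⟩ := h.zero_iff rfl
    have h1 : Algebra.lmul ℂ A a 1 = 0 := by
      have := congrArg Prod.fst ha
      change 0 = Algebra.lmul ℂ A a at this
      rw [← this]; rfl
    have h2 : a = 0 := by simpa using h1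
    have h3 : φ = c.rho a := congrArg Prod.snd ha
    rw [h3, h2, map_zero]
  | succ k ih =>
    intro φ h
    have hc : ∀ p, (Pairs.mk 0 φ : Pairs A M) * c.gf (g p)
        - c.gf (g p) * Pairs.mk 0 φ = 0 := by
      intro p
      have h1 := (h.comm (g p)).2 k rfl
      have h2 : (Pairs.mk 0 φ : Pairs A M) * c.gf (g p)
        - c.gf (g p) * Pairs.mk 0 φ = .mk 0 (φ * c.rho (g p) - c.rho (g p) * φ) :=
        Prod.ext (by
          change 0 * Algebra.lmul ℂ A (g p) - Algebra.lmul ℂ A (g p) * 0 = 0; simp) rfl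
      rw [h2] at h1 ⊢
      rw [ih _ h1]; rfl
    have h1 := h.euler hge k rfl
    simp only [hc, mul_zero, Finset.sum_const_zero, zero_sub] at h1
    have h2 := h1.neg
    rw [neg_neg] at h2
    have h3 : (k + 1) • (Pairs.mk 0 φ : Pairs A M) = .mk 0 ((k + 1) • φ) :=
      Prod.ext (smul_zero (k + 1)) rfl
    rw [h3] at h2
    have h4 := ih _ h2
    have h5 : c.rho (algebraMap ℂ A ((k + 1 : ℂ)⁻¹)) * ((k + 1) • φ) = φ := by
      have : (k + 1) • φ = c.rho (algebraMap ℂ A (k + 1)) * φ := by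
        rw [nsmul_eq_mul]; simp
      rw [this, ← mul_assoc, ← map_mul, ← map_mul,
        inv_mul_cancel₀ (by exact_mod_cast Nat.succ_ne_zero k), map_one, map_one, one_mul]
    rw [← h5, h4, mul_zero]

/-- The graph of the action of differential operators. -/
def Rel (c : Connection A M) (x : Pairs A M) : Prop := ∃ k, c.Ord k x

theorem Rel.add {x y : Pairs A M} :
    c.Rel x → c.Rel y → c.Rel (x + y) := by
  rintro ⟨k, hk⟩ ⟨l, hl⟩
  exact ⟨max k l, .add _ _ _ (hk.mono (le_max_left _ _)) (hl.mono (le_max_right _ _))⟩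

theorem Rel.mul {x y : Pairs A M} :
    c.Rel x → c.Rel y → c.Rel (x * y) := by
  rintro ⟨k, hk⟩
  induction hk generalizing y with
  | fn k a => rintro ⟨l, hl⟩; exact ⟨l, hl.gf_mul a⟩
  | der k θ x _ ih =>
    intro hy
    obtain ⟨l, hl⟩ := ih hy
    rw [mul_assoc]; exact ⟨_, .der _ _ _ hl⟩
  | add k x x' _ _ ihx ihy => intro hy; rw [add_mul]; exact (ihx hy).add (ihy hy)

theorem Rel.unique [Algebra.Smooth ℂ A] {P : Module.End ℂ A} {φ ψ : AddMonoid.End M} :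
    c.Rel (.mk P φ) → c.Rel (.mk P ψ) → φ = ψ := by
  intro h h'
  have h2 : c.Rel (-(.mk P ψ)) := by obtain ⟨k, hk⟩ := h'; exact ⟨k, hk.neg⟩
  obtain ⟨k, hk⟩ := h.add h2
  have : Pairs.mk P φ + -(.mk P ψ) = (Pairs.mk 0 (φ - ψ) : Pairs A M) :=
    Prod.ext (add_neg_cancel P) (sub_eq_add_neg φ ψ).symm
  rw [this] at hk
  exact sub_eq_zero.mp (Ord.eq_zero k _ hk)

theorem Rel.fn (a : A) : c.Rel (c.gf a) := ⟨0, .fn 0 a⟩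
theorem Rel.der (θ : Derivation ℂ A A) : c.Rel (c.gd θ) :=
  ⟨1, by have := Ord.der 0 θ _ (Ord.fn (c := c) 0 1); rwa [c.gf_one, mul_one] at this⟩

theorem Rel.exists (c : Connection A M) (P : DiffOp A) : ∃ φ, c.Rel (.mk P φ) := by
  obtain ⟨P, hP⟩ := P
  change ∃ φ, c.Rel (.mk P φ)
  induction hP using Algebra.adjoin_induction with
  | mem x hx =>
    rcases hx with ⟨a, rfl⟩ | ⟨θ, rfl⟩
    · exact ⟨_, Rel.fn a⟩
    · exact ⟨_, Rel.der θ⟩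
  | algebraMap z =>
    refine ⟨c.rho (algebraMap ℂ A z), ?_⟩
    have : algebraMap ℂ (Module.End ℂ A) z = Algebra.lmul ℂ A (algebraMap ℂ A z) := by
      rw [AlgHom.commutes]
    rw [this]; exact Rel.fn _
  | add x y _ _ hx hy =>
    obtain ⟨a, ha⟩ := hx
    obtain ⟨b, hb⟩ := hy
    exact ⟨a + b, ha.add hb⟩
  | mul x y _ _ hx hy =>
    obtain ⟨a, ha⟩ := hx
    obtain ⟨b, hb⟩ := hy
    exact ⟨a * b, ha.mul hb⟩

/-- On a smooth variety an integrable connection extends uniquely to an action of the ring of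
differential operators. -/
noncomputable def lift [Algebra.Smooth ℂ A] (c : Connection A M) :
    DiffOp A →+* AddMonoid.End M where
  toFun P := (Rel.exists c P).choose
  map_one' := Rel.unique (Rel.exists c 1).choose_spec (by
    have := Rel.fn (c := c) 1; rwa [c.gf_one] at this)
  map_mul' P Q := Rel.unique (Rel.exists c (P * Q)).choose_spec
    ((Rel.exists c P).choose_spec.mul (Rel.exists c Q).choose_spec)
  map_zero' := Rel.unique (Rel.exists c 0).choose_spec ⟨0, .zero 0⟩
  map_add' P Q := Rel.unique (Rel.exists c (P + Q)).choose_spec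
    ((Rel.exists c P).choose_spec.add (Rel.exists c Q).choose_spec)

theorem lift_ofFun [Algebra.Smooth ℂ A] (c : Connection A M) (a : A) :
    c.lift (ofFun a) = c.rho a :=
  Rel.unique (Rel.exists c (ofFun a)).choose_spec (Rel.fn a)

theorem lift_ofDer [Algebra.Smooth ℂ A] (c : Connection A M) (θ : Derivation ℂ A A) :
    c.lift (ofDer θ) = c.nab θ :=
  Rel.unique (Rel.exists c (ofDer θ)).choose_spec (Rel.der θ)

end Connection
end DiffOp

section DirectImage

instance smooth_mvPolynomial {R : Type*} [CommRing R] [Algebra ℂ R] [Algebra.Smooth ℂ R]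
    {ι : Type*} [Finite ι] : Algebra.Smooth ℂ (MvPolynomial ι R) := by
  have h : Algebra.Smooth R (MvPolynomial ι R) := { }
  exact Algebra.Smooth.comp ℂ R (MvPolynomial ι R)

variable {R : Type*} [CommRing R] [Algebra ℂ R] {ι : Type*}

/-- A `ℂ`-linear map applied to the coefficients of polynomials. -/
noncomputable def coeffLin (φ : R →ₗ[ℂ] R) : MvPolynomial ι R →ₗ[ℂ] MvPolynomial ι R :=
  (AddMonoidAlgebra.coeffLinearEquiv ℂ).symm.toLinearMap ∘ₗ Finsupp.mapRange.linearMap φ ∘ₗ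
    (AddMonoidAlgebra.coeffLinearEquiv ℂ).toLinearMap

theorem coeff_coeffLin (φ : R →ₗ[ℂ] R) (p : MvPolynomial ι R) (ν : ι →₀ ℕ) :
    coeff ν (coeffLin φ p) = φ (coeff ν p) := rfl

theorem coeffLin_monomial (φ : R →ₗ[ℂ] R) (ν : ι →₀ ℕ) (a : R) :
    coeffLin φ (monomial ν a) = monomial ν (φ a) := by
  classical
  ext μ
  rw [coeff_coeffLin, coeff_monomial, coeff_monomial]
  split_ifs <;> simp

/-- The vector field on `X × 𝔸^ι` that acts by `ξ` on the coefficients of polynomials in the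
coordinates of `𝔸^ι`. -/
noncomputable def coeffDer (ξ : Derivation ℂ R R) :
    Derivation ℂ (MvPolynomial ι R) (MvPolynomial ι R) :=
  Derivation.mk' (coeffLin (ξ : R →ₗ[ℂ] R)) fun p q => by
    induction p using MvPolynomial.induction_on' with
    | add p p' hp hp' => 
      rw [add_mul, map_add, hp, hp', map_add, add_smul, smul_add]; abel
    | monomial μ a =>
      induction q using MvPolynomial.induction_on' with
      | add q q' hq hq' => rw [mul_add, map_add, hq, hq', map_add, add_smul, smul_add]; abel
      | monomial ν b =>
        simp only [monomial_mul, coeffLin_monomial, smul_eq_mul, Derivation.coeFn_coe,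
          Derivation.leibniz, map_add]
        rw [add_comm ν μ]

/-- The vector field `∂/∂t_j` on `X × 𝔸^ι`. -/
noncomputable def partialDer (j : ι) : Derivation ℂ (MvPolynomial ι R) (MvPolynomial ι R) :=
  (pderiv j).restrictScalars ℂ

theorem coeffDer_C (ξ : Derivation ℂ R R) (a : R) :
    coeffDer ξ (C a : MvPolynomial ι R) = C (ξ a) :=
  coeffLin_monomial (ξ : R →ₗ[ℂ] R) 0 a

theorem coeffDer_X (ξ : Derivation ℂ R R) (j : ι) :
    coeffDer ξ (X j : MvPolynomial ι R) = 0 := by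
  refine (coeffLin_monomial (ξ : R →ₗ[ℂ] R) (Finsupp.single j 1) 1).trans ?_
  simp

theorem partialDer_C (j : ι) (a : R) : partialDer j (C a : MvPolynomial ι R) = 0 :=
  pderiv_C

theorem partialDer_X [DecidableEq ι] (j k : ι) :
    partialDer j (X k : MvPolynomial ι R) = if j = k then 1 else 0 := by
  refine (pderiv_X j k).trans ?_
  rw [Pi.single_apply]
  simp only [eq_comm]

theorem der_ext {θ η : Derivation ℂ (MvPolynomial ι R) (MvPolynomial ι R)}
    (hC : ∀ a, θ (C a) = η (C a)) (hX : ∀ j, θ (X j) = η (X j)) : θ = η := by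
  refine Derivation.ext fun p => ?_
  induction p using MvPolynomial.induction_on with
  | C a => exact hC a
  | add p q hp hq => simp_all
  | mul_X p j hp => simp_all

/-- The coefficient of `t^ν` in the values of a vector field at functions on `X`. -/
noncomputable def coeffOf (θ : Derivation ℂ (MvPolynomial ι R) (MvPolynomial ι R)) (ν : ι →₀ ℕ) :
    Derivation ℂ R R :=
  Derivation.mk'
    { toFun := fun a => coeff ν (θ (C a))
      map_add' := fun a b => by rw [C_add, map_add, coeff_add]
      map_smul' := fun z a => by
        have : (C (z • a) : MvPolynomial ι R) = z • C a := by
          rw [Algebra.smul_def, C_mul, Algebra.smul_def]; rfl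
        rw [this, Derivation.map_smul, coeff_smul, RingHom.id_apply] }
    fun a b => by
      change coeff ν (θ (C (a * b))) = a • coeff ν (θ (C b)) + b • coeff ν (θ (C a))
      rw [C_mul, Derivation.leibniz, coeff_add, smul_eq_mul, smul_eq_mul, coeff_C_mul, coeff_C_mul,
        smul_eq_mul, smul_eq_mul]

theorem coeffOf_apply (θ : Derivation ℂ (MvPolynomial ι R) (MvPolynomial ι R)) (ν : ι →₀ ℕ)
    (a : R) : coeffOf θ ν a = coeff ν (θ (C a)) := rfl

variable {f : ι → R} {N : Type*} [AddCommGroup N] [Module (DiffOp R) N]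

/-- The direct image `N ⊗ ℂ[∂_t]` of a `D`-module `N` on `X` under the graph embedding
`x ↦ (x, f(x))` of `X` into `X × 𝔸^ι`; the element `m ⊗ ∂_t^ν` is `Finsupp.single ν m`. -/
def DirectImage (_f : ι → R) (N : Type*) [AddCommGroup N] [Module (DiffOp R) N] : Type _ :=
  (ι →₀ ℕ) →₀ N

noncomputable instance : AddCommGroup (DirectImage f N) :=
  inferInstanceAs (AddCommGroup ((ι →₀ ℕ) →₀ N))

namespace DirectImage

variable (f) in
/-- The element `m ⊗ ∂_t^ν`. -/
noncomputable def tmul (ν : ι →₀ ℕ) : N →+ DirectImage f N := Finsupp.singleAddHom ν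

theorem hom_ext {φ ψ : AddMonoid.End (DirectImage f N)}
    (h : ∀ ν m, φ (tmul f ν m) = ψ (tmul f ν m)) : φ = ψ :=
  Finsupp.addHom_ext h

theorem end_add_apply {M : Type*} [AddCommGroup M] (φ ψ : AddMonoid.End M) (m : M) :
    (φ + ψ) m = φ m + ψ m := rfl

variable (f) in
/-- `m ⊗ ∂_t^ν ↦ φ(m) ⊗ ∂_t^ν`. -/
noncomputable def onCoef (φ : AddMonoid.End N) : AddMonoid.End (DirectImage f N) :=
  Finsupp.mapRange.addMonoidHom φ

theorem onCoef_tmul (φ : AddMonoid.End N) (ν : ι →₀ ℕ) (m : N) :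
    onCoef f φ (tmul f ν m) = tmul f ν (φ m) :=
  Finsupp.mapRange_single (hf := map_zero _)

variable (f) in
/-- `m ⊗ ∂_t^ν ↦ P m ⊗ ∂_t^ν`. -/
noncomputable def coef : DiffOp R →+* AddMonoid.End (DirectImage f N) where
  toFun P := onCoef f (Module.toAddMonoidEnd (DiffOp R) N P)
  map_one' := hom_ext fun ν m => by rw [onCoef_tmul, map_one]; rfl
  map_mul' P Q := hom_ext fun ν m => by
    rw [onCoef_tmul, map_mul, AddMonoid.End.coe_mul, AddMonoid.End.coe_mul, Function.comp_apply,
      Function.comp_apply, onCoef_tmul, onCoef_tmul]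
  map_zero' := hom_ext fun ν m => by
    rw [onCoef_tmul, map_zero]; exact map_zero (tmul f ν)
  map_add' P Q := hom_ext fun ν m => by
    rw [onCoef_tmul, map_add, end_add_apply, end_add_apply, onCoef_tmul, onCoef_tmul, map_add]

theorem coef_tmul (P : DiffOp R) (ν : ι →₀ ℕ) (m : N) :
    coef f P (tmul f ν m) = tmul f ν (P • m) :=
  onCoef_tmul _ _ _

variable (f N) in
/-- `m ⊗ ∂_t^ν ↦ m ⊗ ∂_{t_j} ∂_t^ν`. -/
noncomputable def raise (j : ι) : AddMonoid.End (DirectImage f N) :=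
  Finsupp.liftAddHom fun ν => tmul f (ν + Finsupp.single j 1)

theorem raise_tmul (j : ι) (ν : ι →₀ ℕ) (m : N) :
    raise f N j (tmul f ν m) = tmul f (ν + Finsupp.single j 1) m :=
  Finsupp.liftAddHom_apply_single _ _ _

variable (f N) in
/-- `m ⊗ ∂_t^ν ↦ ν_j m ⊗ (∂_t^ν)_j`. -/
noncomputable def lower (j : ι) : AddMonoid.End (DirectImage f N) :=
  Finsupp.liftAddHom fun ν => ν j • tmul f (ν - Finsupp.single j 1)

theorem lower_tmul (j : ι) (ν : ι →₀ ℕ) (m : N) :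
    lower f N j (tmul f ν m) = ν j • tmul f (ν - Finsupp.single j 1) m :=
  Finsupp.liftAddHom_apply_single _ _ _

theorem coef_raise (P : DiffOp R) (j : ι) :
    coef f P * raise f N j = raise f N j * coef f P :=
  hom_ext fun ν m => by
    simp only [AddMonoid.End.coe_mul, Function.comp_apply, coef_tmul, raise_tmul]

theorem coef_lower (P : DiffOp R) (j : ι) :
    coef f P * lower f N j = lower f N j * coef f P :=
  hom_ext fun ν m => by
    simp only [AddMonoid.End.coe_mul, Function.comp_apply, coef_tmul, lower_tmul, map_nsmul]

theorem raise_raise (i j : ι) : raise f N i * raise f N j = raise f N j * raise f N i :=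
  hom_ext fun ν m => by
    simp only [AddMonoid.End.coe_mul, Function.comp_apply, raise_tmul, add_right_comm]

theorem lower_lower (i j : ι) : lower f N i * lower f N j = lower f N j * lower f N i :=
  hom_ext fun ν m => by
    classical
    by_cases hij : i = j
    · rw [hij]
    simp only [AddMonoid.End.coe_mul, Function.comp_apply, lower_tmul, map_nsmul, smul_smul,
      Finsupp.tsub_apply, Finsupp.single_apply, if_neg hij, if_neg (Ne.symm hij), tsub_zero]
    rw [mul_comm, tsub_right_comm]

theorem lower_raise [DecidableEq ι] (j k : ι) :
    lower f N k * raise f N j = raise f N j * lower f N k + if j = k then 1 else 0 :=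
  hom_ext fun ν m => by
    rw [end_add_apply]
    simp only [AddMonoid.End.coe_mul, Function.comp_apply, lower_tmul, raise_tmul, map_nsmul]
    split_ifs with h
    · subst h
      rw [add_tsub_cancel_right, Finsupp.add_apply, Finsupp.single_eq_same, add_smul, one_smul]
      change _ = _ + tmul f ν m
      congr 1
      rcases Nat.eq_zero_or_pos (ν j) with h0 | h0
      · rw [h0, zero_smul, zero_smul]
      · rw [tsub_add_cancel_of_le]
        exact Finsupp.single_le_iff.mpr h0
    · change _ = _ + (0 : DirectImage f N)
      rw [add_zero, Finsupp.add_apply, Finsupp.single_apply, if_neg h, add_zero]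
      rcases Nat.eq_zero_or_pos (ν k) with h0 | h0
      · rw [h0, zero_smul, zero_smul]
      · rw [tsub_add_eq_add_tsub]
        exact Finsupp.single_le_iff.mpr h0

variable (f N) in
/-- The action of `t_j`: `m ⊗ ∂_t^ν ↦ f_j m ⊗ ∂_t^ν - ν_j m ⊗ (∂_t^ν)_j`. -/
noncomputable def mulT (j : ι) : AddMonoid.End (DirectImage f N) :=
  coef f (ofFun (f j)) - lower f N j

theorem coef_mulT (a : R) (j : ι) :
    coef f (ofFun a) * mulT f N j = mulT f N j * coef f (ofFun a) := by
  rw [mulT, mul_sub, sub_mul, coef_lower, ← map_mul, ← map_mul, ← map_mul, ← map_mul, mul_comm a]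

theorem mulT_mulT (i j : ι) : mulT f N i * mulT f N j = mulT f N j * mulT f N i := by
  have h1 : coef f (ofFun (f i)) * coef f (ofFun (f j))
      = (coef f (ofFun (f j)) * coef f (ofFun (f i)) : AddMonoid.End (DirectImage f N)) := by
    rw [← map_mul, ← map_mul, ← map_mul, ← map_mul, mul_comm]
  simp only [mulT, mul_sub, sub_mul, h1, coef_lower, lower_lower i j]
  abel

variable (f N) in
/-- The operators by which functions on `X` and coordinates of `𝔸^ι` act. -/
def funOps : Set (AddMonoid.End (DirectImage f N)) :=
  Set.range (fun a => coef f (ofFun a)) ∪ Set.range (mulT f N)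

theorem funOps_comm : ∀ x ∈ funOps f N, ∀ y ∈ funOps f N, x * y = y * x := by
  rintro _ (⟨a, rfl⟩ | ⟨i, rfl⟩) _ (⟨b, rfl⟩ | ⟨j, rfl⟩)
  · simp only [← map_mul, mul_comm]
  · exact coef_mulT a j
  · exact (coef_mulT b i).symm
  · exact mulT_mulT i j

variable (f N) in
/-- The commutative ring of operators generated by functions on `X` and coordinates. -/
def FunRing : Type _ := Subring.closure (funOps f N)

noncomputable instance : Ring (FunRing f N) :=
  inferInstanceAs (Ring (Subring.closure (funOps f N)))

theorem FunRing.mul_comm (x y : FunRing f N) : x * y = y * x := by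
  have := Subring.isMulCommutative_closure (funOps_comm (f := f) (N := N))
  exact mul_comm' (M := Subring.closure (funOps f N)) x y

noncomputable instance : CommRing (FunRing f N) where
  mul_comm := FunRing.mul_comm

variable (f N) in
noncomputable def FunRing.val : FunRing f N →+* AddMonoid.End (DirectImage f N) where
  toFun x := x.1
  map_one' := rfl
  map_mul' _ _ := rfl
  map_zero' := rfl
  map_add' _ _ := rfl

variable (f N) in
noncomputable def FunRing.ofFun : R →+* FunRing f N where
  toFun a := ⟨coef f (DMod.ofFun a), Subring.subset_closure (Or.inl ⟨a, rfl⟩)⟩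
  map_one' := Subtype.ext (by simp; rfl)
  map_mul' _ _ := Subtype.ext (by simp; rfl)
  map_zero' := Subtype.ext (by simp; rfl)
  map_add' _ _ := Subtype.ext (by simp; rfl)

variable (f N) in
noncomputable def FunRing.coord (j : ι) : FunRing f N :=
  ⟨mulT f N j, Subring.subset_closure (Or.inr ⟨j, rfl⟩)⟩

variable (f N) in
/-- The action of functions on `X × 𝔸^ι`. -/
noncomputable def rho : MvPolynomial ι R →+* AddMonoid.End (DirectImage f N) :=
  (FunRing.val f N).comp (eval₂Hom (FunRing.ofFun f N) (FunRing.coord f N))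

theorem rho_C (a : R) : rho f N (C a) = coef f (ofFun a) :=
  congrArg (FunRing.val f N) (eval₂Hom_C _ _ a)

theorem rho_X (j : ι) : rho f N (X j) = mulT f N j :=
  congrArg (FunRing.val f N) (eval₂Hom_X' _ _ j)

/-- An operator that satisfies the commutation rule of `θ` on coefficients and coordinates
satisfies it on all functions. -/
theorem comm_rho (E : AddMonoid.End (DirectImage f N))
    (θ : Derivation ℂ (MvPolynomial ι R) (MvPolynomial ι R))
    (hC : ∀ a, E * rho f N (C a) = rho f N (C a) * E + rho f N (θ (C a)))
    (hX : ∀ j, E * rho f N (X j) = rho f N (X j) * E + rho f N (θ (X j))) (p : MvPolynomial ι R) :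
    E * rho f N p = rho f N p * E + rho f N (θ p) := by
  induction p using MvPolynomial.induction_on with
  | C a => exact hC a
  | add p q hp hq => simp only [map_add, mul_add, add_mul, hp, hq]; abel
  | mul_X p j hp =>
    rw [map_mul, ← mul_assoc, hp, add_mul, mul_assoc (rho f N p) E, hX, Derivation.leibniz, map_add,
      smul_eq_mul, smul_eq_mul, mul_comm (X j) (θ p), map_mul, map_mul]
    noncomm_ring

theorem raise_rho (j : ι) (p : MvPolynomial ι R) :
    raise f N j * rho f N p = rho f N p * raise f N j + rho f N (partialDer j p) := by
  classical
  refine comm_rho _ _ (fun a => ?_) (fun k => ?_) p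
  · rw [partialDer_C, map_zero, add_zero, rho_C, coef_raise]
  · rw [partialDer_X, rho_X, mulT, mul_sub, sub_mul, lower_raise, coef_raise]
    split_ifs
    · simp only [map_one]; abel
    · simp

theorem coeffDer_lie (ξ η : Derivation ℂ R R) :
    (coeffDer ⁅ξ, η⁆ : Derivation ℂ (MvPolynomial ι R) (MvPolynomial ι R))
      = ⁅(coeffDer ξ : Derivation ℂ (MvPolynomial ι R) (MvPolynomial ι R)),
        (coeffDer η : Derivation ℂ (MvPolynomial ι R) (MvPolynomial ι R))⁆ :=
  der_ext (fun a => by simp only [Derivation.commutator_apply, coeffDer_C, map_sub])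
    (fun j => by simp only [Derivation.commutator_apply, coeffDer_X, map_zero, sub_zero])

theorem lie_coeffDer_partialDer (ξ : Derivation ℂ R R) (j : ι) :
    ⁅(coeffDer ξ : Derivation ℂ (MvPolynomial ι R) (MvPolynomial ι R)),
      (partialDer j : Derivation ℂ (MvPolynomial ι R) (MvPolynomial ι R))⁆ = 0 := by
  classical
  refine der_ext (fun a => ?_) (fun k => ?_)
  · simp only [Derivation.commutator_apply, coeffDer_C, partialDer_C, map_zero, sub_zero,
      Derivation.zero_apply]
  · simp only [Derivation.commutator_apply, coeffDer_X, partialDer_X, map_zero, sub_zero,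
      Derivation.zero_apply]
    split_ifs <;> simp

theorem lie_partialDer (i j : ι) :
    ⁅(partialDer i : Derivation ℂ (MvPolynomial ι R) (MvPolynomial ι R)),
      (partialDer j : Derivation ℂ (MvPolynomial ι R) (MvPolynomial ι R))⁆ = 0 := by
  classical
  refine der_ext (fun a => ?_) (fun k => ?_)
  · simp only [Derivation.commutator_apply, partialDer_C, map_zero, sub_zero,
      Derivation.zero_apply]
  · simp only [Derivation.commutator_apply, partialDer_X, Derivation.zero_apply]
    split_ifs <;> simp

variable [Fintype ι]

variable (f N) in
/-- The action of a vector field `ξ` on `X`: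
`m ⊗ ∂_t^ν ↦ ξ m ⊗ ∂_t^ν - ∑_j ξ(f_j) m ⊗ ∂_{t_j} ∂_t^ν`. -/
noncomputable def hat : Derivation ℂ R R →+ AddMonoid.End (DirectImage f N) where
  toFun ξ := coef f (ofDer ξ) - ∑ j, coef f (ofFun (ξ (f j))) * raise f N j
  map_zero' := by
    have : ofDer (0 : Derivation ℂ R R) = 0 := rfl
    simp [this]
  map_add' ξ η := by
    simp only [ofDer_add, Derivation.add_apply, map_add, add_mul, Finset.sum_add_distrib]
    abel

theorem hat_apply (ξ : Derivation ℂ R R) :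
    hat f N ξ = coef f (ofDer ξ) - ∑ j, coef f (ofFun (ξ (f j))) * raise f N j := rfl

theorem hat_smul (a : R) (ξ : Derivation ℂ R R) :
    hat f N (a • ξ) = rho f N (C a) * hat f N ξ := by
  simp only [hat_apply, rho_C, ofDer_smul, map_mul, mul_sub, Finset.mul_sum, Derivation.smul_apply,
    smul_eq_mul, mul_assoc]

theorem hat_rho (ξ : Derivation ℂ R R) (p : MvPolynomial ι R) :
    hat f N ξ * rho f N p = rho f N p * hat f N ξ + rho f N (coeffDer ξ p) := by
  classical
  refine comm_rho _ _ (fun a => ?_) (fun k => ?_) p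
  · rw [coeffDer_C, rho_C, rho_C, hat_apply, sub_mul, mul_sub, ← map_mul, ofDer_mul_ofFun, map_add,
      map_mul]
    have : (∑ j, coef f (ofFun (ξ (f j))) * raise f N j) * coef f (ofFun a)
        = coef f (ofFun a) * ∑ j, coef f (ofFun (ξ (f j))) * raise f N j := by
      rw [Finset.sum_mul, Finset.mul_sum]
      refine Finset.sum_congr rfl fun j _ => ?_
      rw [mul_assoc, ← coef_raise, ← mul_assoc, ← mul_assoc, ← map_mul, ← map_mul, ← map_mul,
        ← map_mul, mul_comm a]
    rw [this]; abel
  · rw [coeffDer_X, map_zero, add_zero, rho_X, hat_apply, sub_mul, mul_sub]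
    have h1 : coef f (ofDer ξ) * mulT f N k
        = mulT f N k * coef f (ofDer ξ) + coef f (ofFun (ξ (f k))) := by
      rw [mulT, mul_sub, sub_mul, coef_lower, ← map_mul, ofDer_mul_ofFun, map_add, map_mul]
      abel
    have h2 : ∀ j, raise f N j * mulT f N k
        = mulT f N k * raise f N j + if j = k then 1 else 0 := by
      intro j
      rw [mulT, mul_sub, sub_mul, lower_raise, coef_raise]
      abel
    have h3 : (∑ j, coef f (ofFun (ξ (f j))) * raise f N j) * mulT f N k
        = mulT f N k * (∑ j, coef f (ofFun (ξ (f j))) * raise f N j)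
          + coef f (ofFun (ξ (f k))) := by
      rw [Finset.sum_mul, Finset.mul_sum]
      have : ∀ j, coef f (ofFun (ξ (f j))) * raise f N j * mulT f N k
          = mulT f N k * (coef f (ofFun (ξ (f j))) * raise f N j)
            + if j = k then coef f (ofFun (ξ (f j))) else 0 := by
        intro j
        rw [mul_assoc, h2, mul_add, ← mul_assoc, coef_mulT, mul_assoc, mul_ite, mul_one, mul_zero]
      rw [Finset.sum_congr rfl fun j _ => this j, Finset.sum_add_distrib]
      simp
    rw [h1, h3]; abel

theorem hat_raise (ξ : Derivation ℂ R R) (j : ι) :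
    hat f N ξ * raise f N j = raise f N j * hat f N ξ := by
  rw [hat_apply, sub_mul, mul_sub, coef_raise, Finset.sum_mul, Finset.mul_sum]
  congr 1
  refine Finset.sum_congr rfl fun k _ => ?_
  rw [mul_assoc, raise_raise, ← mul_assoc, coef_raise, mul_assoc]

theorem hat_lie (ξ η : Derivation ℂ R R) :
    hat f N ⁅ξ, η⁆ = hat f N ξ * hat f N η - hat f N η * hat f N ξ := by
  have h1 : ∀ ξ η : Derivation ℂ R R, coef f (ofDer ξ) * (∑ j, coef f (ofFun (η (f j))) * raise f N j)
      = (∑ j, coef f (ofFun (η (f j))) * raise f N j) * coef f (ofDer ξ)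
        + ∑ j, coef f (ofFun (ξ (η (f j)))) * raise f N j := by
    intro ξ η
    rw [Finset.sum_mul, Finset.mul_sum, ← Finset.sum_add_distrib]
    refine Finset.sum_congr rfl fun j _ => ?_
    rw [← mul_assoc, ← map_mul, ofDer_mul_ofFun, map_add, map_mul, add_mul, mul_assoc, coef_raise,
      mul_assoc]
  have h2 : (∑ j, coef f (ofFun (ξ (f j))) * raise f N j)
        * (∑ j, coef f (ofFun (η (f j))) * raise f N j)
      = (∑ j, coef f (ofFun (η (f j))) * raise f N j)
        * (∑ j, coef f (ofFun (ξ (f j))) * raise f N j) := by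
    rw [Finset.sum_mul_sum, Finset.sum_mul_sum, Finset.sum_comm]
    refine Finset.sum_congr rfl fun j _ => Finset.sum_congr rfl fun k _ => ?_
    have : ∀ (a b : R) (j k : ι), coef f (ofFun a) * raise f N k * (coef f (ofFun b) * raise f N j)
        = coef f (ofFun (a * b)) * (raise f N k * raise f N j) := by
      intro a b j k
      rw [map_mul, map_mul, mul_assoc, ← mul_assoc (raise f N k), ← coef_raise]
      noncomm_ring
    rw [this, this, mul_comm, raise_raise]
  have h3 : ∑ j, coef f (ofFun (⁅ξ, η⁆ (f j))) * raise f N j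
      = ∑ j, coef f (ofFun (ξ (η (f j)))) * raise f N j
        - ∑ j, coef f (ofFun (η (ξ (f j)))) * raise f N j := by
    rw [← Finset.sum_sub_distrib]
    refine Finset.sum_congr rfl fun j _ => ?_
    rw [Derivation.commutator_apply, map_sub, map_sub, sub_mul]
  have h4 : coef f (ofDer ξ * ofDer η - ofDer η * ofDer ξ)
      = coef f (ofDer ξ * ofDer η) - (coef f (ofDer η * ofDer ξ) :
        AddMonoid.End (DirectImage f N)) := by
    rw [eq_sub_iff_add_eq, ← map_add]
    exact congrArg _ (Subtype.ext (sub_add_cancel _ _))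
  rw [hat_apply ⁅ξ, η⁆, h3, ofDer_lie, h4, map_mul, map_mul, hat_apply, hat_apply, sub_mul,
    sub_mul, mul_sub, mul_sub, mul_sub, mul_sub, h1, h1, h2]
  abel

theorem der_induction {P : Derivation ℂ (MvPolynomial ι R) (MvPolynomial ι R) → Prop}
    (hg : ∀ θ, ∃ (n : ℕ) (a : Fin n → MvPolynomial ι R) (ξ : Fin n → Derivation ℂ R R)
      (b : ι → MvPolynomial ι R),
      θ = ∑ p, a p • coeffDer (ξ p) + ∑ j, b j • partialDer j)
    (h0 : P 0) (hadd : ∀ θ η, P θ → P η → P (θ + η)) (hsmul : ∀ (a : MvPolynomial ι R) θ, P θ → P (a • θ))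
    (hc : ∀ ξ, P (coeffDer ξ)) (hp : ∀ j, P (partialDer j)) (θ) : P θ := by
  obtain ⟨n, a, ξ, b, rfl⟩ := hg θ
  exact hadd _ _ (Finset.sum_induction _ P hadd h0 fun p _ => hsmul _ _ (hc _))
    (Finset.sum_induction _ P hadd h0 fun p _ => hsmul _ _ (hp _))

variable (f N) in
/-- The action of the vector fields on `X × 𝔸^ι`; a vector field `θ` is written as
`∑_p θ(g_p) e_p + ∑_j θ(t_j) ∂_{t_j}` with the help of a dual system on `X`. -/
theorem exists_nab [Algebra.Smooth ℂ R] : ∃ nab : Derivation ℂ (MvPolynomial ι R) (MvPolynomial ι R) →+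
      AddMonoid.End (DirectImage f N),
    (∀ a θ, nab (a • θ) = rho f N a * nab θ) ∧
    (∀ ξ, nab (coeffDer ξ) = hat f N ξ) ∧ (∀ j, nab (partialDer j) = raise f N j) ∧
    (∀ θ, ∃ (n : ℕ) (a : Fin n → MvPolynomial ι R) (ξ : Fin n → Derivation ℂ R R)
      (b : ι → MvPolynomial ι R),
      θ = ∑ p, a p • coeffDer (ξ p) + ∑ j, b j • partialDer j) := by
  classical
  obtain ⟨n, g, e, hge⟩ := exists_dual R
  refine ⟨AddMonoidHom.mk' (fun θ => ∑ p, rho f N (θ (C (g p))) * hat f N (e p)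
    + ∑ j, rho f N (θ (X j)) * raise f N j) ?_, ?_, ?_, ?_, ?_⟩
  · intro θ η
    simp only [Derivation.add_apply, map_add, add_mul, Finset.sum_add_distrib]
    abel
  · intro a θ
    simp only [AddMonoidHom.mk'_apply, Derivation.smul_apply, smul_eq_mul, map_mul, mul_add,
      Finset.mul_sum, mul_assoc]
  · intro ξ
    simp only [AddMonoidHom.mk'_apply, coeffDer_C, coeffDer_X, map_zero, zero_mul,
      Finset.sum_const_zero, add_zero, ← hat_smul, ← map_sum, ← hge ξ]
  · intro j
    simp only [AddMonoidHom.mk'_apply, partialDer_C, partialDer_X, map_zero, zero_mul,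
      Finset.sum_const_zero, zero_add]
    rw [Finset.sum_eq_single j]
    · simp
    · intro k _ hk; simp [Ne.symm hk]
    · simp
  · intro θ
    have hsum : ∀ {m : ℕ} (F : Fin m → Derivation ℂ (MvPolynomial ι R) (MvPolynomial ι R)) q,
        (∑ p, F p) q = ∑ p, F p q := fun F q =>
      map_sum (AddMonoidHom.mk' (fun θ : Derivation ℂ (MvPolynomial ι R) (MvPolynomial ι R) => θ q)
        fun _ _ => rfl) _ _
    have hsum' : ∀ (F : ι → Derivation ℂ (MvPolynomial ι R) (MvPolynomial ι R)) q,
        (∑ p, F p) q = ∑ p, F p q := fun F q =>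
      map_sum (AddMonoidHom.mk' (fun θ : Derivation ℂ (MvPolynomial ι R) (MvPolynomial ι R) => θ q)
        fun _ _ => rfl) _ _
    refine ⟨n, fun p => θ (C (g p)), e, fun j => θ (X j), der_ext (fun a => ?_) (fun k => ?_)⟩
    · rw [Derivation.add_apply, hsum, hsum']
      simp only [Derivation.smul_apply, coeffDer_C, partialDer_C, smul_eq_mul]
      ext ν
      have h := congrArg (fun ξ : Derivation ℂ R R => ξ a) (hge (coeffOf θ ν))
      have hs : ∀ F : Fin n → Derivation ℂ R R, (∑ p, F p) a = ∑ p, F p a := fun F =>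
        map_sum (AddMonoidHom.mk' (fun θ : Derivation ℂ R R => θ a) fun _ _ => rfl) _ _
      simp only [hs, Derivation.smul_apply, smul_eq_mul, coeffOf_apply] at h
      simp only [mul_zero, Finset.sum_const_zero, add_zero, coeff_sum]
      rw [h]
      refine Finset.sum_congr rfl fun p _ => ?_
      rw [mul_comm (θ _), coeff_C_mul, mul_comm]
    · rw [Derivation.add_apply, hsum, hsum']
      simp only [Derivation.smul_apply, coeffDer_X, partialDer_X,
        Finset.sum_const_zero, zero_add, smul_eq_mul, mul_ite, mul_one, mul_zero]
      simp

theorem nab_rho_of {nab : Derivation ℂ (MvPolynomial ι R) (MvPolynomial ι R) →+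
      AddMonoid.End (DirectImage f N)}
    (hs : ∀ a θ, nab (a • θ) = rho f N a * nab θ)
    (hc : ∀ ξ, nab (coeffDer ξ) = hat f N ξ) (hp : ∀ j, nab (partialDer j) = raise f N j)
    (hg : ∀ θ, ∃ (n : ℕ) (a : Fin n → MvPolynomial ι R) (ξ : Fin n → Derivation ℂ R R)
      (b : ι → MvPolynomial ι R),
      θ = ∑ p, a p • coeffDer (ξ p) + ∑ j, b j • partialDer j) (θ) :
    ∀ a, nab θ * rho f N a = rho f N a * nab θ + rho f N (θ a) := by
  refine der_induction hg (P := fun θ => ∀ a, nab θ * rho f N a = rho f N a * nab θ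
    + rho f N (θ a)) ?_ ?_ ?_ ?_ ?_ θ
  · intro a; simp
  · intro θ η h h' a
    rw [map_add, add_mul, mul_add, h, h', Derivation.add_apply, map_add]; abel
  · intro b θ h a
    rw [hs, mul_assoc, h, mul_add, Derivation.smul_apply, smul_eq_mul, ← mul_assoc, ← map_mul,
      mul_comm b a, map_mul, map_mul, mul_assoc]
  · intro ξ a; rw [hc]; exact hat_rho ξ a
  · intro j a; rw [hp]; exact raise_rho j a

theorem nab_lie_of {nab : Derivation ℂ (MvPolynomial ι R) (MvPolynomial ι R) →+
      AddMonoid.End (DirectImage f N)}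
    (hs : ∀ a θ, nab (a • θ) = rho f N a * nab θ)
    (hc : ∀ ξ, nab (coeffDer ξ) = hat f N ξ) (hp : ∀ j, nab (partialDer j) = raise f N j)
    (hg : ∀ θ, ∃ (n : ℕ) (a : Fin n → MvPolynomial ι R) (ξ : Fin n → Derivation ℂ R R)
      (b : ι → MvPolynomial ι R),
      θ = ∑ p, a p • coeffDer (ξ p) + ∑ j, b j • partialDer j) (θ η) :
    nab ⁅θ, η⁆ = nab θ * nab η - nab η * nab θ := by
  have symm : ∀ θ η, nab ⁅θ, η⁆ = nab θ * nab η - nab η * nab θ →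
      nab ⁅η, θ⁆ = nab η * nab θ - nab θ * nab η := by
    intro θ η h
    rw [← lie_skew, map_neg, h]; abel
  have hz : ∀ θ, nab ⁅θ, (0 : Derivation ℂ (MvPolynomial ι R) (MvPolynomial ι R))⁆
      = nab θ * nab 0 - nab 0 * nab θ := by
    intro θ
    have e : ⁅θ, (0 : Derivation ℂ (MvPolynomial ι R) (MvPolynomial ι R))⁆ = 0 :=
      Derivation.ext fun p => by simp [Derivation.commutator_apply]
    rw [e, map_zero, mul_zero, zero_mul, sub_zero]
  have hadd : ∀ θ η η', nab ⁅θ, η⁆ = nab θ * nab η - nab η * nab θ →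
      nab ⁅θ, η'⁆ = nab θ * nab η' - nab η' * nab θ →
      nab ⁅θ, η + η'⁆ = nab θ * nab (η + η') - nab (η + η') * nab θ := by
    intro θ η η' h h'
    have e : ⁅θ, η + η'⁆ = ⁅θ, η⁆ + ⁅θ, η'⁆ :=
      Derivation.ext fun p => by
        simp only [Derivation.commutator_apply, Derivation.add_apply, map_add]; ring
    rw [e, map_add, h, h', map_add, mul_add, add_mul]; abel
  have hsm : ∀ θ (a : MvPolynomial ι R) η, nab ⁅θ, η⁆ = nab θ * nab η - nab η * nab θ →
      nab ⁅θ, a • η⁆ = nab θ * nab (a • η) - nab (a • η) * nab θ := by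
    intro θ a η h
    have e : ⁅θ, a • η⁆ = θ a • η + a • ⁅θ, η⁆ := by
      refine Derivation.ext fun p => ?_
      simp only [Derivation.commutator_apply, Derivation.add_apply, Derivation.smul_apply,
        smul_eq_mul, Derivation.leibniz]
      ring
    rw [e, map_add, hs, hs, hs, h, ← mul_assoc, nab_rho_of hs hc hp hg]
    noncomm_ring
  have step : ∀ γ, (∀ ξ, nab ⁅γ, coeffDer ξ⁆ = nab γ * nab (coeffDer ξ) - nab (coeffDer ξ) * nab γ) →
      (∀ j, nab ⁅γ, partialDer j⁆ = nab γ * nab (partialDer j) - nab (partialDer j) * nab γ) →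
      ∀ θ, nab ⁅γ, θ⁆ = nab γ * nab θ - nab θ * nab γ := fun γ h1 h2 θ =>
    der_induction hg (P := fun θ => nab ⁅γ, θ⁆ = nab γ * nab θ - nab θ * nab γ) (hz γ) (hadd γ)
      (hsm γ) h1 h2 θ
  have hcp : ∀ ξ j, nab ⁅(coeffDer ξ : Derivation ℂ (MvPolynomial ι R) (MvPolynomial ι R)),
        (partialDer j : Derivation ℂ (MvPolynomial ι R) (MvPolynomial ι R))⁆
      = nab (coeffDer ξ) * nab (partialDer j) - nab (partialDer j) * nab (coeffDer ξ) := by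
    intro ξ j
    rw [lie_coeffDer_partialDer, map_zero, hc, hp, hat_raise, sub_self]
  refine step θ (fun ξ => symm _ _ (step _ (fun ξ' => ?_) (hcp ξ) θ))
    (fun j => symm _ _ (step _ (fun ξ => symm _ _ (hcp ξ j)) (fun k => ?_) θ)) η
  · rw [← coeffDer_lie, hc, hc, hc, hat_lie]
  · rw [lie_partialDer, map_zero, hp, hp, raise_raise, sub_self]

variable [Algebra.Smooth ℂ R]

variable (f N) in
/-- The integrable connection on the direct image. -/
noncomputable def connection : Connection (MvPolynomial ι R) (DirectImage f N) where
  rho := rho f N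
  nab := (exists_nab f N).choose
  nab_smul := (exists_nab f N).choose_spec.1
  nab_rho := nab_rho_of (exists_nab f N).choose_spec.1 (exists_nab f N).choose_spec.2.1
    (exists_nab f N).choose_spec.2.2.1 (exists_nab f N).choose_spec.2.2.2
  nab_lie := nab_lie_of (exists_nab f N).choose_spec.1 (exists_nab f N).choose_spec.2.1
    (exists_nab f N).choose_spec.2.2.1 (exists_nab f N).choose_spec.2.2.2

/-- The `D`-module structure of the direct image. -/
noncomputable instance : Module (DiffOp (MvPolynomial ι R)) (DirectImage f N) :=
  Module.compHom _ (connection f N).lift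

theorem smul_def (P : DiffOp (MvPolynomial ι R)) (m : DirectImage f N) :
    P • m = (connection f N).lift P m := rfl

/-- `g (m ⊗ ∂_t^ν) = g m ⊗ ∂_t^ν` for a function `g` on `X`. -/
theorem ofFun_C_smul (a : R) (ν : ι →₀ ℕ) (m : N) :
    (ofFun (C a) : DiffOp (MvPolynomial ι R)) • tmul f ν m = tmul f ν (ofFun a • m) := by
  rw [smul_def, Connection.lift_ofFun]
  change rho f N (C a) _ = _
  rw [rho_C, coef_tmul]

/-- `t_j (m ⊗ ∂_t^ν) = f_j m ⊗ ∂_t^ν - ν_j m ⊗ (∂_t^ν)_j`. -/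
theorem ofFun_X_smul (j : ι) (ν : ι →₀ ℕ) (m : N) :
    (ofFun (X j) : DiffOp (MvPolynomial ι R)) • tmul f ν m
      = tmul f ν (ofFun (f j) • m) - ν j • tmul f (ν - Finsupp.single j 1) m := by
  rw [smul_def, Connection.lift_ofFun]
  change rho f N (X j) _ = _
  rw [rho_X, mulT, ← coef_tmul, ← lower_tmul]
  rfl

/-- `∂_{t_j} (m ⊗ ∂_t^ν) = m ⊗ ∂_{t_j} ∂_t^ν`. -/
theorem ofDer_partialDer_smul (j : ι) (ν : ι →₀ ℕ) (m : N) :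
    (ofDer (partialDer j) : DiffOp (MvPolynomial ι R)) • tmul f ν m
      = tmul f (ν + Finsupp.single j 1) m := by
  rw [smul_def, Connection.lift_ofDer]
  change (exists_nab f N).choose (partialDer j) _ = _
  rw [(exists_nab f N).choose_spec.2.2.1, raise_tmul]

/-- `ξ (m ⊗ ∂_t^ν) = ξ m ⊗ ∂_t^ν - ∑_j ξ(f_j) m ⊗ ∂_{t_j} ∂_t^ν` for a vector field `ξ` on `X`. -/
theorem ofDer_coeffDer_smul (ξ : Derivation ℂ R R) (ν : ι →₀ ℕ) (m : N) :
    (ofDer (coeffDer ξ) : DiffOp (MvPolynomial ι R)) • tmul f ν m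
      = tmul f ν (ofDer ξ • m)
        - ∑ j, tmul f (ν + Finsupp.single j 1) (ofFun (ξ (f j)) • m) := by
  rw [smul_def, Connection.lift_ofDer]
  change (exists_nab f N).choose (coeffDer ξ) _ = _
  rw [(exists_nab f N).choose_spec.2.1, hat_apply]
  have h : ∀ F : ι → AddMonoid.End (DirectImage f N), (∑ j, F j) (tmul f ν m)
      = ∑ j, F j (tmul f ν m) := fun F =>
    map_sum (AddMonoidHom.mk' (fun φ : AddMonoid.End (DirectImage f N) => φ (tmul f ν m))
      fun _ _ => rfl) _ _
  have h' : ∀ φ ψ : AddMonoid.End (DirectImage f N), (φ - ψ) (tmul f ν m)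
      = φ (tmul f ν m) - ψ (tmul f ν m) := fun _ _ => rfl
  rw [h', h, coef_tmul]
  simp only [AddMonoid.End.coe_mul, Function.comp_apply, raise_tmul, coef_tmul]

end DirectImage
end DirectImage

section VFiltration

variable {A : Type*} [CommRing A] [Algebra ℂ A]

/-- `V^j D = {P | P I^i ⊆ I^{i+j} for all i ∈ ℤ}`, where `I^i = A` for `i ≤ 0`. -/
def vOrder (I : Ideal A) (j : ℤ) : Set (DiffOp A) :=
  {P | ∀ i : ℤ, ∀ a ∈ I ^ i.toNat, (P : Module.End ℂ A) a ∈ I ^ (i + j).toNat}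

/-- The ring `V^0 D`. -/
def vZero (I : Ideal A) : Subring (DiffOp A) where
  carrier := vOrder I 0
  one_mem' := fun i a ha => by simpa using ha
  zero_mem' := fun i a _ => Submodule.zero_mem _
  add_mem' := fun hP hQ i a ha => Submodule.add_mem _ (hP i a ha) (hQ i a ha)
  neg_mem' := fun hP i a ha => Submodule.neg_mem _ (hP i a ha)
  mul_mem' := fun {P Q} hP hQ i a ha => by
    have h1 := hQ i a ha
    rw [add_zero] at h1
    exact hP i _ h1

variable {M : Type*} [AddCommGroup M]

/-- The union `V^{>α}` of all `V^β` with `β > α`. -/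
def gtPart (V : ℝ → AddSubgroup M) (α : ℝ) : Set M := {m | ∃ β, α < β ∧ m ∈ V β}

/-- The set of all `α` with `Gr_V^α = V^α / V^{>α} ≠ 0`. -/
def jumps (V : ℝ → AddSubgroup M) : Set ℝ := {α | ∃ m ∈ V α, m ∉ gtPart V α}

/-- `V` is the `V`-filtration on the `D`-module `M` over a smooth affine variety with coordinate
ring `A`, along the smooth closed subvariety `t = 0`. Here the functions `t_j` are part of a
coordinate system and `d_j` are the corresponding vector fields `∂/∂t_j`. The rings of differential
operators `D` and `V^0 D` are noetherian, so coherent modules are finitely generated modules. -/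
structure IsVFiltration [Module (DiffOp A) M] {ι : Type*} [Fintype ι] (t : ι → A)
    (d : ι → Derivation ℂ A A) (V : ℝ → AddSubgroup M) : Prop where
  /-- `M` is a coherent `D`-module. -/
  finite : Module.Finite (DiffOp A) M
  antitone : Antitone V
  exhaustive : ∀ m, ∃ α, m ∈ V α
  /-- The `V^α` are coherent `V^0 D`-submodules. -/
  coherent : ∀ α, ∃ L : Submodule (vZero (Ideal.span (Set.range t))) M,
    L.FG ∧ (L : Set M) = V α
  left_continuous : ∀ α m, (∀ β < α, m ∈ V β) → m ∈ V α
  discrete : ∀ a b : ℝ, (jumps V ∩ Set.Icc a b).Finite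
  rational : ∀ α ∈ jumps V, ∃ q : ℚ, (q : ℝ) = α
  /-- `(V^j D)(V^α) ⊆ V^{α+j}`. -/
  smul_mem : ∀ (j : ℤ) (α : ℝ), ∀ P ∈ vOrder (Ideal.span (Set.range t)) j, ∀ m ∈ V α,
    P • m ∈ V (α + j)
  /-- `V^{α+1} = ∑_j t_j V^α` for `α ≫ 0`. -/
  eventually : ∃ α₀ : ℝ, ∀ α ≥ α₀, ∀ m, m ∈ V (α + 1) ↔
    ∃ v : ι → M, (∀ j, v j ∈ V α) ∧ m = ∑ j, ofFun (t j) • v j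
  /-- `∑_j ∂_{t_j} t_j - α` is nilpotent on `V^α / V^{>α}`. -/
  nilpotent : ∀ α : ℝ, ∃ k : ℕ, ∀ m ∈ V α,
    (∑ j, ofDer (d j) * ofFun (t j) - ofFun (algebraMap ℂ A (α : ℂ))) ^ k • m ∈ gtPart V α

end VFiltration

section Scheme

open AlgebraicGeometry CategoryTheory

variable (X : Scheme.{0}) [X.Over (Spec (.of ℂ))]

/-- The ring of regular functions on an affine open subset of `X`. -/
def Fn (X : Scheme.{0}) (U : X.affineOpens) : Type := Γ(X, U.1)

noncomputable instance (U : X.affineOpens) : CommRing (Fn X U) :=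
  inferInstanceAs (CommRing Γ(X, U.1))

/-- The structure map `ℂ → Γ(X, U)` of a complex scheme. -/
noncomputable def structureMap (U : X.affineOpens) : ℂ →+* Fn X U :=
  ((Scheme.ΓSpecIso (.of ℂ)).inv ≫ (X ↘ Spec (.of ℂ)).appLE ⊤ U.1 le_top).hom

noncomputable instance (U : X.affineOpens) : Algebra ℂ (Fn X U) := (structureMap X U).toAlgebra

instance [Smooth (X ↘ Spec (.of ℂ))] (U : X.affineOpens) : Algebra.Smooth ℂ (Fn X U) := by
  have h1 : ((X ↘ Spec (.of ℂ)).appLE ⊤ U.1 le_top).hom.Smooth :=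
    Scheme.Hom.smooth_appLE _ (isAffineOpen_top _) U.2 _
  have h2 : (Scheme.ΓSpecIso (.of ℂ)).inv.hom.Smooth :=
    RingHom.Smooth.of_bijective
      (ConcreteCategory.bijective_of_isIso (Scheme.ΓSpecIso (.of ℂ)).inv)
  have h3 : (structureMap X U).Smooth := RingHom.Smooth.comp h2 h1
  exact RingHom.Smooth.toAlgebra h3

variable {X}

/-- Restriction of functions. -/
noncomputable def Fn.res {U U' : X.affineOpens} (h : U ≤ U') : Fn X U' →+* Fn X U :=
  (X.presheaf.map (homOfLE (show U.1 ≤ U'.1 from h)).op).hom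

/-- The restriction of global functions to an affine open subset. -/
noncomputable def restrict {ι : Type*} (f : ι → Γ(X, ⊤)) (U : X.affineOpens) (j : ι) : Fn X U :=
  (X.presheaf.map (homOfLE (le_top : U.1 ≤ ⊤)).op).hom (f j)

/-- The principal affine open subset `D(g)` of `U`. -/
def basic {X : Scheme.{0}} (U : X.affineOpens) (g : Fn X U) : X.affineOpens := X.affineBasicOpen (U := U) g

theorem basic_le {X : Scheme.{0}} (U : X.affineOpens) (g : Fn X U) : basic U g ≤ U := X.affineBasicOpen_le g

/-- The global functions `f_j` generate the ideal sheaf `I`. -/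
def Generates {ι : Type*} (f : ι → Γ(X, ⊤)) (I : X.IdealSheafData) : Prop :=
  ∀ U : X.affineOpens, I.ideal U = Ideal.span (Set.range (restrict f U) : Set Γ(X, U.1))

variable (X) in
/-- A (quasi-coherent, left) `D`-module on a smooth complex variety `X`, given by its sections over
the affine open subsets: these are modules over the rings of differential operators, restriction
maps commute with the action of operators and of their restrictions, and sections over the
principal open subset `D(g)` are obtained by inverting `g`. -/
structure DModule where
  obj : X.affineOpens → Type*
  [addCommGroup : ∀ U, AddCommGroup (obj U)]
  [module : ∀ U, Module (DiffOp (Fn X U)) (obj U)]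
  res : ∀ {U U' : X.affineOpens}, U ≤ U' → obj U' →+ obj U
  res_refl : ∀ (U : X.affineOpens) (m : obj U), res (le_refl U) m = m
  res_trans : ∀ {U U' U'' : X.affineOpens} (h : U ≤ U') (h' : U' ≤ U'') (m : obj U''),
    res h (res h' m) = res (h.trans h') m
  res_smul : ∀ {U U' : X.affineOpens} (h : U ≤ U') (P : DiffOp (Fn X U')) (Q : DiffOp (Fn X U)),
    (∀ a, (Q : Module.End ℂ (Fn X U)) (Fn.res h a)
      = Fn.res h ((P : Module.End ℂ (Fn X U')) a)) →
    ∀ m, res h (P • m) = Q • res h m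
  exists_of_res_eq_zero : ∀ (U : X.affineOpens) (g : Fn X U) (m : obj U),
    res (basic_le U g) m = 0 → ∃ k : ℕ, ofFun (g ^ k) • m = 0
  exists_res_eq : ∀ (U : X.affineOpens) (g : Fn X U) (m : obj (basic U g)),
    ∃ (k : ℕ) (m' : obj U), ofFun (Fn.res (basic_le U g) (g ^ k)) • m = res (basic_le U g) m'

attribute [instance] DModule.addCommGroup DModule.module

variable {ι : Type*} (f : ι → Γ(X, ⊤)) (N : DModule X)

/-- The sections over `U × 𝔸^ι` of the direct image `M = i_* N` under the graph embedding
`i : X → X × 𝔸^ι`, `x ↦ (x, f(x))`. -/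
abbrev GraphImage (U : X.affineOpens) : Type _ := DirectImage (restrict f U) (N.obj U)

/-- Restriction of sections of `M = i_* N` from `U' × 𝔸^ι` to `U × 𝔸^ι`. -/
noncomputable def GraphImage.res {U U' : X.affineOpens} (h : U ≤ U') :
    GraphImage f N U' →+ GraphImage f N U :=
  Finsupp.mapRange.addMonoidHom (N.res h)

variable [Fintype ι] [Smooth (X ↘ Spec (.of ℂ))]

/-- `V` is the `V`-filtration on the direct image `M = i_* N` along `X × {0} ⊆ X × 𝔸^ι`. The
filtration consists of quasi-coherent subsheaves of `M`, given by their sections over the open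
subsets `U × 𝔸^ι` with `U` affine. -/
structure IsGraphVFiltration (V : ∀ U : X.affineOpens, ℝ → AddSubgroup (GraphImage f N U)) :
    Prop where
  isVFiltration : ∀ U, IsVFiltration (A := MvPolynomial ι (Fn X U)) MvPolynomial.X partialDer (V U)
  res_mem : ∀ {U U' : X.affineOpens} (h : U ≤ U') (α : ℝ), ∀ m ∈ V U' α,
    GraphImage.res f N h m ∈ V U α
  exists_res_eq : ∀ (U : X.affineOpens) (g : Fn X U) (α : ℝ), ∀ m ∈ V (basic U g) α,
    ∃ k : ℕ, ∃ m' ∈ V U α,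
      (ofFun (MvPolynomial.C (Fn.res (basic_le U g) (g ^ k))) :
        DiffOp (MvPolynomial ι (Fn X (basic U g)))) • m = GraphImage.res f N (basic_le U g) m'

/-- `W` is the `V`-filtration on `N` defined by the functions `f_j`: one has
`W^α = (N ⊗ 1) ∩ V^α M`, where `V` is the `V`-filtration along `X × {0}` on the direct image `M` of
`N` under the graph embedding of `f`. -/
def IsVFiltrationOf (W : ∀ U : X.affineOpens, ℝ → AddSubgroup (N.obj U)) : Prop :=
  ∃ V : ∀ U : X.affineOpens, ℝ → AddSubgroup (GraphImage f N U),
    IsGraphVFiltration f N V ∧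
    ∀ U α, W U α = (V U α).comap (DirectImage.tmul (restrict f U) 0)

end Scheme

section Further

variable {R : Type*} [CommRing R] [Algebra ℂ R] {ι κ : Type*}

/-- The functions `∑_i a_ij t_i` on `Y = X × 𝔸^ι`. -/
noncomputable def linearForms [Fintype ι] (a : ι → κ → R) (j : κ) : MvPolynomial ι R :=
  ∑ i, C (a i j) * X i

/-- The coordinates `t, t'` on `Y' = X × 𝔸^ι × 𝔸^κ`. -/
noncomputable def coords : ι ⊕ κ → MvPolynomial κ (MvPolynomial ι R) :=
  Sum.elim (fun i => C (X i)) X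

/-- The vector fields `∂/∂t_i`, `∂/∂t'_j` on `Y' = X × 𝔸^ι × 𝔸^κ`. -/
noncomputable def coordFields :
    ι ⊕ κ → Derivation ℂ (MvPolynomial κ (MvPolynomial ι R)) (MvPolynomial κ (MvPolynomial ι R)) :=
  Sum.elim (fun i => coeffDer (partialDer i)) partialDer

/-- `∑_ν V^{α+|ν|} M ⊗ ∂_u^ν`, a subgroup of the direct image `M ⊗ ℂ[∂_u]` of `M`. -/
noncomputable def sumFiltration {h : κ → R} {M : Type*} [AddCommGroup M] [Module (DiffOp R) M]
    (V : ℝ → AddSubgroup M) (α : ℝ) : AddSubgroup (DirectImage h M) :=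
  ⨆ ν : κ →₀ ℕ, (V (α + (ν.degree : ℝ))).map (DirectImage.tmul h ν)

end Further
end DMod

open AlgebraicGeometry CategoryTheory DMod

/-! The proof combines functoriality of `V`-filtrations, the verification of (b), and a morphism
between two iterated direct images.

Functoriality (`IsVFiltration.map_mem`): let `φ : M → M'` be compatible with the operators, their
orders and the Euler operators `s = ∑ ∂_{t_j} t_j`. Since `V^{α₀}M` is finitely generated over `V^0
D` and `V^{β+1} = ∑ t_j V^β` for `β ≥ α₀`, there is `γ` with `φ(V^{α₀+k}M) ⊆ V'^{γ+k}` for all `k`.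
For `m ∈ V^α M`, nilpotency of `s - β` on `Gr^β` gives a polynomial `p` with all roots `≥ α` that
moves `m` so deep that `p(s)φ(m) ∈ V'^α`, and a polynomial `q` with all roots `< α` such that
`q(s)φ(m) ∈ V'^α`. As `p` and `q` are coprime, `φ(m) ∈ V'^α`.

Part (b) (`isVFiltration_sumFiltration`): put `h_j = ∑ a_ij t_i`. Because `h_j` is linear in `t`,
the Euler operator of `M'` acts on `m ⊗ ∂_u^ν` as `s - |ν|` acts on `m`, which explains the shift by
`|ν|`. For stability under `V^j D`, operators are split into homogeneous components for the dilation
of `(t, u)`. The generators have degree `-1`, `0` or `1` and shift the filtration by their degree,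
and an operator of order at least `j` has no component of degree below `j`
(`eq_zero_of_sum_mem_vOrder`). Finite generation, discreteness and a common nilpotency exponent
concern all `ν` at once; `V^{β+1} = ∑ t_i V^β` for large `β` reduces them to bounded `|ν|`.

Part (a): write `g = a f` and `f = b g`. The direct image of `M_f` under `u = ∑ a t` and that of
`M_g` under `t = ∑ b u` both model the direct image of `N` under `x ↦ (x, f(x), g(x))`. The
universal property `DirectImage.exists_lift`, used twice, gives a morphism between them that sends
`n ⊗ 1 ⊗ 1` to `n ⊗ 1 ⊗ 1` (`exists_hom_directImage`). Both sides carry `V`-filtrations by (b), and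
these induce on `N` the filtrations defined by `f` and by `g`. Functoriality gives one inclusion,
and exchanging `f` and `g` the other. -/

set_option linter.unusedSectionVars false

namespace DMod

/-! ### Orders of differential operators along an ideal. -/

section Operators

variable {A : Type*} [CommRing A] [Algebra ℂ A]

theorem DiffOp.induction {C : DiffOp A → Prop} (hfun : ∀ a, C (ofFun a)) (hder : ∀ θ, C (ofDer θ))
    (hadd : ∀ P Q, C P → C Q → C (P + Q)) (hmul : ∀ P Q, C P → C Q → C (P * Q)) (P : DiffOp A) :
    C P := by
  obtain ⟨P, hP⟩ := P
  induction hP using Algebra.adjoin_induction with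
  | mem x hx =>
    rcases hx with ⟨a, rfl⟩ | ⟨θ, rfl⟩
    · exact hfun a
    · exact hder θ
  | algebraMap z =>
    have : algebraMap ℂ (Module.End ℂ A) z = Algebra.lmul ℂ A (algebraMap ℂ A z) := by
      rw [AlgHom.commutes]
    convert hfun (algebraMap ℂ A z) using 1
    exact Subtype.ext this
  | add x y _ _ hx hy => exact hadd _ _ hx hy
  | mul x y _ _ hx hy => exact hmul _ _ hx hy

theorem ofFun_algebraMap (z : ℂ) : ofFun (algebraMap ℂ A z) = algebraMap ℂ (DiffOp A) z :=
  Subtype.ext ((Algebra.lmul ℂ A).commutes z)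

theorem coe_mul_apply (P Q : DiffOp A) (b : A) :
    ((P * Q : DiffOp A) : Module.End ℂ A) b
      = (P : Module.End ℂ A) ((Q : Module.End ℂ A) b) := rfl

variable {I : Ideal A}

theorem vOrder_mul {i j : ℤ} {P Q : DiffOp A} (hP : P ∈ vOrder I i) (hQ : Q ∈ vOrder I j) :
    P * Q ∈ vOrder I (i + j) := fun n a ha => by
  have := hP _ _ (hQ n a ha)
  rwa [add_assoc, add_comm j i] at this

theorem vOrder_add {j : ℤ} {P Q : DiffOp A} (hP : P ∈ vOrder I j) (hQ : Q ∈ vOrder I j) :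
    P + Q ∈ vOrder I j := fun n a ha => Submodule.add_mem _ (hP n a ha) (hQ n a ha)

theorem vOrder_sum {j : ℤ} {ι : Type*} (s : Finset ι) {P : ι → DiffOp A}
    (hP : ∀ i ∈ s, P i ∈ vOrder I j) : ∑ i ∈ s, P i ∈ vOrder I j :=
  Finset.sum_induction _ (· ∈ vOrder I j) (fun _ _ => vOrder_add)
    (fun _ _ _ => Submodule.zero_mem _) hP

theorem ofFun_mem_vOrder_of_mem_pow {k : ℕ} {a : A} (ha : a ∈ I ^ k) :
    ofFun a ∈ vOrder I k := fun n b hb => by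
  rw [ofFun_coe]
  refine Ideal.pow_le_pow_right ?_ (pow_add I k n.toNat ▸ Ideal.mul_mem_mul ha hb)
  omega

theorem ofFun_mem_vOrder_zero (a : A) : ofFun a ∈ vOrder I 0 :=
  ofFun_mem_vOrder_of_mem_pow (k := 0) (by simp)

theorem ofFun_mem_vOrder_one {a : A} (ha : a ∈ I) : ofFun a ∈ vOrder I 1 :=
  ofFun_mem_vOrder_of_mem_pow (k := 1) (by simpa using ha)

/-- By the Leibniz rule a derivation costs at most one factor of `I`. The truncated `n - 1` is
harmless at `n = 0`, where both powers are the whole ring. -/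
theorem derivation_mem_pow_pred (θ : Derivation ℂ A A) {n : ℕ} {a : A} (ha : a ∈ I ^ n) :
    θ a ∈ I ^ (n - 1) := by
  induction ha using Submodule.pow_induction_on_left' with
  | algebraMap r => simp
  | add x y i _ _ hx hy => rw [map_add]; exact Submodule.add_mem _ hx hy
  | mem_mul m hm i x hx ih =>
    rw [Derivation.leibniz]
    refine Submodule.add_mem _ ?_ (Ideal.mul_mem_right _ _ hx)
    rcases i with _ | i
    · simp
    · change m * θ x ∈ I ^ (i + 1)
      rw [pow_succ']; exact Ideal.mul_mem_mul hm ih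

/-- The Leibniz rule again: a field tangent to the zero locus of `I` loses no factor. This gives the
lifts of vector fields on `X` order 0 instead of -1. -/
theorem derivation_mem_pow {θ : Derivation ℂ A A} (hθ : ∀ a ∈ I, θ a ∈ I) {n : ℕ} {a : A}
    (ha : a ∈ I ^ n) : θ a ∈ I ^ n := by
  induction ha using Submodule.pow_induction_on_left' with
  | algebraMap r => simp
  | add x y i _ _ hx hy => rw [map_add]; exact Submodule.add_mem _ hx hy
  | mem_mul m hm i x hx ih =>
    rw [Derivation.leibniz, pow_succ']
    refine Submodule.add_mem _ (Ideal.mul_mem_mul hm ih) ?_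
    rw [smul_eq_mul, mul_comm x]; exact Ideal.mul_mem_mul (hθ m hm) hx

theorem ofDer_mem_vOrder (θ : Derivation ℂ A A) : ofDer θ ∈ vOrder I (-1) := fun n a ha =>
  Ideal.pow_le_pow_right (by omega) (derivation_mem_pow_pred θ ha)

theorem ofDer_mem_vOrder_zero {θ : Derivation ℂ A A} (hθ : ∀ a ∈ I, θ a ∈ I) :
    ofDer θ ∈ vOrder I 0 := fun n a ha => by
  rw [add_zero]; exact derivation_mem_pow hθ ha

theorem derivation_mem_span {s : Set A} {θ : Derivation ℂ A A} (hθ : ∀ a ∈ s, θ a ∈ Ideal.span s) :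
    ∀ a ∈ Ideal.span s, θ a ∈ Ideal.span s := fun a ha => by
  induction ha using Submodule.span_induction with
  | mem x hx => exact hθ x hx
  | zero => rw [map_zero]; exact Submodule.zero_mem _
  | add x y _ _ hx hy => rw [map_add]; exact Submodule.add_mem _ hx hy
  | smul b x hx ih =>
    rw [smul_eq_mul, Derivation.leibniz]
    exact Submodule.add_mem _ (Ideal.mul_mem_left _ _ ih) (Ideal.mul_mem_right _ _ hx)

/-- The operator `∑_j ∂_{t_j} t_j`. -/
def euler {ι : Type*} [Fintype ι] (t : ι → A) (d : ι → Derivation ℂ A A) : DiffOp A :=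
  ∑ j, ofDer (d j) * ofFun (t j)

theorem euler_mem_vOrder {ι : Type*} [Fintype ι] (t : ι → A) (d : ι → Derivation ℂ A A) :
    euler t d ∈ vOrder (Ideal.span (Set.range t)) 0 :=
  vOrder_sum _ fun j _ => vOrder_mul (ofDer_mem_vOrder (d j))
    (ofFun_mem_vOrder_one (Ideal.subset_span (Set.mem_range_self j)))

/-- Needed for the Bézout coefficients in `IsVFiltration.map_mem`, which must not lower the
filtration. -/
theorem aeval_mem_vOrder_zero {P : DiffOp A} (hP : P ∈ vOrder I 0) (p : Polynomial ℂ) :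
    Polynomial.aeval P p ∈ vOrder I 0 := by
  induction p using Polynomial.induction_on' with
  | add p q hp hq => rw [map_add]; exact vOrder_add hp hq
  | monomial n z =>
    rw [Polynomial.aeval_monomial, ← ofFun_algebraMap]
    exact (vZero I).mul_mem (ofFun_mem_vOrder_zero _) ((vZero I).pow_mem hP n)

end Operators

/-! ### Functoriality of the `V`-filtration. -/

namespace IsVFiltration

variable {A : Type*} [CommRing A] [Algebra ℂ A] {M : Type*} [AddCommGroup M] [Module (DiffOp A) M]
  {ι : Type*} [Fintype ι] {t : ι → A} {d : ι → Derivation ℂ A A} {V : ℝ → AddSubgroup M}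

theorem smul_mem_of_vOrder_zero (hV : IsVFiltration t d V) {P : DiffOp A}
    (hP : P ∈ vOrder (Ideal.span (Set.range t)) 0) {α : ℝ} {m : M} (hm : m ∈ V α) :
    P • m ∈ V α := by
  simpa using hV.smul_mem 0 α P hP m hm

theorem coord_smul_mem (hV : IsVFiltration t d V) (j : ι) {α : ℝ} {m : M} (hm : m ∈ V α) :
    ofFun (t j) • m ∈ V (α + 1) := by
  simpa using hV.smul_mem 1 α _ (ofFun_mem_vOrder_one (Ideal.subset_span ⟨j, rfl⟩)) m hm

theorem der_smul_mem (hV : IsVFiltration t d V) (θ : Derivation ℂ A A) {α : ℝ} {m : M}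
    (hm : m ∈ V α) : ofDer θ • m ∈ V (α - 1) := by
  have := hV.smul_mem (-1) α _ (ofDer_mem_vOrder θ) m hm
  rwa [Int.cast_neg, Int.cast_one, ← sub_eq_add_neg] at this

/-- The filtration is constant on intervals without jumps. -/
theorem mem_of_forall_notMem_jumps (hV : IsVFiltration t d V) {α β : ℝ}
    (h : ∀ γ ∈ Set.Ico α β, γ ∉ jumps V) {m : M} (hm : m ∈ V α) : m ∈ V β := by
  by_contra hβ
  have hαβ : α < β := by
    by_contra hle
    exact hβ (hV.antitone (not_lt.mp hle) hm)
  -- By left continuity the supremum of `S` is attained. If it were below `β` it would not be a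
  -- jump, and `m` would lie in some `V^δ` beyond it.
  let S : Set ℝ := {δ | δ ≤ β ∧ m ∈ V δ}
  have hne : S.Nonempty := ⟨α, hαβ.le, hm⟩
  have hbd : BddAbove S := ⟨β, fun δ hδ => hδ.1⟩
  have hsup : m ∈ V (sSup S) := hV.left_continuous _ _ fun γ hγ => by
    obtain ⟨δ, hδ, hlt⟩ := exists_lt_of_lt_csSup hne hγ
    exact hV.antitone hlt.le hδ.2
  have hle : sSup S ≤ β := csSup_le hne fun δ hδ => hδ.1
  have hlt : sSup S < β := lt_of_le_of_ne hle fun e => hβ (e ▸ hsup)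
  have hα : α ≤ sSup S := le_csSup hbd ⟨hαβ.le, hm⟩
  have hj := h _ ⟨hα, hlt⟩
  have : m ∈ gtPart V (sSup S) := by
    by_contra hgt
    exact hj ⟨m, hsup, hgt⟩
  obtain ⟨δ, hδ, hmδ⟩ := this
  have h1 : m ∈ V (min δ β) := hV.antitone (min_le_left _ _) hmδ
  exact absurd (le_csSup hbd ⟨min_le_right _ _, h1⟩) (not_le.mpr (lt_min hδ hlt))

/-- A polynomial in `∑_j ∂_{t_j} t_j` with roots in `[α, β)` maps `V^α` to `V^β`. -/
theorem exists_polynomial (hV : IsVFiltration t d V) (α β : ℝ) :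
    ∃ p : Polynomial ℂ, (∀ z : ℂ, p.eval z = 0 → ∃ γ : ℝ, z = γ ∧ α ≤ γ ∧ γ < β) ∧
      ∀ m ∈ V α, Polynomial.aeval (euler t d) p • m ∈ V β := by
  induction hn : (jumps V ∩ Set.Ico α β).ncard using Nat.strong_induction_on generalizing α with
  | _ n ih =>
    have hfin : ∀ a, (jumps V ∩ Set.Ico a β).Finite := fun a =>
      (hV.discrete a β).subset (Set.inter_subset_inter_right _ Set.Ico_subset_Icc_self)
    rcases (jumps V ∩ Set.Ico α β).eq_empty_or_nonempty with he | hne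
    · refine ⟨1, fun z hz => by simp at hz, fun m hm => ?_⟩
      rw [map_one, one_smul]
      refine hV.mem_of_forall_notMem_jumps (fun γ hγ hj => ?_) hm
      exact he.subset ⟨hj, hγ⟩
    -- Up to the first jump `γ` nothing is lost. A power of `s - γ` then moves `V^γ` to the next
    -- jump, or to `β`, and fewer jumps remain.
    · obtain ⟨γ, ⟨hγj, hγ⟩, hmin⟩ := (hfin α).exists_minimal hne
      have hmin' : ∀ δ ∈ Set.Ico α γ, δ ∉ jumps V := fun δ hδ hj =>
        absurd (hmin ⟨hj, hδ.1, hδ.2.trans hγ.2⟩ hδ.2.le) (not_le.mpr hδ.2)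
      obtain ⟨k, hk⟩ := hV.nilpotent γ
      -- the next jump
      obtain ⟨α', hα', hα'β, hno⟩ : ∃ α', γ < α' ∧ α' ≤ β ∧ ∀ δ ∈ Set.Ioo γ α', δ ∉ jumps V := by
        have hfin' : (jumps V ∩ Set.Ioo γ β).Finite := (hfin γ).subset
          (Set.inter_subset_inter_right _ Set.Ioo_subset_Ico_self)
        rcases (jumps V ∩ Set.Ioo γ β).eq_empty_or_nonempty with he | hne
        · exact ⟨β, hγ.2, le_rfl, fun δ hδ hj => he.subset ⟨hj, hδ⟩⟩
        · obtain ⟨α', ⟨_, h'⟩, hmin⟩ := hfin'.exists_minimal hne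
          exact ⟨α', h'.1, h'.2.le, fun δ hδ hj =>
            absurd (hmin ⟨hj, hδ.1, hδ.2.trans h'.2⟩ hδ.2.le) (not_le.mpr hδ.2)⟩
      have hcard : (jumps V ∩ Set.Ico α' β).ncard < n := by
        rw [← hn]
        refine Set.ncard_lt_ncard ⟨fun δ hδ => ⟨hδ.1, ?_, hδ.2.2⟩, fun h => ?_⟩ (hfin α)
        · exact hγ.1.trans (hα'.le.trans hδ.2.1)
        · exact absurd (h ⟨hγj, hγ⟩).2.1 (not_le.mpr hα')
      obtain ⟨p, hp, hpV⟩ := ih _ hcard α' rfl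
      refine ⟨p * (Polynomial.X - Polynomial.C (γ : ℂ)) ^ k, fun z hz => ?_, fun m hm => ?_⟩
      · rw [Polynomial.eval_mul, Polynomial.eval_pow, mul_eq_zero] at hz
        rcases hz with hz | hz
        · obtain ⟨δ, h1, h2, h3⟩ := hp z hz
          exact ⟨δ, h1, hγ.1.trans (hα'.le.trans h2), h3⟩
        · exact ⟨γ, by simpa [sub_eq_zero] using eq_zero_of_pow_eq_zero hz, hγ⟩
      · rw [map_mul, mul_smul]
        refine hpV _ ?_
        have h1 := hk m (hV.mem_of_forall_notMem_jumps hmin' hm)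
        have h2 : Polynomial.aeval (euler t d) ((Polynomial.X - Polynomial.C (γ : ℂ)) ^ k)
            = (∑ j, ofDer (d j) * ofFun (t j) - ofFun (algebraMap ℂ A (γ : ℂ))) ^ k := by
          rw [map_pow, map_sub, Polynomial.aeval_X, Polynomial.aeval_C, ofFun_algebraMap]; rfl
        rw [h2]
        obtain ⟨δ, hδ, hmδ⟩ := h1
        rcases le_total α' δ with h | h
        · exact hV.antitone h hmδ
        · exact hV.mem_of_forall_notMem_jumps (fun ε hε => hno ε ⟨hδ.trans_le hε.1, hε.2⟩) hmδ

/-- Morphisms of `D`-modules are compatible with the `V`-filtrations. -/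
theorem map_mem {A' : Type*} [CommRing A'] [Algebra ℂ A'] {M' : Type*} [AddCommGroup M']
    [Module (DiffOp A') M'] {ι' : Type*} [Fintype ι'] {t' : ι' → A'} {d' : ι' → Derivation ℂ A' A'}
    {V' : ℝ → AddSubgroup M'} (hV : IsVFiltration t d V) (hV' : IsVFiltration t' d' V')
    (τ : DiffOp A →ₐ[ℂ] DiffOp A')
    (hτ : ∀ j, ∀ P ∈ vOrder (Ideal.span (Set.range t)) j,
      τ P ∈ vOrder (Ideal.span (Set.range t')) j)
    (hs : τ (euler t d) = euler t' d') (φ : M →+ M') (hφ : ∀ P m, φ (P • m) = τ P • φ m)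
    {α : ℝ} {m : M} (hm : m ∈ V α) : φ m ∈ V' α := by
  classical
  obtain ⟨α₀, hα₀⟩ := hV.eventually
  obtain ⟨L, ⟨s, hs'⟩, hL⟩ := hV.coherent α₀
  choose β hβ using hV'.exhaustive
  -- `V^{α₀}` has finitely many generators over `V^0 D`, so one `γ` serves all their images.
  obtain ⟨γ, hγ⟩ : ∃ γ, ∀ x ∈ s, φ x ∈ V' γ := by
    obtain ⟨γ, hγ⟩ := (s.image fun x => β (φ x)).bddBelow
    exact ⟨γ, fun x hx => hV'.antitone
      (hγ (Finset.mem_coe.mpr (Finset.mem_image_of_mem _ hx))) (hβ (φ x))⟩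
  have h0 : ∀ x ∈ V α₀, φ x ∈ V' γ := by
    intro x hx
    have hx' : x ∈ L := by rw [← SetLike.mem_coe, hL]; exact hx
    rw [← hs'] at hx'
    clear hx
    induction hx' using Submodule.span_induction with
    | mem x hx => exact hγ x hx
    | zero => rw [map_zero]; exact (V' γ).zero_mem
    | add x y _ _ ihx ihy => rw [map_add]; exact (V' γ).add_mem ihx ihy
    | smul P x _ ih =>
      change φ ((P : DiffOp A) • x) ∈ _
      rw [hφ]
      exact hV'.smul_mem_of_vOrder_zero (hτ 0 _ P.2) ih
  -- Beyond `α₀` each step is generated by the `t_j`, and `τ` carries these to operators of order 1.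
  have hk : ∀ (k : ℕ), ∀ x ∈ V (α₀ + k), φ x ∈ V' (γ + k) := by
    intro k
    induction k with
    | zero => simpa using h0
    | succ k ih =>
      intro x hx
      rw [Nat.cast_succ, ← add_assoc] at hx ⊢
      obtain ⟨v, hv, rfl⟩ := (hα₀ _ (by simp) x).mp hx
      rw [map_sum]
      refine (V' _).sum_mem fun j _ => ?_
      rw [hφ]
      have := hV'.smul_mem 1 (γ + k) (τ (ofFun (t j)))
        (hτ 1 _ (ofFun_mem_vOrder_one (Ideal.subset_span ⟨j, rfl⟩))) _ (ih _ (hv j))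
      simpa using this
  -- With this `k` one has `γ + k ≥ α`, so `V^{α₀+k}` is mapped into `V'^α`.
  obtain ⟨k, hk'⟩ := exists_nat_ge (α - γ)
  obtain ⟨p, hp, hpV⟩ := hV.exists_polynomial α (α₀ + k)
  obtain ⟨q, hq, hqV⟩ := hV'.exists_polynomial (β (φ m)) α
  -- Every root of `p` is at least `α` and every root of `q` is less than `α`, so there is no common
  -- root in `ℂ`.
  obtain ⟨u, v, huv⟩ : IsCoprime p q := by
    rw [Polynomial.isCoprime_iff_aeval_ne_zero_of_isAlgClosed ℂ ℂ]
    intro z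
    by_contra! h
    obtain ⟨a, ha, ha1, -⟩ := hp z (by simpa using h.1)
    obtain ⟨b, hb, -, hb1⟩ := hq z (by simpa using h.2)
    have : a = b := by exact_mod_cast ha.symm.trans hb
    linarith
  have h1 : Polynomial.aeval (euler t' d') p • φ m ∈ V' α := by
    rw [← hs, Polynomial.aeval_algHom_apply, ← hφ]
    exact hV'.antitone (by linarith) (hk k _ (hpV m hm))
  have h2 := hqV _ (hβ (φ m))
  have h3 : φ m = Polynomial.aeval (euler t' d') u • Polynomial.aeval (euler t' d') p • φ m
      + Polynomial.aeval (euler t' d') v • Polynomial.aeval (euler t' d') q • φ m := by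
    rw [← mul_smul, ← mul_smul, ← map_mul, ← map_mul, ← add_smul, ← map_add, huv, map_one, one_smul]
  rw [h3]
  exact (V' α).add_mem
    (hV'.smul_mem_of_vOrder_zero (aeval_mem_vOrder_zero (euler_mem_vOrder t' d') u) h1)
    (hV'.smul_mem_of_vOrder_zero (aeval_mem_vOrder_zero (euler_mem_vOrder t' d') v) h2)

end IsVFiltration

/-! ### Transport of differential operators along isomorphisms. -/

section Conj

variable {A B : Type*} [CommRing A] [Algebra ℂ A] [CommRing B] [Algebra ℂ B]

/-- Transport of vector fields along an isomorphism. -/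
def conjDer (e : A ≃ₐ[ℂ] B) (θ : Derivation ℂ A A) : Derivation ℂ B B :=
  Derivation.mk' (e.toLinearMap ∘ₗ (θ : A →ₗ[ℂ] A) ∘ₗ e.symm.toLinearMap) fun a b => by
    simp [Derivation.leibniz]

theorem conjDer_apply (e : A ≃ₐ[ℂ] B) (θ : Derivation ℂ A A) (b : B) :
    conjDer e θ b = e (θ (e.symm b)) := rfl

theorem conj_mem (e : A ≃ₐ[ℂ] B) (P : DiffOp A) :
    e.toLinearEquiv.conjAlgEquiv ℂ (P : Module.End ℂ A) ∈ DiffOp B := by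
  induction P using DiffOp.induction with
  | hfun a =>
    convert (ofFun (e a)).2 using 1
    ext b
    change e (a * e.symm b) = e a * b
    simp
  | hder θ => exact (ofDer (conjDer e θ)).2
  | hadd P Q hP hQ =>
    have := add_mem hP hQ
    rwa [← map_add] at this
  | hmul P Q hP hQ =>
    have := mul_mem hP hQ
    rwa [← map_mul] at this

/-- Transport of differential operators along an isomorphism. -/
def conj (e : A ≃ₐ[ℂ] B) : DiffOp A →ₐ[ℂ] DiffOp B :=
  ((e.toLinearEquiv.conjAlgEquiv ℂ : Module.End ℂ A →ₐ[ℂ] Module.End ℂ B).comp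
    (DiffOp A).val).codRestrict (DiffOp B) (conj_mem e)

theorem conj_apply (e : A ≃ₐ[ℂ] B) (P : DiffOp A) (b : B) :
    (conj e P : Module.End ℂ B) b = e ((P : Module.End ℂ A) (e.symm b)) := rfl

theorem conj_ofFun (e : A ≃ₐ[ℂ] B) (a : A) : conj e (ofFun a) = ofFun (e a) := by
  refine Subtype.ext (LinearMap.ext fun b => ?_)
  rw [conj_apply, ofFun_coe, ofFun_coe, map_mul, e.apply_symm_apply]

theorem conj_ofDer (e : A ≃ₐ[ℂ] B) (θ : Derivation ℂ A A) :
    conj e (ofDer θ) = ofDer (conjDer e θ) := rfl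

/-- Together the two inclusions say that `e` identifies `I` with `I'`, hence also their powers. -/
theorem conj_mem_vOrder (e : A ≃ₐ[ℂ] B) {I : Ideal A} {I' : Ideal B} (h : I ≤ I'.comap e)
    (h' : I' ≤ I.comap e.symm) {j : ℤ} {P : DiffOp A} (hP : P ∈ vOrder I j) :
    conj e P ∈ vOrder I' j := fun n b hb => by
  have h1 : e.symm b ∈ I ^ n.toNat :=
    Ideal.le_comap_pow e.symm _ (Ideal.pow_right_mono h' _ hb)
  exact Ideal.le_comap_pow e _ (Ideal.pow_right_mono h _ (hP n _ h1))

end Conj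

/-! ### Operators acting on the coefficients of polynomials. -/

section Coeff

variable {A : Type*} [CommRing A] [Algebra ℂ A] {κ : Type*}

variable (A κ) in
/-- Operators applied to the coefficients of polynomials. -/
noncomputable def coeffLinHom : Module.End ℂ A →ₐ[ℂ] Module.End ℂ (MvPolynomial κ A) :=
  AlgHom.ofLinearMap
    { toFun := coeffLin
      map_add' := fun φ ψ => by
        refine LinearMap.ext fun p => ?_
        ext ν
        rw [LinearMap.add_apply, coeff_add]; rfl
      map_smul' := fun z φ => by
        refine LinearMap.ext fun p => ?_
        ext ν
        rw [LinearMap.smul_apply, coeff_smul]; rfl }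
    (by
      refine LinearMap.ext fun p => ?_
      ext ν
      rfl)
    (fun φ ψ => by
      refine LinearMap.ext fun p => ?_
      ext ν
      rfl)

theorem coeffLinHom_mem (P : DiffOp A) :
    coeffLinHom A κ (P : Module.End ℂ A) ∈ DiffOp (MvPolynomial κ A) := by
  induction P using DiffOp.induction with
  | hfun a =>
    convert (ofFun (C a : MvPolynomial κ A)).2 using 1
    refine LinearMap.ext fun p => ?_
    ext ν
    exact (coeff_C_mul ν a p).symm
  | hder θ => exact (ofDer (coeffDer θ)).2
  | hadd P Q hP hQ =>
    have := add_mem hP hQ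
    rwa [← map_add] at this
  | hmul P Q hP hQ =>
    have := mul_mem hP hQ
    rwa [← map_mul] at this

variable (A κ) in
/-- Differential operators applied to the coefficients of polynomials. -/
noncomputable def coeffOp : DiffOp A →ₐ[ℂ] DiffOp (MvPolynomial κ A) :=
  ((coeffLinHom A κ).comp (DiffOp A).val).codRestrict _ coeffLinHom_mem

theorem coeff_coeffOp (P : DiffOp A) (p : MvPolynomial κ A) (ν : κ →₀ ℕ) :
    coeff ν ((coeffOp A κ P : Module.End ℂ _) p) = (P : Module.End ℂ A) (coeff ν p) := rfl

theorem coeffOp_ofFun (a : A) : coeffOp A κ (ofFun a) = ofFun (C a) := by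
  refine Subtype.ext (LinearMap.ext fun p => ?_)
  ext ν
  exact (coeff_C_mul ν a p).symm

theorem coeffOp_ofDer (θ : Derivation ℂ A A) : coeffOp A κ (ofDer θ) = ofDer (coeffDer θ) := rfl

theorem coeffOp_mul_X (P : DiffOp A) (j : κ) :
    coeffOp A κ P * ofFun (X j) = ofFun (X j) * coeffOp A κ P := by
  classical
  refine Subtype.ext (LinearMap.ext fun p => ?_)
  ext ν
  rw [coe_mul_apply, coe_mul_apply, coeff_coeffOp, ofFun_coe, ofFun_coe, coeff_X_mul', coeff_X_mul']
  split_ifs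
  · rw [coeff_coeffOp]
  · rw [map_zero]

/-- The ideal of `Y × {0}` in `Y × 𝔸^κ`, enlarged by an ideal of `Y`. -/
noncomputable def extIdeal (J : Ideal A) (κ : Type*) : Ideal (MvPolynomial κ A) :=
  J.map C ⊔ Ideal.span (Set.range X)

theorem monomial_add_single_one {ι : Type*} (ν : ι →₀ ℕ) (j : ι) :
    monomial (ν + Finsupp.single j 1) (1 : ℤ) = monomial ν 1 * X j := by
  rw [X, monomial_mul, one_mul]

/-- One exponent grows by one at each step, which matches multiplication by a single `∂_{u_j}`. -/
theorem finsupp_nat_induction {ι : Type*} {Q : (ι →₀ ℕ) → Prop} (h0 : Q 0)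
    (h1 : ∀ ν j, Q ν → Q (ν + Finsupp.single j 1)) (ν : ι →₀ ℕ) : Q ν := by
  have h2 : ∀ j n ν, Q ν → Q (Finsupp.single j n + ν) := by
    intro j n ν h
    induction n with
    | zero => simpa using h
    | succ n ih => rw [Finsupp.single_add, add_right_comm]; exact h1 _ _ ih
  induction ν using Finsupp.induction with
  | zero => exact h0
  | single_add j n ν _ _ ih => exact h2 j n ν ih

theorem C_mem_extIdeal_pow {J : Ideal A} {n : ℕ} {a : A} (ha : a ∈ J ^ n) :
    C a ∈ extIdeal J κ ^ n := by
  have h : J ≤ (extIdeal J κ).comap (C : A →+* MvPolynomial κ A) :=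
    fun a ha => Submodule.mem_sup_left (Ideal.mem_map_of_mem _ ha)
  exact Ideal.le_comap_pow _ _ (Ideal.pow_right_mono h _ ha)

theorem monomial_mem_extIdeal_pow (J : Ideal A) (ν : κ →₀ ℕ) :
    monomial ν (1 : A) ∈ extIdeal J κ ^ ν.degree := by
  induction ν using finsupp_nat_induction with
  | h0 => simp
  | h1 ν j ih =>
    rw [← mul_one (1 : A), ← monomial_mul, map_add, Finsupp.degree_single, pow_succ]
    exact Ideal.mul_mem_mul ih (Submodule.mem_sup_right (Ideal.subset_span ⟨j, rfl⟩))

theorem coeff_mem_of_mem_extIdeal {J : Ideal A} {p : MvPolynomial κ A} (hp : p ∈ extIdeal J κ) :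
    coeff 0 p ∈ J := by
  have h : extIdeal J κ ≤ J.comap (constantCoeff : MvPolynomial κ A →+* A) := by
    refine sup_le (Ideal.map_le_iff_le_comap.mpr fun a ha => ?_) (Ideal.span_le.mpr ?_)
    · simpa using ha
    · rintro _ ⟨j, rfl⟩
      simp
  exact h hp

/-- In a product with an element `m` of the ideal, only the constant coefficient of `m` contributes
without using up degree in `u`, and it lies in `J`. The truncated exponent imposes no condition once
`|ν| ≥ n`. -/
theorem mem_extIdeal_pow_iff {J : Ideal A} {n : ℕ} {p : MvPolynomial κ A} :
    p ∈ extIdeal J κ ^ n ↔ ∀ ν : κ →₀ ℕ, coeff ν p ∈ J ^ (n - ν.degree) := by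
  classical
  constructor
  · intro hp
    induction hp using Submodule.pow_induction_on_left' with
    | algebraMap r => simp
    | add x y i _ _ hx hy => intro ν; rw [coeff_add]; exact Submodule.add_mem _ (hx ν) (hy ν)
    | mem_mul m hm i x hx ih =>
      intro ν
      rw [coeff_mul]
      refine Submodule.sum_mem _ fun μ hμ => ?_
      have hμ' := congrArg Finsupp.degree (Finset.HasAntidiagonal.mem_antidiagonal.mp hμ)
      rw [map_add] at hμ'
      by_cases h0 : μ.1 = 0
      · rw [h0] at hμ' ⊢
        rw [map_zero, zero_add] at hμ'
        have := Ideal.mul_mem_mul (coeff_mem_of_mem_extIdeal hm) (ih μ.2)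
        rw [← pow_succ'] at this
        exact Ideal.pow_le_pow_right (by omega) this
      · have : 0 < μ.1.degree := Nat.pos_of_ne_zero fun h => h0 ((Finsupp.degree_eq_zero_iff _).mp h)
        exact Ideal.mul_mem_left _ _ (Ideal.pow_le_pow_right (by omega) (ih μ.2))
  · intro h
    rw [p.as_sum]
    refine Submodule.sum_mem _ fun ν _ => ?_
    rw [← mul_one (coeff ν p), ← C_mul_monomial]
    have := Ideal.mul_mem_mul (C_mem_extIdeal_pow (κ := κ) (h ν)) (monomial_mem_extIdeal_pow J ν)
    rw [← pow_add] at this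
    exact Ideal.pow_le_pow_right (by omega) this

/-- Powers of the enlarged ideal are described coefficient by coefficient, so the order of `P` is
tested at the exponent `n - |ν|`. This may be negative, which the convention `J^i = A` for `i ≤ 0`
covers. -/
theorem coeffOp_mem_vOrder {J : Ideal A} {i : ℤ} {P : DiffOp A} (hP : P ∈ vOrder J i) :
    coeffOp A κ P ∈ vOrder (extIdeal J κ) i := fun n p hp => by
  rw [mem_extIdeal_pow_iff] at hp ⊢
  intro ν
  rw [coeff_coeffOp]
  have := hP (n - ν.degree) (coeff ν p) (Ideal.pow_le_pow_right (by omega) (hp ν))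
  exact Ideal.pow_le_pow_right (by omega) this

end Coeff

/-! ### Operators on `Y` in coordinates adapted to the graph of `h`. -/

section Graph

variable {A : Type*} [CommRing A] [Algebra ℂ A] {κ : Type*} (h : κ → A)

/-- The change of coordinates `u_j ↦ u_j - h_j`. -/
noncomputable def shift : MvPolynomial κ A ≃ₐ[A] MvPolynomial κ A :=
  AlgEquiv.ofAlgHom (aeval fun j => X j - C (h j)) (aeval fun j => X j + C (h j))
    (by ext j; simp) (by ext j; simp)

theorem shift_C (a : A) : shift h (C a) = C a := (shift h).commutes a
theorem shift_symm_C (a : A) : (shift h).symm (C a) = C a := (shift h).symm.commutes a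
theorem shift_X (j : κ) : shift h (X j) = X j - C (h j) := aeval_X _ _
theorem shift_symm_X (j : κ) : (shift h).symm (X j) = X j + C (h j) := aeval_X _ _

/-- The operators of `Y` as operators of `Y × 𝔸^κ` in the coordinates `u_j - h_j`. -/
noncomputable def graphOp : DiffOp A →ₐ[ℂ] DiffOp (MvPolynomial κ A) :=
  (conj ((shift h).restrictScalars ℂ)).comp (coeffOp A κ)

theorem graphOp_ofFun (a : A) : graphOp h (ofFun a) = ofFun (C a) := by
  change conj _ (coeffOp A κ (ofFun a)) = _
  rw [coeffOp_ofFun, conj_ofFun]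
  exact congrArg ofFun (shift_C h a)

theorem sum_der_apply {B : Type*} [CommRing B] [Algebra ℂ B] {ι : Type*} (s : Finset ι)
    (F : ι → Derivation ℂ B B) (b : B) : (∑ p ∈ s, F p) b = ∑ p ∈ s, F p b :=
  map_sum (AddMonoidHom.mk' (fun θ : Derivation ℂ B B => θ b) fun _ _ => rfl) _ _

theorem ofDer_sum {B : Type*} [CommRing B] [Algebra ℂ B] {ι : Type*} (s : Finset ι)
    (F : ι → Derivation ℂ B B) : ofDer (∑ p ∈ s, F p) = ∑ p ∈ s, ofDer (F p) :=
  map_sum (AddMonoidHom.mk' (ofDer (A := B)) ofDer_add) _ _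

/-- Conjugation with the shift adds the terms `ξ(h_j) ∂_{u_j}`. These are exactly what cancels the
correction terms in the action of `ξ` on a direct image. -/
theorem graphOp_ofDer [Fintype κ] (ξ : Derivation ℂ A A) :
    graphOp h (ofDer ξ) = ofDer (coeffDer ξ)
      + ∑ j, ofFun (C (ξ (h j))) * ofDer (partialDer j) := by
  classical
  have e : conjDer ((shift h).restrictScalars ℂ) (coeffDer ξ)
      = coeffDer ξ + ∑ j, (C (ξ (h j)) : MvPolynomial κ A) • partialDer j := by
    refine der_ext (fun a => ?_) (fun k => ?_)
    · rw [conjDer_apply, Derivation.add_apply, sum_der_apply]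
      change shift h (coeffDer ξ ((shift h).symm (C a))) = _
      simp [shift_symm_C, coeffDer_C, shift_C, partialDer_C]
    · rw [conjDer_apply, Derivation.add_apply, sum_der_apply]
      change shift h (coeffDer ξ ((shift h).symm (X k))) = _
      simp [shift_symm_X, coeffDer_C, coeffDer_X, shift_C, partialDer_X]
  change conj _ (coeffOp A κ (ofDer ξ)) = _
  rw [coeffOp_ofDer, conj_ofDer, e, ofDer_add, ofDer_sum]
  simp only [ofDer_smul]

/-- In the adapted coordinates `u_j - h_j` is a coordinate of the fibre, which operators on
coefficients do not touch. An equation `(u_j - h_j) x = 0` thereby propagates to all `graphOp h P •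
x`. -/
theorem graphOp_mul_X_sub (P : DiffOp A) (j : κ) :
    graphOp h P * ofFun (X j - C (h j)) = ofFun (X j - C (h j)) * graphOp h P := by
  have e : ofFun (X j - C (h j)) = conj ((shift h).restrictScalars ℂ) (ofFun (X j)) := by
    rw [conj_ofFun]; exact congrArg ofFun (shift_X h j).symm
  change conj _ (coeffOp A κ P) * _ = _ * conj _ (coeffOp A κ P)
  rw [e, ← map_mul, ← map_mul, coeffOp_mul_X]

/-- Since `h_j ∈ J`, the shift and its inverse preserve the ideal `J + (u)`. -/
theorem graphOp_mem_vOrder {J : Ideal A} (hJ : ∀ j, h j ∈ J) {i : ℤ} {P : DiffOp A}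
    (hP : P ∈ vOrder J i) : graphOp h P ∈ vOrder (extIdeal J κ) i := by
  have hC : ∀ a ∈ J, C a ∈ extIdeal J κ := fun a ha =>
    Submodule.mem_sup_left (Ideal.mem_map_of_mem _ ha)
  have hX : ∀ j, (X j : MvPolynomial κ A) ∈ extIdeal J κ := fun j =>
    Submodule.mem_sup_right (Ideal.subset_span ⟨j, rfl⟩)
  have h1 : extIdeal J κ ≤ (extIdeal J κ).comap (shift h).toRingHom := by
    refine sup_le (Ideal.map_le_iff_le_comap.mpr fun a ha => ?_) (Ideal.span_le.mpr ?_)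
    · have := hC a ha
      rwa [← shift_C h a] at this
    · rintro _ ⟨j, rfl⟩
      have := sub_mem (hX j) (hC _ (hJ j))
      rwa [← shift_X h j] at this
  have h2 : extIdeal J κ ≤ (extIdeal J κ).comap (shift h).symm.toRingHom := by
    refine sup_le (Ideal.map_le_iff_le_comap.mpr fun a ha => ?_) (Ideal.span_le.mpr ?_)
    · have := hC a ha
      rwa [← shift_symm_C h a] at this
    · rintro _ ⟨j, rfl⟩
      have := add_mem (hX j) (hC _ (hJ j))
      rwa [← shift_symm_X h j] at this
  exact conj_mem_vOrder ((shift h).restrictScalars ℂ) h1 h2 (coeffOp_mem_vOrder hP)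

end Graph

/-! ### The universal property of the direct image. -/

section Universal

variable {A : Type*} [CommRing A] [Algebra ℂ A] {κ : Type*}

theorem ofDer_commute {B : Type*} [CommRing B] [Algebra ℂ B] {θ η : Derivation ℂ B B}
    (h : ⁅θ, η⁆ = 0) : ofDer θ * ofDer η = ofDer η * ofDer θ := by
  have := ofDer_lie θ η
  rw [h] at this
  exact (sub_eq_zero.mp this.symm)

open scoped IsMulCommutative in
-- Polynomials are evaluated in the commutative subring generated by the `x_j`. Integer coefficients
-- suffice for the monomials `∂_u^ν` and their formal derivatives.
theorem exists_ringHom_of_commute {S ι : Type*} [Ring S] (x : ι → S)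
    (hx : ∀ i j, x i * x j = x j * x i) : ∃ D : MvPolynomial ι ℤ →+* S, ∀ j, D (X j) = x j := by
  have := Subring.isMulCommutative_closure (s := Set.range x) (by
    rintro _ ⟨i, rfl⟩ _ ⟨j, rfl⟩
    exact hx i j)
  let g : ι → Subring.closure (Set.range x) := fun j => ⟨x j, Subring.subset_closure ⟨j, rfl⟩⟩
  exact ⟨(Subring.closure (Set.range x)).subtype.comp (eval₂Hom (Int.castRingHom _) g),
    fun j => congrArg Subtype.val (eval₂Hom_X' _ g j)⟩

theorem commute_ofDer_partialDer_ofFun (j : κ) (a : A) :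
    ofDer (partialDer j) * ofFun (C a : MvPolynomial κ A) = ofFun (C a) * ofDer (partialDer j) := by
  rw [ofDer_mul_ofFun, partialDer_C, map_zero, add_zero]

variable [Fintype κ]

variable (A κ) in
/-- Polynomials in the vector fields `∂_{u_j}`. -/
theorem exists_partialOp : ∃ D : MvPolynomial κ ℤ →+* DiffOp (MvPolynomial κ A),
    ∀ j, D (X j) = ofDer (partialDer j) := by
  obtain ⟨D, hD⟩ := exists_ringHom_of_commute (S := DiffOp (MvPolynomial κ A))
    (fun j => ofDer (partialDer j))
    fun i j => ofDer_commute (DirectImage.lie_partialDer i j)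
  exact ⟨D, hD⟩

/-- Polynomials in the vector fields `∂_{u_j}`. -/
noncomputable def partialOp : MvPolynomial κ ℤ →+* DiffOp (MvPolynomial κ A) :=
  (exists_partialOp A κ).choose

theorem partialOp_X (j : κ) : partialOp (X j) = ofDer (partialDer (R := A) j) :=
  (exists_partialOp A κ).choose_spec j

theorem partialOp_commute {P : DiffOp (MvPolynomial κ A)}
    (h : ∀ j, ofDer (partialDer j) * P = P * ofDer (partialDer j)) (q : MvPolynomial κ ℤ) :
    partialOp q * P = P * partialOp q := by
  induction q using MvPolynomial.induction_on with
  | C a =>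
    have : (C a : MvPolynomial κ ℤ) = (a : ℤ) := by simp
    rw [this, map_intCast]; exact Int.cast_comm a P
  | add p q hp hq => rw [map_add, add_mul, mul_add, hp, hq]
  | mul_X p j hp => rw [map_mul, partialOp_X, mul_assoc, h, ← mul_assoc, hp, mul_assoc]

/-- The commutator of `q(∂_u)` with `u_j` is the formal derivative of `q`. For `q = ∂_u^ν` this is
the origin of the term `-ν_j m ⊗ ∂_u^{ν-e_j}` in the action of `u_j`. -/
theorem partialOp_mul_X (q : MvPolynomial κ ℤ) (j : κ) :
    partialOp q * ofFun (X j : MvPolynomial κ A)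
      = ofFun (X j) * partialOp q + partialOp (pderiv j q) := by
  classical
  induction q using MvPolynomial.induction_on with
  | C a =>
    have : (C a : MvPolynomial κ ℤ) = (a : ℤ) := by simp
    rw [pderiv_C, map_zero, add_zero, this, map_intCast]; exact Int.cast_comm a _
  | add p q hp hq => simp only [map_add, add_mul, mul_add, hp, hq]; abel
  | mul_X p k hp =>
    rw [map_mul, partialOp_X, mul_assoc, ofDer_mul_ofFun, mul_add, ← mul_assoc, hp, partialDer_X,
      Derivation.leibniz, pderiv_X, smul_eq_mul, smul_eq_mul, map_add, map_mul, map_mul,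
      partialOp_X, Pi.single_apply]
    have e1 := partialOp_commute (A := A) (κ := κ) (P := ofDer (partialDer k))
      (fun i => ofDer_commute (DirectImage.lie_partialDer i k)) (pderiv j p)
    rw [← e1, add_mul, mul_assoc]
    split_ifs with hk
    · rw [map_one, map_one, mul_one]; abel
    · rw [map_zero, map_zero, mul_zero]; abel

variable [Algebra.Smooth ℂ A]

variable (A κ) in
-- The decomposition does not involve the module, so it is read off from the construction of a
-- direct image with `h = 0`.
theorem exists_der_eq (θ : Derivation ℂ (MvPolynomial κ A) (MvPolynomial κ A)) :
    ∃ (n : ℕ) (a : Fin n → MvPolynomial κ A) (ξ : Fin n → Derivation ℂ A A)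
      (b : κ → MvPolynomial κ A),
      θ = ∑ p, a p • coeffDer (ξ p) + ∑ j, b j • partialDer j :=
  (DirectImage.exists_nab (0 : κ → A) (DiffOp A)).choose_spec.2.2.2 θ

/-- The operators of `Y × 𝔸^κ` are generated by the functions and vector fields on `Y`, the
coordinates `u_j` and the vector fields `∂_{u_j}`. -/
theorem DiffOp.induction_poly {Q : DiffOp (MvPolynomial κ A) → Prop}
    (hC : ∀ a, Q (ofFun (C a))) (hX : ∀ j, Q (ofFun (X j)))
    (hξ : ∀ ξ, Q (ofDer (coeffDer ξ))) (hp : ∀ j, Q (ofDer (partialDer j)))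
    (hadd : ∀ P P', Q P → Q P' → Q (P + P')) (hmul : ∀ P P', Q P → Q P' → Q (P * P'))
    (P : DiffOp (MvPolynomial κ A)) : Q P := by
  have hf : ∀ p : MvPolynomial κ A, Q (ofFun p) := fun p => by
    induction p using MvPolynomial.induction_on with
    | C a => exact hC a
    | add p q hp hq => rw [map_add]; exact hadd _ _ hp hq
    | mul_X p j hp => rw [map_mul]; exact hmul _ _ hp (hX j)
  refine DiffOp.induction hf (fun θ => ?_) hadd hmul P
  refine DirectImage.der_induction (exists_der_eq A κ) (P := fun θ => Q (ofDer θ)) ?_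
    (fun θ η => hadd _ _) (fun a θ h => ?_) hξ hp θ
  · have : ofDer (0 : Derivation ℂ (MvPolynomial κ A) _) = ofFun 0 := by rw [map_zero]; rfl
    rw [this]; exact hf 0
  · rw [ofDer_smul]; exact hmul _ _ (hf a) h

variable {h : κ → A} {M : Type*} [AddCommGroup M] [Module (DiffOp A) M]

theorem DirectImage.induction {C : DirectImage h M → Prop} (h0 : C 0)
    (hadd : ∀ x y, C x → C y → C (x + y)) (ht : ∀ ν m, C (DirectImage.tmul h ν m))
    (x : DirectImage h M) : C x :=
  Finsupp.induction_linear (motive := C) x h0 hadd ht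

/-- The extra terms of `graphOp_ofDer` cancel the corrections in the action of `ξ`. Through
`graphOp` the operators on `Y` therefore act on the factor `M` alone, for every `ν`. -/
theorem graphOp_smul_tmul (P : DiffOp A) (ν : κ →₀ ℕ) (m : M) :
    graphOp h P • DirectImage.tmul h ν m = DirectImage.tmul h ν (P • m) := by
  induction P using DiffOp.induction generalizing ν m with
  | hfun a => rw [graphOp_ofFun, DirectImage.ofFun_C_smul]
  | hder ξ =>
    rw [graphOp_ofDer, add_smul, DirectImage.ofDer_coeffDer_smul, Finset.sum_smul]
    simp only [mul_smul, DirectImage.ofDer_partialDer_smul, DirectImage.ofFun_C_smul,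
      sub_add_cancel]
  | hadd P Q hP hQ => rw [map_add, add_smul, hP, hQ, add_smul, map_add]
  | hmul P Q hP hQ => rw [map_mul, mul_smul, hQ, hP, mul_smul]

theorem partialOp_smul_tmul (ν : κ →₀ ℕ) (m : M) :
    partialOp (A := A) (monomial ν 1) • DirectImage.tmul h 0 m = DirectImage.tmul h ν m := by
  induction ν using finsupp_nat_induction with
  | h0 =>
    have : (monomial (0 : κ →₀ ℕ) (1 : ℤ)) = 1 := rfl
    rw [this, map_one, one_smul]
  | h1 ν j ih =>
    rw [monomial_add_single_one, mul_comm, map_mul, partialOp_X, mul_smul, ih,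
      DirectImage.ofDer_partialDer_smul]

/-- The direct image is the universal `D`-module with an additive map from `M` that satisfies the
rules of calculation for the elements `m ⊗ 1`. -/
theorem DirectImage.exists_lift {S K : Type*} [Ring S] [AddCommGroup K] [Module S K]
    (τ : DiffOp (MvPolynomial κ A) →+* S) (i : M →+ K)
    (hC : ∀ a m, i (ofFun a • m) = τ (ofFun (C a)) • i m)
    (hX : ∀ j m, i (ofFun (h j) • m) = τ (ofFun (X j)) • i m)
    (hξ : ∀ ξ m, i (ofDer ξ • m) = τ (ofDer (coeffDer ξ)) • i m
      + ∑ j, τ (ofDer (partialDer j)) • i (ofFun (ξ (h j)) • m)) :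
    ∃ φ : DirectImage h M →+ K, (∀ m, φ (tmul h 0 m) = i m) ∧
      ∀ P x, φ (P • x) = τ P • φ x := by
  -- The choice is forced by `m ⊗ ∂_u^ν = ∂_u^ν (m ⊗ 1)`.
  let φ : DirectImage h M →+ K := Finsupp.liftAddHom fun ν =>
    (DistribSMul.toAddMonoidHom K (τ (partialOp (monomial ν 1)))).comp i
  have hφ : ∀ ν m, φ (tmul h ν m) = τ (partialOp (monomial ν 1)) • i m := fun ν m =>
    Finsupp.liftAddHom_apply_single _ _ _
  have key : ∀ P : DiffOp (MvPolynomial κ A),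
      (∀ ν m, φ (P • tmul h ν m) = τ P • φ (tmul h ν m)) → ∀ x, φ (P • x) = τ P • φ x := by
    intro P hP x
    induction x using DirectImage.induction with
    | h0 => rw [smul_zero, map_zero, smul_zero]
    | hadd x y hx hy => rw [smul_add, map_add, hx, hy, map_add, smul_add]
    | ht ν m => exact hP ν m
  refine ⟨φ, fun m => ?_, fun P => ?_⟩
  · have : (monomial (0 : κ →₀ ℕ) (1 : ℤ)) = 1 := rfl
    rw [hφ, this, map_one, map_one, one_smul]
  · induction P using DiffOp.induction_poly with
    | hC a =>
      refine key _ fun ν m => ?_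
      rw [ofFun_C_smul, hφ, hφ, hC, ← mul_smul, ← mul_smul, ← map_mul, ← map_mul,
        partialOp_commute fun j => commute_ofDer_partialDer_ofFun j a]
    | hX j =>
      refine key _ fun ν m => ?_
      have e : partialOp (A := A) (pderiv j (monomial ν 1))
          = ν j • partialOp (monomial (ν - Finsupp.single j 1) 1) := by
        rw [pderiv_monomial, one_mul, ← map_nsmul, ← map_nsmul]
        congr 2
        simp
      rw [ofFun_X_smul, map_sub, map_nsmul, hφ, hφ, hφ, hX, ← mul_smul, ← map_mul,
        partialOp_mul_X, e, map_add, map_mul, map_nsmul, add_smul, mul_smul, smul_assoc,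
        add_sub_cancel_right]
    | hξ ξ =>
      refine key _ fun ν m => ?_
      rw [ofDer_coeffDer_smul, map_sub, map_sum]
      simp only [hφ, monomial_add_single_one]
      rw [hξ, smul_add, ← mul_smul, ← map_mul,
        partialOp_commute fun j => (ofDer_commute (lie_coeffDer_partialDer ξ j)).symm, map_mul,
        mul_smul, Finset.smul_sum, add_sub_assoc, add_eq_left, sub_eq_zero]
      refine Finset.sum_congr rfl fun j _ => ?_
      rw [← mul_smul, ← map_mul, map_mul partialOp, partialOp_X]
    | hp j =>
      refine key _ fun ν m => ?_
      rw [ofDer_partialDer_smul, hφ, hφ, monomial_add_single_one, mul_comm, map_mul, partialOp_X, map_mul, mul_smul]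
    | hadd P P' h1 h2 => intro x; rw [add_smul, map_add, h1, h2, map_add, add_smul]
    | hmul P P' h1 h2 => intro x; rw [mul_smul, h1, h2, map_mul, mul_smul]

end Universal

/-! ### The grading of functions and operators by dilation of `(t, t')`. -/

section Homogeneous

variable {R : Type*} [CommRing R] [Algebra ℂ R] {ι κ : Type*}

/-- Homogeneous polynomials in the coordinates `t, t'`. -/
inductive IsHomog : ℤ → MvPolynomial κ (MvPolynomial ι R) → Prop
  | base (r : R) : IsHomog 0 (C (C r))
  | coord (k : ι ⊕ κ) : IsHomog 1 (coords k)
  | zero (n : ℤ) : IsHomog n 0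
  | add (n : ℤ) (p q) (hp : IsHomog n p) (hq : IsHomog n q) : IsHomog n (p + q)
  | mul (n m : ℤ) (p q) (hp : IsHomog n p) (hq : IsHomog m q) : IsHomog (n + m) (p * q)

variable (R ι κ) in
/-- The dilation `t ↦ s t`, `t' ↦ s t'`. -/
noncomputable def dilation : MvPolynomial κ (MvPolynomial ι R) →+*
    Polynomial (MvPolynomial κ (MvPolynomial ι R)) :=
  eval₂Hom (eval₂Hom (Polynomial.C.comp (C.comp C)) fun i => Polynomial.X * Polynomial.C (C (X i)))
    fun j => Polynomial.X * Polynomial.C (X j)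

theorem dilation_base (r : R) : dilation R ι κ (C (C r)) = Polynomial.C (C (C r)) := by
  simp [dilation]

theorem dilation_coords (k : ι ⊕ κ) :
    dilation R ι κ (coords k) = Polynomial.X * Polynomial.C (coords k) := by
  cases k <;> simp [dilation, coords]

/-- Degrees are integers because the coordinate fields lower them. In negative degree nothing
survives. -/
theorem IsHomog.eq_zero {n : ℤ} {p : MvPolynomial κ (MvPolynomial ι R)} (h : IsHomog n p)
    (hn : n < 0) : p = 0 := by
  induction h with
  | base r => omega
  | coord k => omega
  | zero n => rfl
  | add n p q _ _ hp hq => rw [hp hn, hq hn, add_zero]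
  | mul n m p q _ _ hp hq =>
    rcases lt_or_ge n 0 with h | h
    · rw [hp h, zero_mul]
    · rw [hq (by omega), mul_zero]

theorem IsHomog.neg {n : ℤ} {p : MvPolynomial κ (MvPolynomial ι R)} (h : IsHomog n p) :
    IsHomog n (-p) := by
  have := IsHomog.mul 0 _ _ _ (.base (-1)) h
  rw [zero_add, map_neg, map_neg, map_one, map_one] at this
  exact (neg_one_mul p : _) ▸ this

/-- Homogeneity becomes multiplication by a power of the dilation parameter. Components of different
degrees can then be separated as coefficients of a polynomial in that parameter. -/
theorem IsHomog.dilation_eq {n : ℤ} {p : MvPolynomial κ (MvPolynomial ι R)} (h : IsHomog n p) :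
    dilation R ι κ p = Polynomial.X ^ n.toNat * Polynomial.C p := by
  induction h with
  | base r => rw [dilation_base]; simp
  | coord k => rw [dilation_coords]; simp
  | zero n => simp
  | add n p q _ _ hp hq => rw [map_add, hp, hq, map_add, mul_add]
  | mul n m p q hp' hq' hp hq =>
    rcases lt_or_ge n 0 with h | h
    · rw [hp'.eq_zero h]; simp
    rcases lt_or_ge m 0 with h' | h'
    · rw [hq'.eq_zero h']; simp
    rw [map_mul, hp, hq, Int.toNat_add h h', pow_add, Polynomial.C_mul]
    ring

theorem IsHomog.mem_pow {n : ℤ} {p : MvPolynomial κ (MvPolynomial ι R)} (h : IsHomog n p) :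
    p ∈ Ideal.span (Set.range coords) ^ n.toNat := by
  induction h with
  | base r => simp
  | coord k =>
    rw [Int.toNat_one, pow_one]
    exact Ideal.subset_span (Set.mem_range_self k)
  | zero n => exact Submodule.zero_mem _
  | add n p q _ _ hp hq => exact Submodule.add_mem _ hp hq
  | mul n m p q _ _ hp hq =>
    have := Ideal.mul_mem_mul hp hq
    rw [← pow_add] at this
    exact Ideal.pow_le_pow_right (by omega) this

theorem X_pow_dvd_dilation {n : ℕ} {p : MvPolynomial κ (MvPolynomial ι R)}
    (hp : p ∈ Ideal.span (Set.range coords) ^ n) : Polynomial.X ^ n ∣ dilation R ι κ p := by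
  have h : Ideal.span (Set.range coords)
      ≤ (Ideal.span {(Polynomial.X : Polynomial (MvPolynomial κ (MvPolynomial ι R)))}).comap
        (dilation R ι κ) := by
    rw [Ideal.span_le]
    rintro _ ⟨k, rfl⟩
    rw [SetLike.mem_coe, Ideal.mem_comap, dilation_coords, Ideal.mem_span_singleton]
    exact dvd_mul_right _ _
  have := Ideal.le_comap_pow _ n (Ideal.pow_right_mono h n hp)
  rwa [Ideal.mem_comap, Ideal.span_singleton_pow, Ideal.mem_span_singleton] at this

/-- The claim is strengthened to products `p * q` with `q` homogeneous, so that the variables can be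
moved one at a time from `p` into `q`. -/
theorem IsHomog.induction {Q : MvPolynomial κ (MvPolynomial ι R) → Prop}
    (hQ : ∀ n p, IsHomog n p → Q p) (hadd : ∀ p q, Q p → Q q → Q (p + q))
    (p : MvPolynomial κ (MvPolynomial ι R)) : Q p := by
  have hmul : ∀ p : MvPolynomial κ (MvPolynomial ι R),
      ∀ n q, IsHomog n q → Q (p * q) := by
    intro p
    induction p using MvPolynomial.induction_on with
    | C b =>
      induction b using MvPolynomial.induction_on with
      | C r => exact fun n q hq => hQ _ _ (.mul _ _ _ _ (.base r) hq)
      | add b b' hb hb' =>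
        intro n q hq
        rw [map_add, add_mul]; exact hadd _ _ (hb n q hq) (hb' n q hq)
      | mul_X b i hb =>
        intro n q hq
        rw [map_mul, mul_assoc]; exact hb _ _ (.mul _ _ _ _ (.coord (Sum.inl i)) hq)
    | add b b' hb hb' =>
      intro n q hq
      rw [add_mul]; exact hadd _ _ (hb n q hq) (hb' n q hq)
    | mul_X b i hb =>
      intro n q hq
      rw [mul_assoc]; exact hb _ _ (.mul _ _ _ _ (.coord (Sum.inr i)) hq)
  have := hmul p 0 (C (C 1)) (.base 1)
  rwa [map_one, map_one, mul_one] at this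

theorem IsHomog.derivation {θ : Derivation ℂ (MvPolynomial κ (MvPolynomial ι R))
    (MvPolynomial κ (MvPolynomial ι R))} {w : ℤ} (hb : ∀ r, IsHomog w (θ (C (C r))))
    (hc : ∀ k, IsHomog (1 + w) (θ (coords k))) {n : ℤ} {p : MvPolynomial κ (MvPolynomial ι R)}
    (h : IsHomog n p) : IsHomog (n + w) (θ p) := by
  induction h with
  | base r => rw [zero_add]; exact hb r
  | coord k => exact hc k
  | zero n => rw [map_zero]; exact .zero _
  | add n p q _ _ hp hq => rw [map_add]; exact .add _ _ _ hp hq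
  | mul n m p q hp' hq' hp hq =>
    rw [Derivation.leibniz, smul_eq_mul, smul_eq_mul]
    refine .add _ _ _ ?_ ?_
    · rw [add_assoc]; exact .mul _ _ _ _ hp' hq
    · rw [show n + m + w = m + (n + w) by ring]; exact .mul _ _ _ _ hq' hp

/-- Operators of order at least `j` with respect to the `V`-filtration have no homogeneous
components of degree less than `j`. -/
theorem eq_zero_of_sum_mem_vOrder {s : Finset ℤ}
    {P : ℤ → DiffOp (MvPolynomial κ (MvPolynomial ι R))}
    (hP : ∀ d n p, IsHomog n p → IsHomog (n + d) ((P d : Module.End ℂ (MvPolynomial κ (MvPolynomial ι R))) p)) {j : ℤ}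
    (hs : ∑ d ∈ s, P d ∈ vOrder (Ideal.span (Set.range coords)) j) {d : ℤ} (hd : d ∈ s)
    (hdj : d < j) : P d = 0 := by
  refine Subtype.ext (LinearMap.ext fun p => ?_)
  change (P d : Module.End ℂ (MvPolynomial κ (MvPolynomial ι R))) p = 0
  induction p using IsHomog.induction with
  | hadd p q hp hq => rw [map_add, hp, hq, add_zero]
  | hQ n p hp =>
    rcases lt_or_ge n 0 with hn | hn
    · rw [hp.eq_zero hn, map_zero]
    rcases lt_or_ge (n + d) 0 with hnd | hnd
    · exact (hP d n p hp).eq_zero hnd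
    -- Order at least `j` makes the dilated image of `p` divisible by the power `n + j` of the
    -- parameter. The component `P d` contributes in exponent `n + d < n + j`, so that coefficient,
    -- which is `P d` applied to `p`, is zero.
    have h1 := X_pow_dvd_dilation (hs n p hp.mem_pow)
    have h2 : ((∑ d ∈ s, P d : DiffOp _) : Module.End ℂ (MvPolynomial κ (MvPolynomial ι R))) p
        = ∑ d ∈ s, (P d : Module.End ℂ (MvPolynomial κ (MvPolynomial ι R))) p := by
      rw [AddSubmonoidClass.coe_finsetSum, LinearMap.sum_apply]
    rw [h2, map_sum, Polynomial.X_pow_dvd_iff] at h1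
    have h3 := h1 (n + d).toNat (by omega)
    rw [Polynomial.finsetSum_coeff, Finset.sum_eq_single d] at h3
    · rw [(hP d n p hp).dilation_eq, Polynomial.coeff_X_pow_mul'] at h3
      simpa using h3
    · intro e _ hed
      rcases lt_or_ge (n + e) 0 with h | h
      · rw [(hP e n p hp).eq_zero h]; simp
      · rw [(hP e n p hp).dilation_eq, Polynomial.coeff_X_pow_mul']
        split_ifs with hle
        · exact Polynomial.coeff_C_of_ne_zero (by omega)
        · rfl
    · exact fun h => absurd hd h

variable [Fintype ι] [Fintype κ] [Algebra.Smooth ℂ R]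

/-- A system of generators adapted to the grading: their degrees are 0, 1, 0 and -1. -/
theorem DiffOp.induction_poly_poly {Q : DiffOp (MvPolynomial κ (MvPolynomial ι R)) → Prop}
    (hb : ∀ r, Q (ofFun (C (C r)))) (hc : ∀ k, Q (ofFun (coords k)))
    (hξ : ∀ ξ, Q (ofDer (coeffDer (coeffDer ξ)))) (hd : ∀ k, Q (ofDer (coordFields k)))
    (hadd : ∀ P P', Q P → Q P' → Q (P + P')) (hmul : ∀ P P', Q P → Q P' → Q (P * P'))
    (P : DiffOp (MvPolynomial κ (MvPolynomial ι R))) : Q P := by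
  have h : ∀ P : DiffOp (MvPolynomial ι R), Q (coeffOp (MvPolynomial ι R) κ P) := by
    refine DiffOp.induction_poly (fun r => ?_) (fun i => ?_) (fun ξ => ?_) (fun i => ?_)
      (fun P P' h h' => ?_) (fun P P' h h' => ?_)
    · rw [coeffOp_ofFun]; exact hb r
    · rw [coeffOp_ofFun]; exact hc (Sum.inl i)
    · exact hξ ξ
    · exact hd (Sum.inl i)
    · rw [map_add]; exact hadd _ _ h h'
    · rw [map_mul]; exact hmul _ _ h h'
  refine DiffOp.induction_poly (fun a => ?_) (fun j => hc (Sum.inr j)) (fun ξ => h (ofDer ξ))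
    (fun j => hd (Sum.inr j)) hadd hmul P
  rw [← coeffOp_ofFun]; exact h _

end Homogeneous

/-! ### Jumps and nilpotency orders far out in the filtration. -/

section Filtration

variable {M : Type*} [AddCommGroup M]

/-- The subgroup `V^{>α}`. -/
def gtSubgroup (V : ℝ → AddSubgroup M) (hV : Antitone V) (α : ℝ) : AddSubgroup M where
  carrier := gtPart V α
  zero_mem' := ⟨α + 1, by simp, (V _).zero_mem⟩
  add_mem' := by
    rintro x y ⟨β, hβ, hx⟩ ⟨γ, hγ, hy⟩
    exact ⟨min β γ, lt_min hβ hγ, (V _).add_mem (hV (min_le_left _ _) hx)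
      (hV (min_le_right _ _) hy)⟩
  neg_mem' := by
    rintro x ⟨β, hβ, hx⟩
    exact ⟨β, hβ, (V β).neg_mem hx⟩

namespace IsVFiltration

variable {A : Type*} [CommRing A] [Algebra ℂ A] [Module (DiffOp A) M]
  {ι : Type*} [Fintype ι] {t : ι → A} {d : ι → Derivation ℂ A A} {V : ℝ → AddSubgroup M}

theorem smul_mem_gtPart (hV : IsVFiltration t d V) {P : DiffOp A}
    (hP : P ∈ vOrder (Ideal.span (Set.range t)) 0) {α : ℝ} {m : M} (hm : m ∈ gtPart V α) :
    P • m ∈ gtPart V α := by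
  obtain ⟨β, hβ, hm⟩ := hm
  exact ⟨β, hβ, hV.smul_mem_of_vOrder_zero hP hm⟩

theorem coord_smul_mem_gtPart (hV : IsVFiltration t d V) (j : ι) {α : ℝ} {m : M}
    (hm : m ∈ gtPart V α) : ofFun (t j) • m ∈ gtPart V (α + 1) := by
  obtain ⟨β, hβ, hm⟩ := hm
  exact ⟨β + 1, by linarith, hV.coord_smul_mem j hm⟩

/-- If `α + 1` is a jump and `α` is large, then `α` is a jump. -/
theorem exists_jumps_of_add_one (hV : IsVFiltration t d V) :
    ∃ α₀ : ℝ, ∀ α ≥ α₀, α + 1 ∈ jumps V → α ∈ jumps V := by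
  obtain ⟨α₀, hα₀⟩ := hV.eventually
  refine ⟨α₀, fun α hα => ?_⟩
  rintro ⟨m, hm, hgt⟩
  by_contra hj
  -- If `α` is not a jump, the `v j` lie in `V^{>α}`, and multiplication by `t_j` takes them to
  -- `V^{>α+1}`.
  obtain ⟨v, hv, rfl⟩ := (hα₀ α hα m).mp hm
  refine hgt ((gtSubgroup V hV.antitone (α + 1)).sum_mem fun j _ => ?_)
  refine hV.coord_smul_mem_gtPart j ?_
  by_contra h
  exact hj ⟨v j, hv j, h⟩

variable (t d) in
/-- The operator `∑_j ∂_{t_j} t_j - α`. -/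
def eulerSub (α : ℝ) : DiffOp A :=
  ∑ j, ofDer (d j) * ofFun (t j) - ofFun (algebraMap ℂ A (α : ℂ))

theorem eulerSub_add (α : ℝ) :
    eulerSub t d α + ofFun (algebraMap ℂ A (α : ℂ)) = euler t d :=
  Subtype.ext (sub_add_cancel _ _)

theorem eulerSub_eq (α : ℝ) :
    eulerSub t d α = euler t d + ofFun (algebraMap ℂ A (-(α : ℂ))) := by
  rw [← eulerSub_add α, add_assoc, ← map_add, ← map_add, add_neg_cancel, map_zero, map_zero,
    add_zero]

theorem eulerSub_mem (α : ℝ) : eulerSub t d α ∈ vZero (Ideal.span (Set.range t)) :=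
  (vZero _).sub_mem (euler_mem_vOrder t d) (ofFun_mem_vOrder_zero _)

theorem eulerSub_pow_mem_gtPart_of_le (hV : IsVFiltration t d V) {α : ℝ} {k l : ℕ} (hkl : k ≤ l)
    {m : M} (h : eulerSub t d α ^ k • m ∈ gtPart V α) : eulerSub t d α ^ l • m ∈ gtPart V α := by
  obtain ⟨n, rfl⟩ := Nat.exists_eq_add_of_le' hkl
  rw [pow_add, mul_smul]
  exact hV.smul_mem_gtPart ((vZero _).pow_mem (eulerSub_mem α) n) h

variable [DecidableEq ι]

/-- Since `[s, t_j] = t_j` for the Euler operator `s`, multiplication by `t_j` carries `s - α` on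
`Gr^α` to `s - (α + 1)` on `Gr^{α+1}`. -/
theorem eulerSub_mul_coord (hd : ∀ i j, d i (t j) = if i = j then 1 else 0) (α : ℝ) (j : ι) :
    eulerSub t d (α + 1) * ofFun (t j) = ofFun (t j) * eulerSub t d α := by
  have h1 : ∀ i, ofDer (d i) * ofFun (t i) * ofFun (t j)
      = ofFun (t j) * (ofDer (d i) * ofFun (t i)) + if i = j then ofFun (t i) else 0 := by
    intro i
    rw [mul_assoc, ← map_mul, mul_comm (t i), map_mul, ← mul_assoc, ofDer_mul_ofFun, hd, add_mul,
      mul_assoc]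
    split_ifs <;> simp
  have h2 : ofFun (t j) * ofFun (algebraMap ℂ A (-(α : ℂ)))
      = ofFun (t j) + ofFun (algebraMap ℂ A (-((α + 1 : ℝ) : ℂ))) * ofFun (t j) := by
    rw [← map_mul, ← map_mul, ← map_add]
    congr 1
    push_cast
    ring
  rw [eulerSub_eq, eulerSub_eq, euler, add_mul, mul_add, Finset.sum_mul,
    Finset.sum_congr rfl fun i _ => h1 i, Finset.sum_add_distrib, Finset.sum_ite_eq',
    if_pos (Finset.mem_univ _), Finset.mul_sum, h2, add_assoc]

theorem eulerSub_pow_mul_coord (hd : ∀ i j, d i (t j) = if i = j then 1 else 0) (α : ℝ) (k : ℕ)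
    (j : ι) : eulerSub t d (α + 1) ^ k * ofFun (t j) = ofFun (t j) * eulerSub t d α ^ k :=
  (show SemiconjBy (ofFun (t j)) (eulerSub t d α) (eulerSub t d (α + 1)) from
    (eulerSub_mul_coord hd α j).symm).pow_right k |>.symm

/-- The nilpotency orders are bounded on `α + ℕ`. -/
theorem exists_uniform_nilpotent (hV : IsVFiltration t d V)
    (hd : ∀ i j, d i (t j) = if i = j then 1 else 0) (α : ℝ) :
    ∃ k : ℕ, ∀ n : ℕ, ∀ m ∈ V (α + n), eulerSub t d (α + n) ^ k • m ∈ gtPart V (α + n) := by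
  obtain ⟨α₀, hα₀⟩ := hV.eventually
  -- From `N` on, each step is generated by the `t_j`, which transport nilpotency with the same
  -- exponent. The maximum over the indices up to `N` therefore suffices.
  obtain ⟨N, hN⟩ := exists_nat_ge (α₀ - α)
  choose k hk using fun n : ℕ => hV.nilpotent (α + n)
  refine ⟨(Finset.range (N + 1)).sup k, fun n => ?_⟩
  rcases le_total n N with hn | hn
  · intro m hm
    exact hV.eulerSub_pow_mem_gtPart_of_le
      (Finset.le_sup (Finset.mem_range.mpr (Nat.lt_succ_of_le hn))) (hk n m hm)
  · induction n, hn using Nat.le_induction with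
    | base =>
      intro m hm
      exact hV.eulerSub_pow_mem_gtPart_of_le
        (Finset.le_sup (Finset.mem_range.mpr (Nat.lt_succ_self N))) (hk N m hm)
    | succ n hn ih =>
      intro m hm
      have hNn : (N : ℝ) ≤ n := by exact_mod_cast hn
      rw [Nat.cast_succ, ← add_assoc] at hm ⊢
      obtain ⟨v, hv, rfl⟩ := (hα₀ _ (by linarith) m).mp hm
      rw [Finset.smul_sum]
      refine (gtSubgroup V hV.antitone _).sum_mem fun j _ => ?_
      rw [← mul_smul, eulerSub_pow_mul_coord hd, mul_smul]
      exact hV.coord_smul_mem_gtPart j (ih _ (hv j))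

end IsVFiltration

end Filtration

/-! ### The filtration `∑_ν V^{α+|ν|} M ⊗ ∂_u^ν` by coefficients. -/

section SumFiltration

variable {A : Type*} [CommRing A] [Algebra ℂ A] {κ : Type*} {h : κ → A} {M : Type*}
  [AddCommGroup M] [Module (DiffOp A) M] {V : ℝ → AddSubgroup M}

/-- The coefficient of `∂_u^ν`. -/
noncomputable def DirectImage.coeffAt (ν : κ →₀ ℕ) : DirectImage h M →+ M := Finsupp.applyAddHom ν

theorem DirectImage.coeffAt_tmul [DecidableEq κ] (μ ν : κ →₀ ℕ) (m : M) :
    coeffAt (h := h) μ (tmul h ν m) = if ν = μ then m else 0 :=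
  Finsupp.single_apply

theorem DirectImage.eq_sum (x : DirectImage h M) :
    x = ∑ ν ∈ Finsupp.support (M := M) x, tmul h ν (coeffAt ν x) :=
  (Finsupp.sum_single (M := M) x).symm

theorem tmul_mem_sumFiltration {α : ℝ} {ν : κ →₀ ℕ} {m : M} (hm : m ∈ V (α + (ν.degree : ℝ))) :
    DirectImage.tmul h ν m ∈ sumFiltration (h := h) V α :=
  AddSubgroup.mem_iSup_of_mem ν (AddSubgroup.mem_map_of_mem _ hm)

theorem sumFiltration_le {α : ℝ} {G : AddSubgroup (DirectImage h M)}
    (hG : ∀ ν : κ →₀ ℕ, ∀ m ∈ V (α + (ν.degree : ℝ)), DirectImage.tmul h ν m ∈ G) :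
    sumFiltration V α ≤ G := by
  refine iSup_le fun ν => ?_
  rintro _ ⟨m, hm, rfl⟩
  exact hG ν m hm

/-- The direct image is a direct sum of copies of `M` indexed by `ν`, and the filtration respects
this decomposition. Left continuity and the intersection with `M ⊗ 1` can then be checked on
coefficients. -/
theorem mem_sumFiltration_iff {α : ℝ} {x : DirectImage h M} :
    x ∈ sumFiltration V α ↔ ∀ ν : κ →₀ ℕ, DirectImage.coeffAt ν x ∈ V (α + (ν.degree : ℝ)) := by
  classical
  constructor
  · intro hx ν
    have : sumFiltration V α
        ≤ (V (α + (ν.degree : ℝ))).comap (DirectImage.coeffAt (h := h) ν) := by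
      refine sumFiltration_le fun μ m hm => ?_
      rw [AddSubgroup.mem_comap, DirectImage.coeffAt_tmul]
      split_ifs with e
      · exact e ▸ hm
      · exact zero_mem _
    exact this hx
  · intro hx
    rw [DirectImage.eq_sum x]
    exact sum_mem fun ν _ => tmul_mem_sumFiltration (hx ν)

theorem tmul_zero_mem_sumFiltration_iff {α : ℝ} {m : M} :
    DirectImage.tmul h 0 m ∈ sumFiltration (h := h) V α ↔ m ∈ V α := by
  classical
  constructor
  · intro hm
    have := mem_sumFiltration_iff.mp hm 0
    simpa [DirectImage.coeffAt_tmul] using this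
  · intro hm
    exact tmul_mem_sumFiltration (by simpa using hm)

theorem sumFiltration_antitone (hV : Antitone V) :
    Antitone (sumFiltration (h := h) V) := fun _ _ hαβ =>
  sumFiltration_le fun _ _ hm => tmul_mem_sumFiltration (hV (by linarith) hm)

theorem tmul_mem_gtPart {α : ℝ} {ν : κ →₀ ℕ} {m : M} (hm : m ∈ gtPart V (α + (ν.degree : ℝ))) :
    DirectImage.tmul h ν m ∈ gtPart (sumFiltration (h := h) V) α := by
  obtain ⟨β, hβ, hm⟩ := hm
  exact ⟨β - ν.degree, by linarith, tmul_mem_sumFiltration (by simpa using hm)⟩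

/-- If no `α + n` were a jump, each `V^{α+|ν|}` would equal `V^{>α+|ν|}`, and all summands would lie
in step `> α`. -/
theorem exists_mem_jumps_of_mem_jumps_sumFiltration (hV : Antitone V) {α : ℝ}
    (hα : α ∈ jumps (sumFiltration (h := h) V)) : ∃ n : ℕ, α + n ∈ jumps V := by
  by_contra! hj
  obtain ⟨x, hx, hgt⟩ := hα
  refine hgt (sumFiltration_le (G := gtSubgroup _ (sumFiltration_antitone hV) α)
    (fun ν m hm => tmul_mem_gtPart ?_) hx)
  by_contra hm'
  exact hj ν.degree ⟨m, hm, hm'⟩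

end SumFiltration

/-! ### The Euler operator and stability under operators of given order. -/

section SumFiltration

/-- A shortcut for the search of instances. -/
abbrev diffOpRing (A : Type*) [CommRing A] [Algebra ℂ A] : Ring (DiffOp A) := inferInstance

/-- A shortcut for the search of instances. -/
abbrev diffOpAddGroup (A : Type*) [CommRing A] [Algebra ℂ A] : AddGroup (DiffOp A) := inferInstance

attribute [local instance] diffOpRing diffOpAddGroup

open DirectImage

section Euler

variable {A : Type*} [CommRing A] [Algebra ℂ A] [Algebra.Smooth ℂ A] {ι κ : Type*} [Fintype ι]
  [Fintype κ] {h : κ → A} {t : ι → A} {d : ι → Derivation ℂ A A} {M : Type*} [AddCommGroup M]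
  [Module (DiffOp A) M]

theorem sum_smul_tmul_lower (ν : κ →₀ ℕ) (m : M) :
    ∑ j, ν j • tmul h (ν - Finsupp.single j 1 + Finsupp.single j 1) m
      = ν.degree • tmul h ν m := by
  rw [Finsupp.degree_eq_sum, Finset.sum_smul]
  refine Finset.sum_congr rfl fun j _ => ?_
  rcases Nat.eq_zero_or_pos (ν j) with h0 | h0
  · rw [h0, zero_smul, zero_smul]
  · rw [tsub_add_cancel_of_le (Finsupp.single_le_iff.mpr h0)]

variable (h t d) in
theorem ofDer_coeffDer_mul_ofFun_smul_tmul (i : ι) (ν : κ →₀ ℕ) (m : M) :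
    (ofDer (coeffDer (d i)) * ofFun (C (t i)) : DiffOp (MvPolynomial κ A)) • tmul h ν m
      = tmul h ν ((ofDer (d i) * ofFun (t i)) • m)
        - ∑ j, tmul h (ν + Finsupp.single j 1) (ofFun (d i (h j) * t i) • m) := by
  rw [mul_smul, ofFun_C_smul, ofDer_coeffDer_smul]
  simp only [← mul_smul, ← map_mul]

variable (h) in
theorem ofDer_partialDer_mul_ofFun_smul_tmul (j : κ) (ν : κ →₀ ℕ) (m : M) :
    (ofDer (partialDer j) * ofFun (X j) : DiffOp (MvPolynomial κ A)) • tmul h ν m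
      = tmul h (ν + Finsupp.single j 1) (ofFun (h j) • m)
        - ν j • tmul h (ν - Finsupp.single j 1 + Finsupp.single j 1) m := by
  rw [mul_smul, ofFun_X_smul, smul_sub, ofDer_partialDer_smul, smul_comm (ofDer _) (ν j),
    ofDer_partialDer_smul]

/-- `∑ ∂_{t_i} t_i + ∑ ∂_{u_j} u_j` acts on `m ⊗ ∂_u^ν` by `∑ ∂_{t_i} t_i - |ν|` on `m` if the
functions `h_j` are linear in `t`. -/
theorem euler_smul_tmul (hh : ∀ j, ∑ i, d i (h j) * t i = h j) (ν : κ →₀ ℕ) (m : M) :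
    euler (A := MvPolynomial κ A) (Sum.elim (fun i => C (t i)) X)
        (Sum.elim (fun i => coeffDer (d i)) partialDer) • tmul h ν m + ν.degree • tmul h ν m
      = tmul h ν (euler t d • m) := by
  -- The terms with `∂_{u_j} ∂_u^ν` that come from `∂_{t_i} t_i` cancel those from `∂_{u_j} u_j`, by
  -- Euler's identity for `h_j`. Only the contribution `-|ν|` of the lowering terms remains.
  have h3 : ∑ i, ∑ j, tmul h (ν + Finsupp.single j 1) (ofFun (d i (h j) * t i) • m)
      = ∑ j, tmul h (ν + Finsupp.single j 1) (ofFun (h j) • m) := by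
    rw [Finset.sum_comm]
    refine Finset.sum_congr rfl fun j _ => ?_
    rw [← map_sum, ← Finset.sum_smul, ← map_sum, hh]
  rw [euler, Fintype.sum_sum_type, add_smul, Finset.sum_smul, Finset.sum_smul]
  simp only [Sum.elim_inl, Sum.elim_inr, ofDer_coeffDer_mul_ofFun_smul_tmul,
    ofDer_partialDer_mul_ofFun_smul_tmul]
  rw [Finset.sum_sub_distrib, Finset.sum_sub_distrib, h3, sum_smul_tmul_lower, euler,
    Finset.sum_smul, map_sum]
  abel

/-- Tensoring with `∂_u^ν` lowers the eigenvalue of the Euler operator by `|ν|`. This is why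
`V^{α+|ν|} M ⊗ ∂_u^ν` belongs to step `α`. -/
theorem eulerSub_smul_tmul (hh : ∀ j, ∑ i, d i (h j) * t i = h j) (α : ℝ) (ν : κ →₀ ℕ) (m : M) :
    IsVFiltration.eulerSub (A := MvPolynomial κ A) (Sum.elim (fun i => C (t i)) X)
        (Sum.elim (fun i => coeffDer (d i)) partialDer) α • tmul h ν m
      = tmul h ν (IsVFiltration.eulerSub t d (α + ν.degree) • m) := by
  have h1 := euler_smul_tmul hh ν m
  rw [← IsVFiltration.eulerSub_add (t := t) (d := d) (α + ν.degree),
    ← IsVFiltration.eulerSub_add (A := MvPolynomial κ A) (t := Sum.elim (fun i => C (t i)) X)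
      (d := Sum.elim (fun i => coeffDer (d i)) partialDer) α, add_smul, add_smul, map_add] at h1
  have h2 : (ofFun (algebraMap ℂ _ (α : ℂ)) : DiffOp (MvPolynomial κ A))
      • tmul h ν m + ν.degree • tmul h ν m
      = tmul h ν (ofFun (algebraMap ℂ A ((α + ν.degree : ℝ) : ℂ)) • m) := by
    have e : algebraMap ℂ (MvPolynomial κ A) (α : ℂ) = C (algebraMap ℂ A (α : ℂ)) := rfl
    have e2 : (ofFun (algebraMap ℂ A ((α + ν.degree : ℝ) : ℂ)) : DiffOp A)
        = ofFun (algebraMap ℂ A (α : ℂ)) + (ν.degree : DiffOp A) := by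
      rw [Complex.ofReal_add, Complex.ofReal_natCast, map_add, map_add, map_natCast, map_natCast]
    rw [e, ofFun_C_smul, e2, add_smul, map_add, Nat.cast_smul_eq_nsmul, map_nsmul]
  rw [add_assoc, h2] at h1
  exact add_right_cancel h1

theorem eulerSub_pow_smul_tmul (hh : ∀ j, ∑ i, d i (h j) * t i = h j) (α : ℝ) (k : ℕ)
    (ν : κ →₀ ℕ) (m : M) :
    IsVFiltration.eulerSub (A := MvPolynomial κ A) (Sum.elim (fun i => C (t i)) X)
        (Sum.elim (fun i => coeffDer (d i)) partialDer) α ^ k • tmul h ν m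
      = tmul h ν (IsVFiltration.eulerSub t d (α + ν.degree) ^ k • m) := by
  induction k generalizing m with
  | zero => rw [pow_zero, pow_zero, one_smul, one_smul]
  | succ k ih => rw [pow_succ, mul_smul, eulerSub_smul_tmul hh, ih, ← mul_smul, ← pow_succ]

end Euler

variable {R : Type*} [CommRing R] [Algebra ℂ R] {ι κ : Type*} [Fintype ι]

theorem span_range_coords :
    Ideal.span (Set.range (coords (R := R) (ι := ι) (κ := κ)))
      = extIdeal (Ideal.span (Set.range X)) κ := by
  rw [coords, Set.Sum.elim_range, Ideal.span_union, extIdeal, Ideal.map_span, ← Set.range_comp]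
  rfl

theorem linearForms_mem (a : ι → κ → R) (j : κ) :
    linearForms a j ∈ Ideal.span (Set.range (X : ι → MvPolynomial ι R)) :=
  Ideal.sum_mem _ fun i _ => Ideal.mul_mem_left _ _ (Ideal.subset_span ⟨i, rfl⟩)

theorem coeffDer_linearForms (ξ : Derivation ℂ R R) (a : ι → κ → R) (j : κ) :
    coeffDer ξ (linearForms a j) = ∑ i, C (ξ (a i j)) * X i := by
  rw [linearForms, map_sum]
  refine Finset.sum_congr rfl fun i _ => ?_
  rw [Derivation.leibniz, coeffDer_X, coeffDer_C, smul_zero, zero_add, smul_eq_mul, mul_comm]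

theorem partialDer_linearForms (a : ι → κ → R) (i : ι) (j : κ) :
    partialDer i (linearForms a j) = C (a i j) := by
  classical
  rw [linearForms, map_sum, Finset.sum_eq_single i]
  · simp [Derivation.leibniz, partialDer_C, partialDer_X]
  · intro k _ hk
    simp [Derivation.leibniz, partialDer_C, partialDer_X, hk.symm]
  · simp

variable [Fintype κ] [Algebra.Smooth ℂ R] {a : ι → κ → R} {M : Type*} [AddCommGroup M]
  [Module (DiffOp (MvPolynomial ι R)) M] {V : ℝ → AddSubgroup M}

/-- The homogeneous operators of degree `d` that map `V^α` to `V^{α+d}`. -/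
def homogOps (W : ℝ → AddSubgroup (DirectImage (linearForms a) M)) (d : ℤ) :
    AddSubgroup (DiffOp (MvPolynomial κ (MvPolynomial ι R))) where
  carrier := {P | (∀ α, ∀ x ∈ W α, P • x ∈ W (α + d)) ∧ ∀ n p, IsHomog n p →
    IsHomog (n + d) ((P : Module.End ℂ (MvPolynomial κ (MvPolynomial ι R))) p)}
  zero_mem' := ⟨fun α x _ => by rw [zero_smul]; exact zero_mem _, fun n p _ => .zero _⟩
  add_mem' := fun {P Q} hP hQ => ⟨fun α x hx => by
    rw [add_smul]; exact add_mem (hP.1 α x hx) (hQ.1 α x hx),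
    fun n p hp => .add _ _ _ (hP.2 n p hp) (hQ.2 n p hp)⟩
  neg_mem' := fun {P} hP => ⟨fun α x hx => by
    rw [neg_smul]; exact neg_mem (hP.1 α x hx), fun n p hp => by
      exact (hP.2 n p hp).neg⟩

theorem mul_mem_homogOps {W : ℝ → AddSubgroup (DirectImage (linearForms a) M)} {d e : ℤ}
    {P Q : DiffOp (MvPolynomial κ (MvPolynomial ι R))} (hP : P ∈ homogOps W d)
    (hQ : Q ∈ homogOps W e) : P * Q ∈ homogOps W (d + e) := by
  refine ⟨fun α x hx => ?_, fun n p hp => ?_⟩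
  · rw [mul_smul]
    have := hP.1 _ _ (hQ.1 α x hx)
    rwa [add_assoc, add_comm (e : ℝ), ← Int.cast_add] at this
  · have := hP.2 _ _ (hQ.2 n p hp)
    rwa [add_assoc, add_comm e] at this

theorem smul_mem_of_tmul {V' : ℝ → AddSubgroup M} {P : DiffOp (MvPolynomial κ (MvPolynomial ι R))}
    {α β : ℝ} (h : ∀ ν : κ →₀ ℕ, ∀ m ∈ V' (α + (ν.degree : ℝ)),
      P • tmul (linearForms a) ν m ∈ sumFiltration (h := linearForms a) V' β) :
    ∀ x ∈ sumFiltration (h := linearForms a) V' α, P • x ∈ sumFiltration (h := linearForms a) V' β := by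
  have : sumFiltration V' α ≤ (sumFiltration V' β).comap
      (DistribSMul.toAddMonoidHom (DirectImage (linearForms a) M) P) :=
    sumFiltration_le h
  exact fun x hx => this hx

theorem ofFun_mem_homogOps {W : ℝ → AddSubgroup (DirectImage (linearForms a) M)} {d : ℤ}
    {p : MvPolynomial κ (MvPolynomial ι R)} (hp : IsHomog d p)
    (h : ∀ α, ∀ x ∈ W α, ofFun p • x ∈ W (α + d)) : ofFun p ∈ homogOps W d :=
  ⟨h, fun n q hq => by rw [add_comm]; exact .mul _ _ _ _ hp hq⟩

theorem ofFun_base_mem_homogOps (hV : IsVFiltration (A := MvPolynomial ι R) X partialDer V) (r : R) :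
    ofFun (C (C r)) ∈ homogOps (a := a) (κ := κ) (sumFiltration V) 0 := by
  refine ofFun_mem_homogOps (.base r) fun α => smul_mem_of_tmul fun ν m hm => ?_
  rw [Int.cast_zero, add_zero, ofFun_C_smul]
  exact tmul_mem_sumFiltration (hV.smul_mem_of_vOrder_zero (ofFun_mem_vOrder_zero _) hm)

/-- The coefficients are arbitrary because both `h_j = ∑ a_ij t_i` and its derivative `ξ(h_j) = ∑
ξ(a_ij) t_i` are needed. -/
theorem linearForms_smul_mem (hV : IsVFiltration (A := MvPolynomial ι R) X partialDer V) (b : ι → κ → R) (j : κ) {α : ℝ}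
    {m : M} (hm : m ∈ V α) : ofFun (linearForms b j) • m ∈ V (α + 1) := by
  simpa using hV.smul_mem 1 α _ (ofFun_mem_vOrder_one (linearForms_mem b j)) m hm

theorem ofFun_coords_mem_homogOps (hV : IsVFiltration (A := MvPolynomial ι R) X partialDer V) (k : ι ⊕ κ) :
    ofFun (coords k) ∈ homogOps (a := a) (κ := κ) (sumFiltration V) 1 := by
  refine ofFun_mem_homogOps (.coord k) fun α => smul_mem_of_tmul fun ν m hm => ?_
  rw [Int.cast_one]
  rcases k with i | j
  · change (ofFun (C (X i)) : DiffOp (MvPolynomial κ (MvPolynomial ι R))) • _ ∈ _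
    rw [ofFun_C_smul]
    refine tmul_mem_sumFiltration ?_
    rw [add_right_comm]
    exact hV.coord_smul_mem i hm
  · change (ofFun (X j) : DiffOp (MvPolynomial κ (MvPolynomial ι R))) • _ ∈ _
    rw [ofFun_X_smul]
    refine sub_mem (tmul_mem_sumFiltration ?_) ?_
    · rw [add_right_comm]; exact linearForms_smul_mem hV a j hm
    -- If `ν_j = 0`, the truncated `ν - single j 1` has not dropped in degree, but its coefficient
    -- vanishes.
    · rcases Nat.eq_zero_or_pos (ν j) with h0 | h0
      · rw [h0, zero_smul]; exact zero_mem _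
      · refine nsmul_mem (tmul_mem_sumFiltration ?_) _
        have : ν.degree = (ν - Finsupp.single j 1).degree + 1 := by
          have e := congrArg Finsupp.degree
            (tsub_add_cancel_of_le (Finsupp.single_le_iff.mpr (show 1 ≤ ν j from h0)))
          rw [← e, map_add, Finsupp.degree_single]
        rw [this, Nat.cast_succ] at hm
        rwa [add_assoc, add_comm 1]

theorem ofDer_mem_homogOps {W : ℝ → AddSubgroup (DirectImage (linearForms a) M)} {d : ℤ}
    {θ : Derivation ℂ (MvPolynomial κ (MvPolynomial ι R)) (MvPolynomial κ (MvPolynomial ι R))}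
    (hb : ∀ r, IsHomog d (θ (C (C r)))) (hc : ∀ k, IsHomog (1 + d) (θ (coords k)))
    (h : ∀ α, ∀ x ∈ W α, ofDer θ • x ∈ W (α + d)) : ofDer θ ∈ homogOps W d :=
  ⟨h, fun _ _ hp => hp.derivation hb hc⟩

/-- The lift of `ξ` kills the `t_i`, hence preserves `V` on `M`. In the corrections `ξ(h_j) m ⊗
∂_{u_j} ∂_u^ν` the degree `|ν|` grows by one, and `ξ(h_j)`, again linear in `t`, raises `V` by one
in compensation. -/
theorem ofDer_coeffDer_mem_homogOps (hV : IsVFiltration (A := MvPolynomial ι R) X partialDer V) (ξ : Derivation ℂ R R) :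
    ofDer (coeffDer (coeffDer ξ)) ∈ homogOps (a := a) (κ := κ) (sumFiltration V) 0 := by
  refine ofDer_mem_homogOps (fun r => ?_) (fun k => ?_) fun α => smul_mem_of_tmul fun ν m hm => ?_
  · rw [coeffDer_C, coeffDer_C]; exact .base _
  · rcases k with i | j
    · change IsHomog _ (coeffDer (coeffDer ξ) (C (X i)))
      rw [coeffDer_C, coeffDer_X, map_zero]; exact .zero _
    · change IsHomog _ (coeffDer (coeffDer ξ) (X j))
      rw [coeffDer_X]; exact .zero _
  · rw [Int.cast_zero, add_zero, ofDer_coeffDer_smul]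
    refine sub_mem (tmul_mem_sumFiltration (hV.smul_mem_of_vOrder_zero
      (ofDer_mem_vOrder_zero (derivation_mem_span ?_)) hm))
      (sum_mem fun j _ => tmul_mem_sumFiltration ?_)
    · rintro _ ⟨i, rfl⟩
      rw [coeffDer_X]; exact zero_mem _
    · rw [coeffDer_linearForms, map_add, Finsupp.degree_single, Nat.cast_succ, ← add_assoc]
      exact linearForms_smul_mem hV (fun i j => ξ (a i j)) j hm

/-- The field `∂_{u_j}` loses one step by raising `|ν|`. The field `∂_{t_i}` loses one step in `M`,
and its corrections `a_ij m ⊗ ∂_{u_j} ∂_u^ν` lose no more. -/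
theorem ofDer_coordFields_mem_homogOps (hV : IsVFiltration (A := MvPolynomial ι R) X partialDer V) (k : ι ⊕ κ) :
    ofDer (coordFields k) ∈ homogOps (a := a) (κ := κ) (sumFiltration V) (-1) := by
  classical
  have h1 : IsHomog 0 (1 : MvPolynomial κ (MvPolynomial ι R)) := by
    have := IsHomog.base (R := R) (ι := ι) (κ := κ) 1
    rwa [map_one, map_one] at this
  have hdeg : ∀ {α : ℝ} {ν : κ →₀ ℕ} {j : κ} {m : M}, m ∈ V (α + (ν.degree : ℝ)) →
      m ∈ V (α + ((-1 : ℤ) : ℝ) + ((ν + Finsupp.single j 1).degree : ℝ)) := by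
    intro α ν j m hm
    rw [map_add, Finsupp.degree_single]
    push_cast
    rwa [show α + -1 + ((ν.degree : ℝ) + 1) = α + ν.degree by ring]
  rcases k with i | j
  · refine ofDer_mem_homogOps (fun r => ?_) (fun k => ?_) fun α => smul_mem_of_tmul fun ν m hm => ?_
    · change IsHomog _ (coeffDer (partialDer i) (C (C r)))
      rw [coeffDer_C, partialDer_C, map_zero]; exact .zero _
    · rcases k with k | k
      · change IsHomog _ (coeffDer (partialDer i) (C (X k)))
        rw [coeffDer_C, partialDer_X]
        split_ifs
        · rw [map_one]; exact h1
        · rw [map_zero]; exact .zero _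
      · change IsHomog _ (coeffDer (partialDer i) (X k))
        rw [coeffDer_X]; exact .zero _
    · change ofDer (coeffDer (partialDer i)) • _ ∈ _
      rw [ofDer_coeffDer_smul]
      refine sub_mem (tmul_mem_sumFiltration ?_) (sum_mem fun j _ => tmul_mem_sumFiltration ?_)
      · rw [Int.cast_neg, Int.cast_one, add_right_comm]
        exact hV.der_smul_mem _ hm
      · rw [partialDer_linearForms]
        exact hdeg (hV.smul_mem_of_vOrder_zero (ofFun_mem_vOrder_zero _) hm)
  · refine ofDer_mem_homogOps (fun r => ?_) (fun k => ?_) fun α => smul_mem_of_tmul fun ν m hm => ?_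
    · change IsHomog _ (partialDer j (C (C r)))
      rw [partialDer_C]; exact .zero _
    · rcases k with k | k
      · change IsHomog _ (partialDer j (C (X k)))
        rw [partialDer_C]; exact .zero _
      · change IsHomog _ (partialDer j (X k))
        rw [partialDer_X]
        split_ifs
        · exact h1
        · exact .zero _
    · change ofDer (partialDer j) • _ ∈ _
      rw [ofDer_partialDer_smul]
      exact tmul_mem_sumFiltration (hdeg hm)

/-- Products of homogeneous operators with the required shift are again of this kind, so the sum of
all `homogOps` is a ring. It contains the generators. -/
theorem mem_iSup_homogOps (hV : IsVFiltration (A := MvPolynomial ι R) X partialDer V)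
    (P : DiffOp (MvPolynomial κ (MvPolynomial ι R))) :
    P ∈ ⨆ d, homogOps (a := a) (sumFiltration V) d := by
  have hle : ∀ {d P}, P ∈ homogOps (a := a) (κ := κ) (sumFiltration V) d →
      P ∈ ⨆ d, homogOps (a := a) (sumFiltration V) d := fun h => AddSubgroup.mem_iSup_of_mem _ h
  induction P using DiffOp.induction_poly_poly with
  | hb r => exact hle (ofFun_base_mem_homogOps hV r)
  | hc k => exact hle (ofFun_coords_mem_homogOps hV k)
  | hξ ξ => exact hle (ofDer_coeffDer_mem_homogOps hV ξ)
  | hd k => exact hle (ofDer_coordFields_mem_homogOps hV k)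
  | hadd P P' hP hP' => exact add_mem hP hP'
  | hmul P P' hP hP' =>
    refine AddSubgroup.iSup_induction (C := fun Q => Q * P' ∈ ⨆ d, homogOps (sumFiltration V) d) _
      hP (fun d Q hQ => ?_) (by rw [zero_mul]; exact zero_mem _)
      fun Q Q' h h' => by rw [add_mul]; exact add_mem h h'
    refine AddSubgroup.iSup_induction (C := fun Q' => Q * Q' ∈ ⨆ d, homogOps (sumFiltration V) d) _
      hP' (fun e Q' hQ' => ?_) (by rw [mul_zero]; exact zero_mem _)
      fun Q' Q'' h h' => by rw [mul_add]; exact add_mem h h'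
    exact hle (mul_mem_homogOps hQ hQ')

/-- Among the homogeneous components of an operator of order at least `j`, those of degree `d < j`
vanish. The others shift the filtration by `d ≥ j`. -/
theorem sumFiltration_smul_mem (hV : IsVFiltration (A := MvPolynomial ι R) X partialDer V) (j : ℤ) (α : ℝ)
    (P : DiffOp (MvPolynomial κ (MvPolynomial ι R)))
    (hP : P ∈ vOrder (Ideal.span (Set.range coords)) j)
    (x : DirectImage (linearForms a) M) (hx : x ∈ sumFiltration V α) :
    P • x ∈ sumFiltration V (α + j) := by
  obtain ⟨p, hp, rfl⟩ : ∃ p : ℤ →₀ DiffOp (MvPolynomial κ (MvPolynomial ι R)),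
      (∀ d, p d ∈ homogOps (a := a) (sumFiltration V) d) ∧ ∑ d ∈ p.support, p d = P := by
    classical
    clear hP
    refine AddSubgroup.iSup_induction (C := fun P => ∃ p : ℤ →₀ _,
      (∀ d, p d ∈ homogOps (a := a) (sumFiltration V) d) ∧ ∑ d ∈ p.support, p d = P) _
      (mem_iSup_homogOps (a := a) hV P) (fun d Q hQ => ?_) ⟨0, fun _ => zero_mem _, by simp⟩ ?_
    · refine ⟨Finsupp.single d Q, fun e => ?_, Finsupp.sum_single_index (h := fun _ b => b) rfl⟩
      rw [Finsupp.single_apply]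
      split_ifs with h
      · exact h ▸ hQ
      · exact zero_mem _
    · rintro _ _ ⟨p, hp, rfl⟩ ⟨q, hq, rfl⟩
      exact ⟨p + q, fun d => add_mem (hp d) (hq d),
        Finsupp.sum_add_index' (h := fun _ b => b) (fun _ => rfl) fun _ _ _ => rfl⟩
  rw [Finset.sum_smul]
  refine sum_mem fun d hd => ?_
  rcases lt_or_ge d j with h | h
  · rw [eq_zero_of_sum_mem_vOrder (fun d => (hp d).2) hP hd h, zero_smul]; exact zero_mem _
  · refine sumFiltration_antitone hV.antitone ?_ ((hp d).1 α x hx)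
    have : (j : ℝ) ≤ d := by exact_mod_cast h
    linarith

end SumFiltration

/-! ### Finiteness properties of the filtration and part (b). -/

section SumFiltration

open DirectImage

section General

variable {A : Type*} [CommRing A] [Algebra ℂ A] {κ : Type*} [Fintype κ] [Algebra.Smooth ℂ A]
  {h : κ → A} {M : Type*} [AddCommGroup M] [Module (DiffOp A) M]

theorem smul_mem_of_mem_vZero {I : Ideal A} (L : Submodule (vZero I) M) {P : DiffOp A}
    (hP : P ∈ vZero I) {x : M} (hx : x ∈ L) : P • x ∈ L :=
  L.smul_mem ⟨P, hP⟩ hx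

/-- From `m ⊗ 1` with `m` in a generating set, the operators `graphOp h P` produce all of `M ⊗ 1`,
and the `∂_u^ν` produce the rest. -/
theorem finite_directImage [Module.Finite (DiffOp A) M] :
    Module.Finite (DiffOp (MvPolynomial κ A)) (DirectImage h M) := by
  obtain ⟨s, hs⟩ := (Module.Finite.fg_top : (⊤ : Submodule (DiffOp A) M).FG)
  classical
  refine ⟨⟨s.image (tmul h 0), ?_⟩⟩
  rw [eq_top_iff]
  rintro x -
  induction x using DirectImage.induction with
  | h0 => exact zero_mem _
  | hadd x y hx hy => exact add_mem hx hy
  | ht ν m =>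
    rw [← partialOp_smul_tmul]
    refine Submodule.smul_mem _ _ ?_
    have hm : m ∈ Submodule.span (DiffOp A) (s : Set M) := hs ▸ Submodule.mem_top
    induction hm using Submodule.span_induction with
    | mem x hx =>
      exact Submodule.subset_span (Finset.mem_coe.mpr (Finset.mem_image_of_mem _ hx))
    | zero => rw [map_zero]; exact zero_mem _
    | add x y _ _ hx hy => rw [map_add]; exact add_mem hx hy
    | smul P x _ hx =>
      rw [← graphOp_smul_tmul]
      exact Submodule.smul_mem _ _ hx

variable {ι : Type*} [Fintype ι] {t : ι → A} {d : ι → Derivation ℂ A A} {V : ℝ → AddSubgroup M}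

/-- A jump `α` comes from a jump `α + n` of `V`. Jumps beyond `α₀` descend by one, so the least such
`n` is at most `N`, uniformly for `α ≥ b`. Hence finitely many translates of jump sets are enough.
-/
theorem finite_jumps_sumFiltration (hV : IsVFiltration t d V) (b c : ℝ) :
    (jumps (sumFiltration (h := h) V) ∩ Set.Icc b c).Finite := by
  obtain ⟨α₀, hα₀⟩ := hV.exists_jumps_of_add_one
  obtain ⟨N, hN⟩ := exists_nat_ge (α₀ - b)
  have hfin : (⋃ k ∈ Finset.range (N + 1),
      (fun γ => γ - (k : ℝ)) '' (jumps V ∩ Set.Icc (b + k) (c + k))).Finite :=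
    Set.Finite.biUnion (Finset.finite_toSet _) fun k _ => (hV.discrete _ _).image _
  refine hfin.subset fun α ⟨hα, hb, hc⟩ => ?_
  have hex := exists_mem_jumps_of_mem_jumps_sumFiltration hV.antitone hα
  classical
  have hk := Nat.find_spec hex
  have hkN : Nat.find hex < N + 1 := by
    by_contra hlt
    rw [not_lt] at hlt
    obtain ⟨n, hn⟩ := Nat.exists_eq_add_of_le' ((Nat.le_add_left 1 N).trans hlt)
    have hNn : (N : ℝ) ≤ n := by exact_mod_cast (by omega : N ≤ n)
    refine Nat.find_min hex (m := n) (by omega) (hα₀ _ (by linarith) ?_)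
    rw [hn, Nat.cast_succ, ← add_assoc] at hk
    exact hk
  simp only [Set.mem_iUnion]
  exact ⟨_, Finset.mem_range.mpr hkN, α + Nat.find hex,
    ⟨hk, by linarith, by linarith⟩, by simp⟩

end General

variable {R : Type*} [CommRing R] [Algebra ℂ R] {ι κ : Type*} [Fintype ι]
  [Fintype κ] [Algebra.Smooth ℂ R] {a : ι → κ → R} {M : Type*} [AddCommGroup M]
  [Module (DiffOp (MvPolynomial ι R)) M] {V : ℝ → AddSubgroup M}

/-- The submodule `V^α M'`. -/
noncomputable def sumSubmodule (hV : IsVFiltration (A := MvPolynomial ι R) X partialDer V) (α : ℝ) :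
    Submodule (vZero (Ideal.span (Set.range (coords (R := R) (ι := ι) (κ := κ)))))
      (DirectImage (linearForms a) M) where
  carrier := (sumFiltration V α : AddSubgroup (DirectImage (linearForms a) M))
  zero_mem' := zero_mem (sumFiltration V α)
  add_mem' := fun hx hy => add_mem (S := AddSubgroup (DirectImage (linearForms a) M)) hx hy
  smul_mem' P x hx := by
    have := sumFiltration_smul_mem hV 0 α P P.2 x hx
    rwa [Int.cast_zero, add_zero] at this

theorem graphOp_mem_vZero (a : ι → κ → R) {P : DiffOp (MvPolynomial ι R)}
    (hP : P ∈ vZero (Ideal.span (Set.range X))) :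
    graphOp (linearForms a) P
      ∈ vZero (Ideal.span (Set.range (coords (R := R) (ι := ι) (κ := κ)))) := by
  rw [span_range_coords]
  exact graphOp_mem_vOrder (linearForms a) (linearForms_mem a) hP

theorem ofDer_mul_ofFun_mem_vZero (i : ι) (j : κ) :
    ofDer (partialDer j) * ofFun (C (X i) : MvPolynomial κ (MvPolynomial ι R))
      ∈ vZero (Ideal.span (Set.range (coords (R := R) (ι := ι) (κ := κ)))) :=
  vOrder_mul (i := -1) (j := 1) (ofDer_mem_vOrder _) (ofFun_mem_vOrder_one
    (Ideal.subset_span (Set.mem_range_self (f := coords (R := R) (ι := ι) (κ := κ)) (Sum.inl i))))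

/-- A submodule over `V^0` contains `V^α M ⊗ ∂_u^ν` if it contains generators. -/
theorem tmul_mem_of_span {L : Submodule (vZero (Ideal.span (Set.range
    (coords (R := R) (ι := ι) (κ := κ))))) (DirectImage (linearForms a) M)} {s : Set M}
    {ν : κ →₀ ℕ} (hs : ∀ m ∈ s, tmul (linearForms a) ν m ∈ L) {m : M}
    (hm : m ∈ Submodule.span (vZero (Ideal.span (Set.range (X : ι → MvPolynomial ι R)))) s) :
    tmul (linearForms a) ν m ∈ L := by
  induction hm using Submodule.span_induction with
  | mem x hx => exact hs x hx
  | zero => rw [map_zero]; exact zero_mem _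
  | add x y _ _ hx hy => rw [map_add]; exact add_mem hx hy
  | smul P x _ hx =>
    have := smul_mem_of_mem_vZero L (graphOp_mem_vZero a P.2) hx
    rwa [graphOp_smul_tmul] at this

/-- One has `t_i m ⊗ ∂_{u_j} ∂_u^ν = ∂_{u_j} t_i (m ⊗ ∂_u^ν)`. The product `∂_{u_j} t_i` has order 0
although `∂_{u_j}` alone does not. -/
theorem tmul_add_single_mem {L : Submodule (vZero (Ideal.span (Set.range
    (coords (R := R) (ι := ι) (κ := κ))))) (DirectImage (linearForms a) M)} {ν : κ →₀ ℕ}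
    {v : ι → M} (hv : ∀ i, tmul (linearForms a) ν (v i) ∈ L) (j : κ) :
    tmul (linearForms a) (ν + Finsupp.single j 1)
      (∑ i, (ofFun (X i) : DiffOp (MvPolynomial ι R)) • v i) ∈ L := by
  rw [map_sum]
  refine sum_mem fun i _ => ?_
  have := smul_mem_of_mem_vZero L (ofDer_mul_ofFun_mem_vZero i j) (hv i)
  rwa [mul_smul, ofFun_C_smul, ofDer_partialDer_smul] at this

/-- Generators of `V^{α+|ν|} M` for `|ν| ≤ N` suffice. Once `α + |ν| ≥ α₀`, the relation
`V^{α+|ν|+1} M = ∑ t_i V^{α+|ν|} M` and `tmul_add_single_mem` yield the summands of the next degree.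
-/
theorem coherent_sumFiltration (hV : IsVFiltration (A := MvPolynomial ι R) X partialDer V) (α : ℝ) :
    ∃ L : Submodule (vZero (Ideal.span (Set.range (coords (R := R) (ι := ι) (κ := κ)))))
      (DirectImage (linearForms a) M), L.FG ∧ (L : Set (DirectImage (linearForms a) M))
        = (sumFiltration V α : AddSubgroup (DirectImage (linearForms a) M)) := by
  classical
  obtain ⟨α₀, hα₀⟩ := hV.eventually
  obtain ⟨N, hN⟩ := exists_nat_ge (α₀ - α)
  choose L hfg hL using hV.coherent
  choose s hs using hfg
  let T : Finset (κ →₀ ℕ) := (Finsupp.finite_of_degree_le (σ := κ) N).toFinset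
  have hT : ∀ ν : κ →₀ ℕ, ν ∈ T ↔ ν.degree ≤ N := fun ν => by simp [T]
  let G : Finset (DirectImage (linearForms a) M) :=
    T.biUnion fun ν => (s (α + (ν.degree : ℝ))).image (tmul (linearForms a) ν)
  refine ⟨Submodule.span _ (G : Set (DirectImage (linearForms a) M)), ⟨G, rfl⟩, ?_⟩
  refine Set.Subset.antisymm ?_ ?_
  · have hle : Submodule.span _ (G : Set (DirectImage (linearForms a) M))
        ≤ sumSubmodule (κ := κ) (a := a) hV α := by
      rw [Submodule.span_le]
      intro x hx
      obtain ⟨ν, _, hx⟩ := Finset.mem_biUnion.mp (Finset.mem_coe.mp hx)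
      obtain ⟨m, hm, rfl⟩ := Finset.mem_image.mp hx
      refine tmul_mem_sumFiltration ?_
      rw [← SetLike.mem_coe, ← hL, ← hs]
      exact Submodule.subset_span hm
    exact hle
  · have hle : sumFiltration V α ≤ (Submodule.span
        (vZero (Ideal.span (Set.range (coords (R := R) (ι := ι) (κ := κ)))))
        (G : Set (DirectImage (linearForms a) M))).toAddSubgroup := by
      refine sumFiltration_le fun ν => ?_
      have hsmall : ∀ ν : κ →₀ ℕ, ν.degree ≤ N → ∀ m ∈ V (α + (ν.degree : ℝ)),
          tmul (linearForms a) ν m ∈ Submodule.span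
            (vZero (Ideal.span (Set.range (coords (R := R) (ι := ι) (κ := κ)))))
            (G : Set (DirectImage (linearForms a) M)) := by
        intro ν hν m hm
        rw [← SetLike.mem_coe, ← hL, ← hs] at hm
        refine tmul_mem_of_span (fun x hx => ?_) hm
        refine Submodule.subset_span ?_
        exact Finset.mem_coe.mpr
          (Finset.mem_biUnion.mpr ⟨ν, (hT ν).mpr hν, Finset.mem_image_of_mem _ hx⟩)
      induction ν using finsupp_nat_induction with
      | h0 => exact hsmall 0 (by simp)
      | h1 ν j ih =>
        intro m hm
        by_cases hν : (ν + Finsupp.single j 1).degree ≤ N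
        · exact hsmall _ hν m hm
        · rw [map_add, Finsupp.degree_single] at hν hm
          have hNν : (N : ℝ) ≤ ν.degree := by exact_mod_cast (by omega : N ≤ ν.degree)
          rw [Nat.cast_succ, ← add_assoc] at hm
          obtain ⟨v, hv, rfl⟩ := (hα₀ _ (by linarith) m).mp hm
          exact tmul_add_single_mem (fun i => ih _ (hv i)) j
    exact hle

/-- Since `|ν| ≥ 0`, the bound `α₀` for `M` works for all `ν` at once. The coordinates `t_i` alone
suffice, so the components of `v` at the `u_j` are taken to be zero. -/
theorem eventually_sumFiltration (hV : IsVFiltration (A := MvPolynomial ι R) X partialDer V) :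
    ∃ α₀ : ℝ, ∀ α ≥ α₀, ∀ x : DirectImage (linearForms a) M, x ∈ sumFiltration V (α + 1) ↔
      ∃ v : ι ⊕ κ → DirectImage (linearForms a) M, (∀ k, v k ∈ sumFiltration V α) ∧
        x = ∑ k, (ofFun (coords k) : DiffOp (MvPolynomial κ (MvPolynomial ι R))) • v k := by
  obtain ⟨α₀, hα₀⟩ := hV.eventually
  refine ⟨α₀, fun α hα x => ⟨fun hx => ?_, ?_⟩⟩
  -- The possible sums form the range of a homomorphism, so it is enough to reach the elements `m ⊗
  -- ∂_u^ν`.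
  · let φ : (ι ⊕ κ → sumFiltration (h := linearForms a) V α) →+ DirectImage (linearForms a) M :=
      ∑ k, (DistribSMul.toAddMonoidHom (DirectImage (linearForms a) M)
        (ofFun (coords k) : DiffOp (MvPolynomial κ (MvPolynomial ι R)))).comp
        ((sumFiltration V α).subtype.comp (Pi.evalAddMonoidHom _ k))
    have hφ : ∀ v, φ v = ∑ k, (ofFun (coords k) : DiffOp (MvPolynomial κ (MvPolynomial ι R))) •
        (v k : DirectImage (linearForms a) M) := fun v => by
      rw [AddMonoidHom.finsetSum_apply]; rfl
    have hle : sumFiltration V (α + 1) ≤ φ.range := by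
      classical
      refine sumFiltration_le fun ν m hm => ?_
      rw [add_right_comm] at hm
      have h0 : (0 : ℝ) ≤ ν.degree := Nat.cast_nonneg _
      obtain ⟨v, hv, rfl⟩ := (hα₀ _ (by linarith) m).mp hm
      refine ⟨Sum.elim (fun i => ⟨tmul (linearForms a) ν (v i), tmul_mem_sumFiltration (hv i)⟩)
        fun _ => 0, ?_⟩
      rw [hφ, Fintype.sum_sum_type, map_sum]
      simp only [Sum.elim_inl, Sum.elim_inr, ZeroMemClass.coe_zero, smul_zero,
        Finset.sum_const_zero, add_zero]
      exact Finset.sum_congr rfl fun i _ => ofFun_C_smul _ _ _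
    obtain ⟨v, rfl⟩ := hle hx
    exact ⟨fun k => v k, fun k => (v k).2, hφ v⟩
  · rintro ⟨v, hv, rfl⟩
    refine sum_mem fun k _ => ?_
    have := sumFiltration_smul_mem hV 1 α (ofFun (coords k))
      (ofFun_mem_vOrder_one (Ideal.subset_span ⟨k, rfl⟩)) (v k) (hv k)
    rwa [Int.cast_one] at this

theorem sum_partialDer_linearForms_mul (a : ι → κ → R) (j : κ) :
    ∑ i, partialDer i (linearForms a j) * X i = linearForms a j := by
  simp only [partialDer_linearForms]; rfl

/-- On `m ⊗ ∂_u^ν` the operator acts as `s - (α + |ν|)` on `m`. The bound of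
`exists_uniform_nilpotent` makes a single exponent valid for all `ν`. -/
theorem nilpotent_sumFiltration (hV : IsVFiltration (A := MvPolynomial ι R) X partialDer V) (α : ℝ) :
    ∃ k : ℕ, ∀ x ∈ sumFiltration (h := linearForms a) V α,
      IsVFiltration.eulerSub (A := MvPolynomial κ (MvPolynomial ι R)) coords coordFields α ^ k • x
        ∈ gtPart (sumFiltration V) α := by
  classical
  obtain ⟨k, hk⟩ := hV.exists_uniform_nilpotent (fun i j => partialDer_X i j) α
  refine ⟨k, ?_⟩
  have hle : sumFiltration (h := linearForms a) V α
      ≤ (gtSubgroup _ (sumFiltration_antitone hV.antitone) α).comap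
        (DistribSMul.toAddMonoidHom (DirectImage (linearForms a) M)
          (IsVFiltration.eulerSub (A := MvPolynomial κ (MvPolynomial ι R)) coords coordFields α ^ k)) := by
    refine sumFiltration_le fun ν m hm => ?_
    have e : IsVFiltration.eulerSub (A := MvPolynomial κ (MvPolynomial ι R)) coords coordFields α ^ k
        • tmul (linearForms a) ν m = _ :=
      eulerSub_pow_smul_tmul (sum_partialDer_linearForms_mul a) α k ν m
    change IsVFiltration.eulerSub (A := MvPolynomial κ (MvPolynomial ι R)) coords coordFields α ^ k
      • tmul (linearForms a) ν m ∈ gtPart _ α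
    rw [e]
    exact tmul_mem_gtPart (hk _ m hm)
  exact hle

/-- This is part (b). It also supplies the filtrations on both iterated direct images in part (a).
-/
theorem isVFiltration_sumFiltration
    (hV : IsVFiltration (A := MvPolynomial ι R) X partialDer V) :
    IsVFiltration (A := MvPolynomial κ (MvPolynomial ι R)) (M := DirectImage (linearForms a) M)
      coords coordFields (sumFiltration V) where
  finite :=
    have := hV.finite
    finite_directImage
  antitone := sumFiltration_antitone hV.antitone
  exhaustive x := by
    induction x using DirectImage.induction with
    | h0 => exact ⟨0, zero_mem _⟩
    | hadd x y hx hy =>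
      obtain ⟨α, hα⟩ := hx
      obtain ⟨β, hβ⟩ := hy
      exact ⟨min α β, add_mem (sumFiltration_antitone hV.antitone (min_le_left _ _) hα)
        (sumFiltration_antitone hV.antitone (min_le_right _ _) hβ)⟩
    | ht ν m =>
      obtain ⟨α, hα⟩ := hV.exhaustive m
      exact ⟨α - ν.degree, tmul_mem_sumFiltration (by rwa [sub_add_cancel])⟩
  coherent := coherent_sumFiltration hV
  left_continuous α x hx := mem_sumFiltration_iff.mpr fun ν =>
    hV.left_continuous _ _ fun β hβ => by
      have := mem_sumFiltration_iff.mp (hx (β - ν.degree) (by linarith)) ν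
      rwa [sub_add_cancel] at this
  discrete := finite_jumps_sumFiltration hV
  rational α hα := by
    obtain ⟨n, hn⟩ := exists_mem_jumps_of_mem_jumps_sumFiltration hV.antitone hα
    obtain ⟨q, hq⟩ := hV.rational _ hn
    exact ⟨q - n, by push_cast; linarith⟩
  smul_mem := sumFiltration_smul_mem hV
  eventually := eventually_sumFiltration hV
  nilpotent := nilpotent_sumFiltration hV

end SumFiltration

/-! ### Exchange of coordinates and the elements `n ⊗ 1 ⊗ 1`. -/

section Comparison

attribute [local instance] diffOpRing diffOpAddGroup

open DirectImage

variable {R : Type*} [CommRing R] [Algebra ℂ R] {ι κ : Type*}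

variable (R ι κ) in
/-- The exchange of the coordinates `t` and `u`. -/
noncomputable def swapHom :
    MvPolynomial κ (MvPolynomial ι R) →+* MvPolynomial ι (MvPolynomial κ R) :=
  eval₂Hom (map C) fun j => C (X j)

theorem swapHom_base (r : R) : swapHom R ι κ (C (C r)) = C (C r) := by
  simp only [swapHom, coe_eval₂Hom, eval₂_C, map_C]

theorem swapHom_C_X (i : ι) : swapHom R ι κ (C (X i)) = X i := by
  simp only [swapHom, coe_eval₂Hom, eval₂_C, map_X]

theorem swapHom_X (j : κ) : swapHom R ι κ (X j) = C (X j) := by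
  simp only [swapHom, coe_eval₂Hom, eval₂_X]

theorem swapHom_comp_swapHom : (swapHom R κ ι).comp (swapHom R ι κ) = RingHom.id _ := by
  refine MvPolynomial.ringHom_ext' (MvPolynomial.ringHom_ext' (RingHom.ext fun r => ?_)
    fun i => ?_) fun j => ?_
  · change swapHom R κ ι (swapHom R ι κ (C (C r))) = C (C r)
    rw [swapHom_base, swapHom_base]
  · change swapHom R κ ι (swapHom R ι κ (C (X i))) = C (X i)
    rw [swapHom_C_X, swapHom_X]
  · change swapHom R κ ι (swapHom R ι κ (X j)) = X j
    rw [swapHom_X, swapHom_C_X]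

variable (R ι κ) in
/-- The exchange of the coordinates `t` and `u`, as an isomorphism. -/
noncomputable def swap :
    MvPolynomial κ (MvPolynomial ι R) ≃ₐ[ℂ] MvPolynomial ι (MvPolynomial κ R) :=
  AlgEquiv.ofRingEquiv
    (f := RingEquiv.ofRingHom (swapHom R ι κ) (swapHom R κ ι) swapHom_comp_swapHom
      swapHom_comp_swapHom)
    fun z => swapHom_base (algebraMap ℂ R z)

theorem swap_base (r : R) : swap R ι κ (C (C r)) = C (C r) := swapHom_base r

theorem swap_C_X (i : ι) : swap R ι κ (C (X i)) = X i := swapHom_C_X i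

theorem swap_X (j : κ) : swap R ι κ (X j) = C (X j) := swapHom_X j

theorem swap_symm_base (r : R) : (swap R ι κ).symm (C (C r)) = C (C r) := by
  rw [AlgEquiv.symm_apply_eq, swap_base]

theorem swap_symm_C_X (j : κ) : (swap R ι κ).symm (C (X j)) = X j := by
  rw [AlgEquiv.symm_apply_eq, swap_X]

theorem swap_symm_X (i : ι) : (swap R ι κ).symm (X i) = C (X i) := by
  rw [AlgEquiv.symm_apply_eq, swap_C_X]

theorem der_ext_base {θ η : Derivation ℂ (MvPolynomial κ (MvPolynomial ι R))
    (MvPolynomial κ (MvPolynomial ι R))} (hb : ∀ r, θ (C (C r)) = η (C (C r)))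
    (ht : ∀ i, θ (C (X i)) = η (C (X i))) (hu : ∀ j, θ (X j) = η (X j)) : θ = η := by
  refine der_ext (fun p => ?_) hu
  induction p using MvPolynomial.induction_on with
  | C r => exact hb r
  | add p q hp hq => rw [map_add, map_add, map_add, hp, hq]
  | mul_X p i hp => rw [map_mul, Derivation.leibniz, Derivation.leibniz, hp, ht]

theorem conjDer_swap_coeffDer_coeffDer (ξ : Derivation ℂ R R) :
    conjDer (swap R ι κ) (coeffDer (coeffDer ξ)) = coeffDer (coeffDer ξ) := by
  refine der_ext_base (fun r => ?_) (fun j => ?_) fun i => ?_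
  · rw [conjDer_apply, swap_symm_base, coeffDer_C, coeffDer_C, swap_base, coeffDer_C, coeffDer_C]
  · rw [conjDer_apply, swap_symm_C_X, coeffDer_X, coeffDer_C, coeffDer_X, map_zero, map_zero]
  · rw [conjDer_apply, swap_symm_X, coeffDer_C, coeffDer_X, coeffDer_X, map_zero, map_zero]

theorem conjDer_swap_coeffDer_partialDer (i : ι) :
    conjDer (swap R ι κ) (coeffDer (partialDer i)) = partialDer i := by
  classical
  refine der_ext_base (fun r => ?_) (fun j => ?_) fun k => ?_
  · rw [conjDer_apply, swap_symm_base, coeffDer_C, partialDer_C, map_zero, map_zero, partialDer_C]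
  · rw [conjDer_apply, swap_symm_C_X, coeffDer_X, map_zero, partialDer_C]
  · rw [conjDer_apply, swap_symm_X, coeffDer_C, partialDer_X, partialDer_X]
    split_ifs
    · rw [map_one, map_one]
    · rw [map_zero, map_zero]

theorem conjDer_swap_partialDer (j : κ) :
    conjDer (swap R ι κ) (partialDer j) = coeffDer (partialDer j) := by
  classical
  refine der_ext_base (fun r => ?_) (fun k => ?_) fun i => ?_
  · rw [conjDer_apply, swap_symm_base, partialDer_C, coeffDer_C, partialDer_C, map_zero, map_zero]
  · rw [conjDer_apply, swap_symm_C_X, coeffDer_C, partialDer_X, partialDer_X]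
    split_ifs
    · rw [map_one, map_one]
    · rw [map_zero, map_zero]
  · rw [conjDer_apply, swap_symm_X, partialDer_C, coeffDer_X, map_zero]

theorem swap_mem_vOrder {j : ℤ} {P : DiffOp (MvPolynomial κ (MvPolynomial ι R))}
    (hP : P ∈ vOrder (Ideal.span (Set.range coords)) j) :
    conj (swap R ι κ) P ∈ vOrder (Ideal.span (Set.range coords)) j := by
  refine conj_mem_vOrder (swap R ι κ) (Ideal.span_le.mpr ?_) (Ideal.span_le.mpr ?_) hP
  · rintro _ ⟨i | j, rfl⟩
    · have : X i ∈ Ideal.span (Set.range (coords (R := R) (ι := κ) (κ := ι))) :=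
        Ideal.subset_span (Set.mem_range_self (f := coords) (Sum.inr i))
      rwa [← swap_C_X] at this
    · have : C (X j) ∈ Ideal.span (Set.range (coords (R := R) (ι := κ) (κ := ι))) :=
        Ideal.subset_span (Set.mem_range_self (f := coords) (Sum.inl j))
      rwa [← swap_X] at this
  · rintro _ ⟨j | i, rfl⟩
    · have : X j ∈ Ideal.span (Set.range (coords (R := R) (ι := ι) (κ := κ))) :=
        Ideal.subset_span (Set.mem_range_self (f := coords) (Sum.inr j))
      rwa [← swap_symm_C_X] at this
    · have : C (X i) ∈ Ideal.span (Set.range (coords (R := R) (ι := ι) (κ := κ))) :=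
        Ideal.subset_span (Set.mem_range_self (f := coords) (Sum.inl i))
      rwa [← swap_symm_X] at this

variable [Fintype ι] [Fintype κ]

/-- The exchange only permutes the two groups of summands. With `swap_mem_vOrder` it provides the
hypotheses on `τ` in `IsVFiltration.map_mem`. -/
theorem swap_euler :
    conj (swap R ι κ) (euler coords coordFields) = euler coords coordFields := by
  have h1 : ∀ i, conj (swap R ι κ) (ofDer (coordFields (Sum.inl i)) * ofFun (coords (Sum.inl i)))
      = ofDer (coordFields (Sum.inr i)) * ofFun (coords (Sum.inr i)) := by
    intro i
    rw [map_mul, conj_ofDer, conj_ofFun]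
    exact congrArg₂ (fun θ p => ofDer θ * ofFun p) (conjDer_swap_coeffDer_partialDer i) (swap_C_X i)
  have h2 : ∀ j, conj (swap R ι κ) (ofDer (coordFields (Sum.inr j)) * ofFun (coords (Sum.inr j)))
      = ofDer (coordFields (Sum.inl j)) * ofFun (coords (Sum.inl j)) := by
    intro j
    rw [map_mul, conj_ofDer, conj_ofFun]
    exact congrArg₂ (fun θ p => ofDer θ * ofFun p) (conjDer_swap_partialDer j) (swap_X j)
  rw [euler, euler, Fintype.sum_sum_type, Fintype.sum_sum_type, map_add, map_sum, map_sum,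
    add_comm, Finset.sum_congr rfl fun i _ => h1 i, Finset.sum_congr rfl fun j _ => h2 j]

variable [Algebra.Smooth ℂ R] {N : Type*} [AddCommGroup N] [Module (DiffOp R) N]
  {f : ι → R} {g : κ → R} {a : ι → κ → R} {b : κ → ι → R}

theorem ofFun_X_smul_tmul_zero (i : ι) (n : N) :
    (ofFun (X i) : DiffOp (MvPolynomial ι R)) • tmul f 0 n = tmul f 0 (ofFun (f i) • n) := by
  rw [ofFun_X_smul, Finsupp.zero_apply, zero_smul, sub_zero]

theorem ofFun_linearForms_smul_tmul_zero (i : ι) (hf : f i = ∑ j, b j i * g j) (n : N) :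
    ofFun (linearForms b i) • tmul g 0 n = tmul g 0 (ofFun (f i) • n) := by
  rw [linearForms, map_sum, Finset.sum_smul, hf, map_sum, Finset.sum_smul, map_sum]
  refine Finset.sum_congr rfl fun j _ => ?_
  rw [map_mul, mul_smul, ofFun_X_smul_tmul_zero, ofFun_C_smul, map_mul, mul_smul]

variable (N g b) in
/-- The map `n ↦ n ⊗ 1 ⊗ 1`. -/
noncomputable def tmulZero : N →+ DirectImage (linearForms b) (DirectImage g N) :=
  (tmul (linearForms b) 0).comp (tmul g 0)

theorem base_smul_tmulZero (r : R) (n : N) :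
    (ofFun (C (C r)) : DiffOp (MvPolynomial ι (MvPolynomial κ R))) • tmulZero N g b n
      = tmulZero N g b (ofFun r • n) := by
  rw [tmulZero, AddMonoidHom.comp_apply, ofFun_C_smul, ofFun_C_smul]; rfl

theorem C_X_smul_tmulZero (j : κ) (n : N) :
    (ofFun (C (X j)) : DiffOp (MvPolynomial ι (MvPolynomial κ R))) • tmulZero N g b n
      = tmulZero N g b (ofFun (g j) • n) := by
  rw [tmulZero, AddMonoidHom.comp_apply, ofFun_C_smul, ofFun_X_smul_tmul_zero]; rfl

theorem X_smul_tmulZero (i : ι) (hf : f i = ∑ j, b j i * g j) (n : N) :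
    (ofFun (X i) : DiffOp (MvPolynomial ι (MvPolynomial κ R))) • tmulZero N g b n
      = tmulZero N g b (ofFun (f i) • n) := by
  rw [tmulZero, AddMonoidHom.comp_apply, ofFun_X_smul_tmul_zero,
    ofFun_linearForms_smul_tmul_zero i hf]; rfl

/-- The corrections come from `ξ(g_j)` and from `ξ` applied to the forms `∑ b_ji u_j`. The Leibniz
rule for `f_i = ∑ b_ji g_j` assembles them into the rule, symmetric in `f` and `g`, for the direct
image under `x ↦ (x, f(x), g(x))`. -/
theorem der_smul_tmulZero (hf : ∀ i, f i = ∑ j, b j i * g j) (ξ : Derivation ℂ R R) (n : N) :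
    tmulZero N g b (ofDer ξ • n)
      = (ofDer (coeffDer (coeffDer ξ)) : DiffOp (MvPolynomial ι (MvPolynomial κ R)))
          • tmulZero N g b n
        + ∑ i, (ofDer (partialDer i) : DiffOp (MvPolynomial ι (MvPolynomial κ R)))
          • tmulZero N g b (ofFun (ξ (f i)) • n)
        + ∑ j, (ofDer (coeffDer (partialDer j)) : DiffOp (MvPolynomial ι (MvPolynomial κ R)))
          • tmulZero N g b (ofFun (ξ (g j)) • n) := by
  have h1 : (ofDer (coeffDer (coeffDer ξ)) : DiffOp (MvPolynomial ι (MvPolynomial κ R)))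
      • tmulZero N g b n = tmulZero N g b (ofDer ξ • n)
        - ∑ j, tmul (linearForms b) 0 (tmul g (0 + Finsupp.single j 1) (ofFun (ξ (g j)) • n))
        - ∑ i, tmul (linearForms b) (0 + Finsupp.single i 1)
          (tmul g 0 (ofFun (∑ j, ξ (b j i) * g j) • n)) := by
    rw [tmulZero, AddMonoidHom.comp_apply, ofDer_coeffDer_smul, ofDer_coeffDer_smul, map_sub,
      map_sum]
    congr 1
    refine Finset.sum_congr rfl fun i _ => ?_
    rw [coeffDer_linearForms]
    exact congrArg _ (ofFun_linearForms_smul_tmul_zero (f := fun i => ∑ j, ξ (b j i) * g j)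
      (b := fun j i => ξ (b j i)) i rfl n)
  have h2 : ∀ i x, (ofDer (partialDer i) : DiffOp (MvPolynomial ι (MvPolynomial κ R)))
      • tmulZero N g b x = tmul (linearForms b) (0 + Finsupp.single i 1) (tmul g 0 x) :=
    fun i x => ofDer_partialDer_smul i 0 (tmul g 0 x)
  have h3 : ∀ j x, (ofDer (coeffDer (partialDer j)) : DiffOp (MvPolynomial ι (MvPolynomial κ R)))
      • tmulZero N g b x = tmul (linearForms b) 0 (tmul g (0 + Finsupp.single j 1) x)
        - ∑ i, tmul (linearForms b) (0 + Finsupp.single i 1) (tmul g 0 (ofFun (b j i) • x)) := by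
    intro j x
    rw [tmulZero, AddMonoidHom.comp_apply, ofDer_coeffDer_smul, ofDer_partialDer_smul]
    simp only [partialDer_linearForms, ofFun_C_smul]
  have h4 : ∀ i, ofFun (ξ (f i)) • n = ofFun (∑ j, ξ (b j i) * g j) • n
      + ∑ j, ofFun (b j i) • ofFun (ξ (g j)) • n := by
    intro i
    rw [hf, map_sum]
    simp only [Derivation.leibniz, smul_eq_mul, ← mul_smul, ← map_mul, ← Finset.sum_smul, ← map_sum,
      ← add_smul, ← map_add, ← Finset.sum_add_distrib]
    refine congrArg (fun r => ofFun r • n) (Finset.sum_congr rfl fun j _ => ?_)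
    ring
  have h5 : ∀ i, (ofDer (partialDer i) : DiffOp (MvPolynomial ι (MvPolynomial κ R)))
      • tmulZero N g b (ofFun (ξ (f i)) • n)
      = tmul (linearForms b) (0 + Finsupp.single i 1)
          (tmul g 0 (ofFun (∑ j, ξ (b j i) * g j) • n))
        + ∑ j, tmul (linearForms b) (0 + Finsupp.single i 1)
          (tmul g 0 (ofFun (b j i) • ofFun (ξ (g j)) • n)) := by
    intro i
    rw [h2, h4, map_add, map_add, map_sum (tmul g 0 : N →+ DirectImage g N), map_sum (tmul (linearForms b) (0 + Finsupp.single i 1) : DirectImage g N →+ _)]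
  rw [h1, Finset.sum_congr rfl fun i _ => h5 i, Finset.sum_congr rfl fun j _ => h3 j _,
    Finset.sum_add_distrib, Finset.sum_sub_distrib,
    Finset.sum_comm (s := (Finset.univ : Finset ι)) (t := (Finset.univ : Finset κ))]
  abel

variable (a) in
/-- The operators on `X × 𝔸^ι` as operators on `X × 𝔸^κ × 𝔸^ι` in the coordinates
`u_j - ∑_i a_ij t_i`. -/
noncomputable def swapGraphOp :
    DiffOp (MvPolynomial ι R) →ₐ[ℂ] DiffOp (MvPolynomial ι (MvPolynomial κ R)) :=
  (conj (swap R ι κ)).comp (graphOp (linearForms a))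

theorem swapGraphOp_apply (P : DiffOp (MvPolynomial ι R)) :
    swapGraphOp a P = conj (swap R ι κ) (graphOp (linearForms a) P) := rfl

theorem swap_C_linearForms_smul (hf : ∀ i, f i = ∑ j, b j i * g j) (c : ι → κ → R) (j : κ) (n : N) :
    ofFun (swap R ι κ (C (linearForms c j))) • tmulZero N g b n
      = tmulZero N g b (ofFun (∑ i, c i j * f i) • n) := by
  rw [linearForms, map_sum, map_sum, map_sum, map_sum, Finset.sum_smul, Finset.sum_smul, map_sum]
  refine Finset.sum_congr rfl fun i _ => ?_
  rw [map_mul, map_mul, swap_base, swap_C_X, map_mul, mul_smul, X_smul_tmulZero i (hf i),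
    base_smul_tmulZero, map_mul, mul_smul]

theorem commute_ofDer_coeffDer_partialDer (j : κ) (p : MvPolynomial ι R) :
    ofFun (swap R ι κ (C p)) * ofDer (coeffDer (partialDer j))
      = ofDer (coeffDer (partialDer j)) * ofFun (swap R ι κ (C p)) := by
  have := congrArg (conj (swap R ι κ)) (commute_ofDer_partialDer_ofFun (κ := κ) j p)
  rw [map_mul, map_mul, conj_ofFun, conj_ofDer, conjDer_swap_partialDer] at this
  exact this.symm

/-- The field `∂_{u_j}` stands on the left, as in the hypothesis on vector fields of
`DirectImage.exists_lift`. -/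
theorem swapGraphOp_ofDer (ξ : Derivation ℂ (MvPolynomial ι R) (MvPolynomial ι R)) :
    swapGraphOp a (ofDer ξ) = ofDer (conjDer (swap R ι κ) (coeffDer ξ))
      + ∑ j, ofDer (coeffDer (partialDer j)) * ofFun (swap R ι κ (C (ξ (linearForms a j)))) := by
  rw [swapGraphOp_apply, graphOp_ofDer, map_add, conj_ofDer, map_sum]
  refine congrArg _ (Finset.sum_congr rfl fun j _ => ?_)
  rw [map_mul, conj_ofFun, conj_ofDer, conjDer_swap_partialDer, commute_ofDer_coeffDer_partialDer]

end Comparison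

/-! ### The morphism between iterated direct images and part (a). -/

section Comparison

attribute [local instance] diffOpRing diffOpAddGroup

open DirectImage

variable {R : Type*} [CommRing R] [Algebra ℂ R] {ι κ : Type*} [Fintype ι] [Fintype κ]
  [Algebra.Smooth ℂ R] {N : Type*} [AddCommGroup N] [Module (DiffOp R) N]
  {f : ι → R} {g : κ → R} {a : ι → κ → R} {b : κ → ι → R}

theorem swapGraphOp_ofFun (p : MvPolynomial ι R) :
    swapGraphOp a (ofFun p) = ofFun (swap R ι κ (C p)) := by
  rw [swapGraphOp_apply, graphOp_ofFun, conj_ofFun]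

theorem swapGraphOp_partialDer_smul_tmulZero (i : ι) (n : N) :
    swapGraphOp a (ofDer (partialDer i)) • tmulZero N g b n
      = (ofDer (partialDer i) : DiffOp (MvPolynomial ι (MvPolynomial κ R))) • tmulZero N g b n
        + ∑ j, (ofDer (coeffDer (partialDer j)) : DiffOp (MvPolynomial ι (MvPolynomial κ R)))
          • tmulZero N g b (ofFun (a i j) • n) := by
  rw [swapGraphOp_ofDer, conjDer_swap_coeffDer_partialDer, add_smul, Finset.sum_smul]
  refine congrArg _ (Finset.sum_congr rfl fun j _ => ?_)
  rw [partialDer_linearForms, swap_base, mul_smul, base_smul_tmulZero]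

theorem swapGraphOp_coeffDer_smul_tmulZero (hf : ∀ i, f i = ∑ j, b j i * g j)
    (ξ : Derivation ℂ R R) (n : N) :
    swapGraphOp a (ofDer (coeffDer ξ)) • tmulZero N g b n
      = (ofDer (coeffDer (coeffDer ξ)) : DiffOp (MvPolynomial ι (MvPolynomial κ R)))
          • tmulZero N g b n
        + ∑ j, (ofDer (coeffDer (partialDer j)) : DiffOp (MvPolynomial ι (MvPolynomial κ R)))
          • tmulZero N g b (ofFun (∑ i, ξ (a i j) * f i) • n) := by
  rw [swapGraphOp_ofDer, conjDer_swap_coeffDer_coeffDer, add_smul, Finset.sum_smul]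
  refine congrArg _ (Finset.sum_congr rfl fun j _ => ?_)
  rw [coeffDer_linearForms, mul_smul]
  exact congrArg _ (swap_C_linearForms_smul hf (fun i j => ξ (a i j)) j n)

/-- The symmetric formula is regrouped: by the Leibniz rule for `g_j = ∑ a_ij f_i`, the terms in
`ξ(g_j)` are absorbed into the operators `swapGraphOp`. The result is the hypothesis on vector
fields of `DirectImage.exists_lift`. -/
theorem der_smul_tmulZero_eq (hf : ∀ i, f i = ∑ j, b j i * g j)
    (hg : ∀ j, g j = ∑ i, a i j * f i) (ξ : Derivation ℂ R R) (n : N) :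
    tmulZero N g b (ofDer ξ • n) = swapGraphOp a (ofDer (coeffDer ξ)) • tmulZero N g b n
      + ∑ i, swapGraphOp a (ofDer (partialDer i)) • tmulZero N g b (ofFun (ξ (f i)) • n) := by
  have h1 : ∀ j, ofFun (ξ (g j)) • n = ofFun (∑ i, ξ (a i j) * f i) • n
      + ∑ i, ofFun (a i j) • ofFun (ξ (f i)) • n := by
    intro j
    rw [hg, map_sum]
    simp only [Derivation.leibniz, smul_eq_mul, ← mul_smul, ← map_mul, ← Finset.sum_smul,
      ← map_sum, ← add_smul, ← map_add, ← Finset.sum_add_distrib]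
    refine congrArg (fun r => ofFun r • n) (Finset.sum_congr rfl fun j _ => ?_)
    ring
  have h2 : ∀ j, (ofDer (coeffDer (partialDer j)) : DiffOp (MvPolynomial ι (MvPolynomial κ R)))
      • tmulZero N g b (ofFun (ξ (g j)) • n)
      = (ofDer (coeffDer (partialDer j)) : DiffOp (MvPolynomial ι (MvPolynomial κ R)))
          • tmulZero N g b (ofFun (∑ i, ξ (a i j) * f i) • n)
        + ∑ i, (ofDer (coeffDer (partialDer j)) : DiffOp (MvPolynomial ι (MvPolynomial κ R)))
          • tmulZero N g b (ofFun (a i j) • ofFun (ξ (f i)) • n) := by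
    intro j
    rw [h1, map_add, smul_add, map_sum (tmulZero N g b), Finset.smul_sum]
  rw [der_smul_tmulZero hf, swapGraphOp_coeffDer_smul_tmulZero hf,
    Finset.sum_congr rfl fun i _ => swapGraphOp_partialDer_smul_tmulZero i _,
    Finset.sum_congr rfl fun j _ => h2 j, Finset.sum_add_distrib, Finset.sum_add_distrib,
    Finset.sum_comm (s := (Finset.univ : Finset ι)) (t := (Finset.univ : Finset κ))]
  abel

/-- First use of the universal property: `n ↦ n ⊗ 1 ⊗ 1` extends to `M_f`, whose operators act on
the target in the coordinates `u_j - ∑ a_ij t_i`. -/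
theorem exists_lift_tmulZero (hf : ∀ i, f i = ∑ j, b j i * g j) (hg : ∀ j, g j = ∑ i, a i j * f i) :
    ∃ φ : DirectImage f N →+ DirectImage (linearForms b) (DirectImage g N),
      (∀ n, φ (tmul f 0 n) = tmulZero N g b n) ∧ ∀ P x, φ (P • x) = swapGraphOp a P • φ x := by
  refine exists_lift (S := DiffOp (MvPolynomial ι (MvPolynomial κ R)))
    (swapGraphOp a).toRingHom (tmulZero N g b) (fun r n => ?_) (fun i n => ?_)
    (der_smul_tmulZero_eq hf hg)
  · change _ = swapGraphOp a _ • _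
    rw [swapGraphOp_ofFun, swap_base, base_smul_tmulZero]
  · change _ = swapGraphOp a _ • _
    rw [swapGraphOp_ofFun, swap_C_X, X_smul_tmulZero i (hf i)]

/-- The morphism between the direct images of the direct images of `N` defined by `f` and `g`. -/
theorem exists_hom_directImage (hf : ∀ i, f i = ∑ j, b j i * g j)
    (hg : ∀ j, g j = ∑ i, a i j * f i) :
    ∃ φ : DirectImage (linearForms a) (DirectImage f N) →+
        DirectImage (linearForms b) (DirectImage g N),
      (∀ n, φ (tmul (linearForms a) 0 (tmul f 0 n)) = tmul (linearForms b) 0 (tmul g 0 n)) ∧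
        ∀ P x, φ (P • x) = conj (swap R ι κ) P • φ x := by
  obtain ⟨φ₁, hφ₁, hφ₁'⟩ := exists_lift_tmulZero (N := N) hf hg
  have hX : ∀ j x, φ₁ (ofFun (linearForms a j) • x)
      = conj (swap R ι κ) (ofFun (X j)) • φ₁ x := by
    intro j x
    -- On `n ⊗ 1 ⊗ 1` this is `g_j = ∑ a_ij f_i`. It extends to the whole image of `φ₁` because `u_j
    -- - ∑ a_ij t_i` commutes with every `swapGraphOp a P`.
    have hw : conj (swap R ι κ) (ofFun (X j - C (linearForms a j))) • φ₁ x = 0 := by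
      induction x using DirectImage.induction with
      | h0 => rw [map_zero, smul_zero]
      | hadd x y hx hy => rw [map_add, smul_add, hx, hy, add_zero]
      | ht ν n =>
        rw [← partialOp_smul_tmul, hφ₁', swapGraphOp_apply, ← mul_smul, ← map_mul,
          ← graphOp_mul_X_sub, map_mul, mul_smul, hφ₁, conj_ofFun, map_sub, swap_X]
        have h1 : (ofFun (C (X j)) : DiffOp (MvPolynomial ι (MvPolynomial κ R)))
            • tmulZero N g b n = ofFun (swap R ι κ (C (linearForms a j))) • tmulZero N g b n := by
          rw [C_X_smul_tmulZero, swap_C_linearForms_smul hf, hg]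
        have h2 : (ofFun (C (X j)) : DiffOp (MvPolynomial ι (MvPolynomial κ R)))
            = ofFun (C (X j) - swap R ι κ (C (linearForms a j)))
              + ofFun (swap R ι κ (C (linearForms a j))) := by
          rw [← map_add, sub_add_cancel]
        rw [h2, add_smul, add_eq_right] at h1
        rw [h1, smul_zero]
    have h3 : ofFun (X j : MvPolynomial κ (MvPolynomial ι R))
        = ofFun (X j - C (linearForms a j)) + ofFun (C (linearForms a j)) := by
      rw [← map_add, sub_add_cancel]
    rw [h3, map_add, add_smul, hw, zero_add, hφ₁', swapGraphOp_apply, graphOp_ofFun]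
  have hC : ∀ p x, φ₁ (ofFun p • x) = conj (swap R ι κ) (ofFun (C p)) • φ₁ x := by
    intro p x
    rw [hφ₁', swapGraphOp_ofFun, conj_ofFun]
  have hξ : ∀ ξ x, φ₁ (ofDer ξ • x) = conj (swap R ι κ) (ofDer (coeffDer ξ)) • φ₁ x
      + ∑ j, conj (swap R ι κ) (ofDer (partialDer j))
        • φ₁ (ofFun (ξ (linearForms a j)) • x) := by
    intro ξ x
    rw [hφ₁', swapGraphOp_ofDer, add_smul, Finset.sum_smul, conj_ofDer]
    refine congrArg _ (Finset.sum_congr rfl fun j _ => ?_)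
    rw [mul_smul, conj_ofDer, conjDer_swap_partialDer, hφ₁', swapGraphOp_ofFun]
  -- Second use of the universal property, for the direct image of `M_f` under `u_j = ∑ a_ij t_i`.
  obtain ⟨φ, hφ, hφ'⟩ := exists_lift (S := DiffOp (MvPolynomial ι (MvPolynomial κ R)))
    (h := linearForms a) (conj (swap R ι κ)).toRingHom φ₁ hC hX hξ
  exact ⟨φ, fun n => by rw [hφ, hφ₁]; rfl, hφ'⟩

/-- Membership of `m ⊗ 1` in step `α` of the iterated direct image is membership of `m` in `V^α`, so
the question passes to modules between which there is a morphism. -/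
theorem tmul_mem_of_tmul_mem (hf : ∀ i, f i = ∑ j, b j i * g j)
    (hg : ∀ j, g j = ∑ i, a i j * f i) {V : ℝ → AddSubgroup (DirectImage f N)}
    {V' : ℝ → AddSubgroup (DirectImage g N)}
    (hV : IsVFiltration (A := MvPolynomial ι R) X partialDer V)
    (hV' : IsVFiltration (A := MvPolynomial κ R) X partialDer V') {α : ℝ} {n : N}
    (hn : tmul f 0 n ∈ V α) : tmul g 0 n ∈ V' α := by
  obtain ⟨φ, hφ, hφ'⟩ := exists_hom_directImage (N := N) hf hg
  have h1 : tmul (linearForms a) 0 (tmul f 0 n) ∈ sumFiltration V α :=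
    tmul_zero_mem_sumFiltration_iff.mpr hn
  have h2 := (isVFiltration_sumFiltration (a := a) hV).map_mem
    (isVFiltration_sumFiltration (a := b) hV') (conj (swap R ι κ)) (fun _ _ => swap_mem_vOrder)
    swap_euler φ hφ' h1
  rw [hφ] at h2
  exact tmul_zero_mem_sumFiltration_iff.mp h2

/-- The matrices expressing the two systems of generators by each other need not be inverse to one
another. Each inclusion uses both matrices, with their roles exchanged. -/
theorem comap_eq_of_span_eq (h : Ideal.span (Set.range f) = Ideal.span (Set.range g))
    {V : ℝ → AddSubgroup (DirectImage f N)} {V' : ℝ → AddSubgroup (DirectImage g N)}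
    (hV : IsVFiltration (A := MvPolynomial ι R) X partialDer V)
    (hV' : IsVFiltration (A := MvPolynomial κ R) X partialDer V') (α : ℝ) :
    (V α).comap (tmul f 0) = (V' α).comap (tmul g 0) := by
  have h1 : ∀ i, ∃ c : κ → R, ∑ j, c j * g j = f i := fun i => by
    have : f i ∈ Ideal.span (Set.range g) := h ▸ Ideal.subset_span ⟨i, rfl⟩
    exact (Ideal.mem_span_range_iff_exists_fun).mp this
  have h2 : ∀ j, ∃ c : ι → R, ∑ i, c i * f i = g j := fun j => by
    have : g j ∈ Ideal.span (Set.range f) := h ▸ Ideal.subset_span ⟨j, rfl⟩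
    exact (Ideal.mem_span_range_iff_exists_fun).mp this
  choose b hb using h1
  choose a ha using h2
  ext n
  exact ⟨tmul_mem_of_tmul_mem (b := fun j i => b i j) (a := fun i j => a j i)
      (fun i => (hb i).symm) (fun j => (ha j).symm) hV hV',
    tmul_mem_of_tmul_mem (b := fun i j => a j i) (a := fun j i => b i j)
      (fun j => (ha j).symm) (fun i => (hb i).symm) hV' hV⟩

end Comparison

end DMod

theorem mainTheorem5 (X : Scheme.{0}) [X.Over (Spec (.of ℂ))] [Smooth (X ↘ Spec (.of ℂ))]
    [IsSeparated (X ↘ Spec (.of ℂ))] [QuasiCompact (X ↘ Spec (.of ℂ))]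
    (I : X.IdealSheafData) {r r' : ℕ} (f : Fin r → Γ(X, ⊤)) (g : Fin r' → Γ(X, ⊤))
    (hf : Generates f I) (hg : Generates g I) (N : DModule X) :
    (∀ W W' : ∀ U : X.affineOpens, ℝ → AddSubgroup (N.obj U),
      IsVFiltrationOf f N W → IsVFiltrationOf g N W' → W = W') ∧
    (∀ (U : X.affineOpens) (a : Fin r → Fin r' → Fn X U),
      (∀ j, restrict g U j = ∑ i, a i j * restrict f U i) →
      ∀ V : ℝ → AddSubgroup (GraphImage f N U),
        IsVFiltration (A := MvPolynomial (Fin r) (Fn X U)) MvPolynomial.X partialDer V →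
        IsVFiltration (A := MvPolynomial (Fin r') (MvPolynomial (Fin r) (Fn X U)))
          (M := DirectImage (linearForms a) (GraphImage f N U))
          coords coordFields (sumFiltration V)) := by
  refine ⟨?_, fun U a _ V hV => isVFiltration_sumFiltration hV⟩
  rintro W W' ⟨V, hV, hW⟩ ⟨V', hV', hW'⟩
  -- The comparison is made on each affine open subset separately, where both systems span the ideal
  -- given by `I`.
  funext U α
  rw [hW, hW']
  have h : Ideal.span (Set.range (restrict f U)) = Ideal.span (Set.range (restrict g U)) :=
    (hf U).symm.trans (hg U)
  exact comap_eq_of_span_eq h (hV.isVFiltration U) (hV'.isVFiltration U) α
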